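/- Let $\mathbf{k}$ be a field containing $\mathbb{Q}(q)$, let $l\ge 0$, and write $\mathbf{k}[x^{\pm1}]=\mathbf{k}[x_1^{\pm 1},\dots,x_l^{\pm 1}]$, with $x^\lambda=x_1^{\lambda_1}\cdots x_l^{\lambda_l}$ for $\lambda\in\mathbb{Z}^l$. The group $S_l$ acts by $(w\lambda)_{w(i)}=\lambda_i$ and $w(x^\lambda)=x^{w\lambda}$. **Twisted non-symmetric Hall–Littlewood polynomials.** Let $T_i=q\,s_i+(1-q)\frac{1}{1-x_{i+1}/x_i}(s_i-1)$ for $1\le i<l$ be the Demazure–Lusztig operators on $\mathbf{k}[x^{\pm1}]$, and let $T_w=T_{i_1}\cdots T_{i_m}$ for a reduced expression $w=s_{i_1}\cdots s_{i_m}$. For $\lambda\in\mathbb{Z}^l$ let $\lambda_+$ be the dominant (weakly decreasing) weight in its $S_l$-orbit, and put $E_\lambda(x;q)=q^{-\ell(w)}T_w x^{\lambda_+}$, where $\lambda=w(\lambda_+)$. For $\sigma\in S_l$ put $$E^\sigma_\lambda(x;q)=q^{e}\,T_{\sigma^{-1}}^{-1}E_{\sigma^{-1}(\lambda)}(x;q),\qquad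 e=\#\{i<j:\ \sigma^{-1}(i)>\sigma^{-1}(j),\ \lambda_i\ge\lambda_j\}.$$ **LLT series.** Let $\chi_\lambda$ be the irreducible character of $GL_l$ with dominant highest weight $\lambda$. For $\alpha,\beta\in\mathbb{Z}^l$ and $\sigma\in S_l$, the LLT series $\mathcal{L}^\sigma_{\beta/\alpha}(x;q)$ is the infinite formal sum of characters $\chi_\lambda$ in which the coefficient of $\chi_\lambda$ is the coefficient of $E^{\sigma^{-1}}_\beta(x;q^{-1})$ in the expansion of $\chi_\lambda\cdot E^{\sigma^{-1}}_\alpha(x;q^{-1})$ on the family $\{E^{\sigma^{-1}}_\mu(x;q^{-1})\}_{\mu\in\mathbb{Z}^l}$. Its polynomial part $\mathcal{L}^\sigma_{\beta/\alpha}(x;q)_{\mathrm{pol}}$ is the partial sum over the polynomial weights $\lambda_1\ge\dots\ge\lambda_l\ge0$, regarded as a formal power series in $x_1,\dots,x_l$. **LLT polynomials.** The content of a box in column $i$ and row $j$ is $i-j$. In a tuple $\nu=(\nu^{(1)},\dots,\nu^{(k)})$ of skew diagrams, boxes $a\in\nu^{(i)}$, $b\in\nu^{(j)}$ form an attacking pair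 with $a$ preceding $b$ if either $c(a)=c(b)$ and $i<j$, or $c(b)=c(a)+1$ and $i>j$. For a semistandard tableau $T$ on $\nu$ (weakly increasing along rows and strictly increasing along columns on each component), $\mathrm{inv}(T)$ is the number of such pairs with $T(a)>T(b)$, and $\mathcal{G}_\nu(x_1,\dots,x_l;q)=\sum_T q^{\mathrm{inv}(T)}\prod_{a\in\nu}x_{T(a)}$, summed over the semistandard $T$ with entries in $\{1,\dots,l\}$. **Triples.** If $\alpha_j\le\beta_j$ for all $j$, let $\beta/\alpha$ be the tuple of one-row diagrams $(\beta_j)/(\alpha_j)$, the boxes of row $j$ having coordinates $\alpha_j+1,\dots,\beta_j$, and let $\sigma(\beta/\alpha)=\sigma(\beta)/\sigma(\alpha)$. For a box $a$ in or adjacent to row $j(a)$, with coordinate $i(a)$ satisfying $\alpha_{j(a)}\le i(a)\le\beta_{j(a)}+1$, order boxes lexicographically by $(i(a),\sigma(j(a)))$. A $\sigma$-triple in $\beta/\alpha$ is a triple $(a,b,c)$ with $j(a)=j(c)$, $i(c)=i(a)+1$, $j(b)<j(a)$ and $a<b<c$, where $b$ is a box of $\beta/\alpha$, while $a$ may be the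 position adjacent to the left end of its row and $c$ the position adjacent to the right end. Let $h_\sigma(\beta/\alpha)$ be the number of $\sigma$-triples in $\beta/\alpha$. **Statement.** For all $\alpha,\beta\in\mathbb{Z}^l$ and $\sigma\in S_l$, the polynomials $E^{\sigma^{-1}}_\mu(x;q^{-1})$, $\mu\in\mathbb{Z}^l$, form a $\mathbf{k}$-basis of $\mathbf{k}[x^{\pm1}]$ (so that the LLT series is well defined), and $$\mathcal{L}^\sigma_{\beta/\alpha}(x;q)_{\mathrm{pol}}=\begin{cases}q^{h_\sigma(\beta/\alpha)}\,\mathcal{G}_{\sigma(\beta/\alpha)}(x_1,\dots,x_l;q^{-1})&\text{if }\alpha_i\le\beta_i\text{ for all }i,\\ 0&\text{otherwise.}\end{cases}$$ -/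

import Mathlib

noncomputable section

namespace LLT

/-! ### Weights and Laurent polynomials -/

/-- The weight lattice `ℤ^l` of `GL_l`. -/
abbrev Weight (l : ℕ) : Type := Fin l → ℤ

/-- Laurent polynomials `𝕜[x₁^{±1}, …, x_l^{±1}]`, the group algebra of the weight lattice. -/
abbrev LaurentPoly (𝕜 : Type*) [Field 𝕜] (l : ℕ) : Type _ := AddMonoidAlgebra 𝕜 (Weight l)

/-- The Laurent monomial `x^μ`. -/
def mono (𝕜 : Type*) [Field 𝕜] {l : ℕ} (μ : Weight l) : LaurentPoly 𝕜 l :=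
  AddMonoidAlgebra.single μ 1

/-- The linear operator on Laurent polynomials with prescribed values on the monomials. -/
def extendLinear {𝕜 : Type*} [Field 𝕜] {l : ℕ} (F : Weight l → LaurentPoly 𝕜 l) :
    Module.End 𝕜 (LaurentPoly 𝕜 l) :=
  (Finsupp.linearCombination 𝕜 F) ∘ₗ (AddMonoidAlgebra.coeffLinearEquiv 𝕜).toLinearMap

/-- The action of `w ∈ S_l` on weights, permuting coordinates: `(w μ)_{w(i)} = μ_i`. -/
def permAct {l : ℕ} (w : Equiv.Perm (Fin l)) (μ : Weight l) : Weight l := fun i => μ (w⁻¹ i)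

/-- The action of `w ∈ S_l` on Laurent polynomials: `w (x^μ) = x^{w μ}`. -/
def permOp (𝕜 : Type*) [Field 𝕜] {l : ℕ} (w : Equiv.Perm (Fin l)) :
    Module.End 𝕜 (LaurentPoly 𝕜 l) :=
  extendLinear fun μ => mono 𝕜 (permAct w μ)

theorem extendLinear_mono {𝕜 : Type*} [Field 𝕜] {l : ℕ} (F : Weight l → LaurentPoly 𝕜 l)
    (μ : Weight l) : extendLinear F (mono 𝕜 μ) = F μ := by
  simp [extendLinear, mono]

theorem mono_mul_mono (𝕜 : Type*) [Field 𝕜] {l : ℕ} (μ ν : Weight l) :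
    mono 𝕜 μ * mono 𝕜 ν = mono 𝕜 (μ + ν) := by
  simp [mono, AddMonoidAlgebra.single_mul_single]

theorem mono_zero (𝕜 : Type*) [Field 𝕜] {l : ℕ} : mono 𝕜 (0 : Weight l) = 1 := rfl

/-- Two linear operators on Laurent polynomials agreeing on monomials are equal. -/
theorem linearMap_ext {𝕜 : Type*} [Field 𝕜] {l : ℕ} {f g : Module.End 𝕜 (LaurentPoly 𝕜 l)}
    (h : ∀ μ, f (mono 𝕜 μ) = g (mono 𝕜 μ)) : f = g := by
  apply LinearMap.ext
  intro x
  induction x using AddMonoidAlgebra.induction_linear with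
  | zero => simp
  | add a b ha hb => rw [map_add, map_add, ha, hb]
  | single μ a =>
    have e : (AddMonoidAlgebra.single μ a : LaurentPoly 𝕜 l) = a • mono 𝕜 μ := by
      simp [mono]
    rw [e, map_smul, map_smul, h]

/-! ### Demazure–Lusztig operators and the operators `T_w` -/

/-- The index `i` (0-based) in the pair of consecutive indices `i, i + 1`. -/
def lo {l : ℕ} (k : Fin (l - 1)) : Fin l := ⟨k, by omega⟩

/-- The index `i + 1` (0-based) in the pair of consecutive indices `i, i + 1`. -/
def hi {l : ℕ} (k : Fin (l - 1)) : Fin l := ⟨k + 1, by omega⟩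

/-- The simple transposition `s_k`. -/
def simpleRefl {l : ℕ} (k : Fin (l - 1)) : Equiv.Perm (Fin l) := Equiv.swap (lo k) (hi k)

/-- The simple root `α_k = ε_k - ε_{k+1}`. -/
def simpleRoot {l : ℕ} (k : Fin (l - 1)) : Weight l := Pi.single (lo k) 1 - Pi.single (hi k) 1

/-- The operator `f ↦ (s_k f - f) / (1 - x_{k+1}/x_k)`, given on monomials by the geometric sum
which results from the division; see `one_sub_mul_divDiff`. -/
def divDiff (𝕜 : Type*) [Field 𝕜] {l : ℕ} (k : Fin (l - 1)) : Module.End 𝕜 (LaurentPoly 𝕜 l) :=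
  extendLinear fun μ =>
    (∑ m ∈ Finset.range (μ (hi k) - μ (lo k)).toNat, mono 𝕜 (μ + ((m : ℤ) + 1) • simpleRoot k))
      - ∑ m ∈ Finset.range (μ (lo k) - μ (hi k)).toNat, mono 𝕜 (μ - (m : ℤ) • simpleRoot k)

theorem permAct_simpleRefl {l : ℕ} (k : Fin (l - 1)) (μ : Weight l) :
    permAct (simpleRefl k) μ = μ - (μ (lo k) - μ (hi k)) • simpleRoot k := by
  have hne : lo k ≠ hi k := by simp [lo, hi]
  funext i
  simp only [permAct, simpleRefl, Equiv.swap_inv, simpleRoot, Pi.sub_apply, Pi.smul_apply,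
    smul_eq_mul]
  by_cases h1 : i = lo k
  · subst h1; simp [hne]
  · by_cases h2 : i = hi k
    · subst h2; simp [hne.symm]
    · rw [Equiv.swap_apply_of_ne_of_ne h1 h2]; simp [h1, h2]

/-- The defining property of `divDiff`: `(1 - x_{k+1}/x_k) · divDiff f = s_k f - f`. -/
theorem one_sub_mul_divDiff (𝕜 : Type*) [Field 𝕜] {l : ℕ} (k : Fin (l - 1))
    (f : LaurentPoly 𝕜 l) :
    (1 - mono 𝕜 (-simpleRoot k)) * divDiff 𝕜 k f = permOp 𝕜 (simpleRefl k) f - f := by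
  suffices h : (LinearMap.mulLeft 𝕜 (1 - mono 𝕜 (-simpleRoot k))) ∘ₗ divDiff 𝕜 k
      = permOp 𝕜 (simpleRefl k) - LinearMap.id from congrArg (fun g => g f) h
  apply linearMap_ext
  intro μ
  simp only [LinearMap.comp_apply, LinearMap.mulLeft_apply, LinearMap.sub_apply,
    LinearMap.id_apply, divDiff, permOp, extendLinear_mono, permAct_simpleRefl]
  have up : ∀ n : ℕ, (1 - mono 𝕜 (-simpleRoot k)) *
      ∑ m ∈ Finset.range n, mono 𝕜 (μ + ((m : ℤ) + 1) • simpleRoot k)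
      = mono 𝕜 (μ + (n : ℤ) • simpleRoot k) - mono 𝕜 μ := by
    intro n
    induction n with
    | zero => simp
    | succ n ih =>
      rw [Finset.sum_range_succ, mul_add, ih, sub_mul, one_mul, mono_mul_mono]
      have e : -simpleRoot k + (μ + ((n : ℤ) + 1) • simpleRoot k)
          = μ + (n : ℤ) • simpleRoot k := by module
      rw [e]; push_cast; abel
  have down : ∀ n : ℕ, (1 - mono 𝕜 (-simpleRoot k)) *
      ∑ m ∈ Finset.range n, mono 𝕜 (μ - (m : ℤ) • simpleRoot k)
      = mono 𝕜 μ - mono 𝕜 (μ - (n : ℤ) • simpleRoot k) := by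
    intro n
    induction n with
    | zero => simp
    | succ n ih =>
      rw [Finset.sum_range_succ, mul_add, ih, sub_mul, one_mul, mono_mul_mono]
      have e : -simpleRoot k + (μ - (n : ℤ) • simpleRoot k)
          = μ - ((n + 1 : ℕ) : ℤ) • simpleRoot k := by push_cast; module
      rw [e]; abel
  rw [mul_sub, up, down]
  rcases le_total (μ (lo k)) (μ (hi k)) with h | h
  · have e1 : (((μ (hi k) - μ (lo k)).toNat : ℕ) : ℤ) = μ (hi k) - μ (lo k) :=
      Int.toNat_of_nonneg (by omega)
    have e2 : (((μ (lo k) - μ (hi k)).toNat : ℕ) : ℤ) = 0 := by omega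
    rw [e1, e2]
    have e : μ + (μ (hi k) - μ (lo k)) • simpleRoot k
        = μ - (μ (lo k) - μ (hi k)) • simpleRoot k := by module
    rw [e]; simp
  · have e1 : (((μ (lo k) - μ (hi k)).toNat : ℕ) : ℤ) = μ (lo k) - μ (hi k) :=
      Int.toNat_of_nonneg (by omega)
    have e2 : (((μ (hi k) - μ (lo k)).toNat : ℕ) : ℤ) = 0 := by omega
    rw [e1, e2]; simp

/-- The Demazure–Lusztig operator
`T_k = q s_k + (1 - q) (1 / (1 - x_{k+1}/x_k)) (s_k - 1)`. -/
def demazureLusztig {𝕜 : Type*} [Field 𝕜] {l : ℕ} (q : 𝕜) (k : Fin (l - 1)) :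
    Module.End 𝕜 (LaurentPoly 𝕜 l) :=
  q • permOp 𝕜 (simpleRefl k) + (1 - q) • divDiff 𝕜 k

theorem exists_word {l : ℕ} (w : Equiv.Perm (Fin l)) :
    ∃ n : ℕ, ∃ ws : List (Fin (l - 1)), ws.length = n ∧ (ws.map simpleRefl).prod = w := by
  cases l with
  | zero => exact ⟨0, [], rfl, Subsingleton.elim _ _⟩
  | succ n =>
    have h : w ∈ Submonoid.closure (Set.range fun i : Fin n => Equiv.swap i.castSucc i.succ) := by
      rw [Equiv.Perm.mclosure_swap_castSucc_succ]; trivial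
    induction h using Submonoid.closure_induction with
    | mem x hx =>
      obtain ⟨i, rfl⟩ := hx
      refine ⟨1, [i], rfl, ?_⟩
      simp only [List.map_cons, List.map_nil, List.prod_cons, List.prod_nil, mul_one]
      rfl
    | one => exact ⟨0, [], rfl, rfl⟩
    | mul x y _ _ hx hy =>
      obtain ⟨_, a, _, ha⟩ := hx
      obtain ⟨_, b, _, hb⟩ := hy
      exact ⟨_, a ++ b, rfl, by rw [List.map_append, List.prod_append, ha, hb]⟩

open Classical in
/-- The length `ℓ(w)`: the least length of an expression of `w` as a product of simple
transpositions. -/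
def permLength {l : ℕ} (w : Equiv.Perm (Fin l)) : ℕ := Nat.find (exists_word w)

open Classical in
theorem exists_reducedWord {l : ℕ} (w : Equiv.Perm (Fin l)) :
    ∃ ws : List (Fin (l - 1)), ws.length = permLength w ∧ (ws.map simpleRefl).prod = w :=
  Nat.find_spec (exists_word w)

/-- A reduced expression of `w`. -/
def reducedWord {l : ℕ} (w : Equiv.Perm (Fin l)) : List (Fin (l - 1)) :=
  Classical.choose (exists_reducedWord w)

/-- `T_w = T_{i₁} ⋯ T_{i_m}` for a reduced expression `w = s_{i₁} ⋯ s_{i_m}`. -/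
def heckeT {𝕜 : Type*} [Field 𝕜] {l : ℕ} (q : 𝕜) (w : Equiv.Perm (Fin l)) :
    Module.End 𝕜 (LaurentPoly 𝕜 l) :=
  ((reducedWord w).map (demazureLusztig q)).prod

/-! ### Non-symmetric Hall–Littlewood polynomials -/

/-- A permutation `w` with `μ = w (μ₊)`, where `μ₊` is dominant. -/
def dominantPerm {l : ℕ} (μ : Weight l) : Equiv.Perm (Fin l) := Tuple.sort fun i => -μ i

/-- The dominant weight `μ₊` in the orbit of `μ`. -/
def dominantRep {l : ℕ} (μ : Weight l) : Weight l := fun i => μ (dominantPerm μ i)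

theorem dominantRep_antitone {l : ℕ} (μ : Weight l) : Antitone (dominantRep μ) := by
  intro i j h
  have := Tuple.monotone_sort (fun i => -μ i) h
  simpa [dominantRep, dominantPerm] using this

theorem permAct_dominantPerm {l : ℕ} (μ : Weight l) :
    permAct (dominantPerm μ) (dominantRep μ) = μ := by
  funext i; simp [permAct, dominantRep]

/-- The non-symmetric Hall–Littlewood polynomial `E_μ(x; q) = q^{-ℓ(w)} T_w x^{μ₊}`,
where `μ = w (μ₊)`. -/
def nsHL {𝕜 : Type*} [Field 𝕜] {l : ℕ} (q : 𝕜) (μ : Weight l) : LaurentPoly 𝕜 l :=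
  (q ^ permLength (dominantPerm μ))⁻¹ • heckeT q (dominantPerm μ) (mono 𝕜 (dominantRep μ))

/-- The number `|Inv(σ⁻¹) ∩ Inv(μ + ε ρ)|` of pairs `i < j` with `σ⁻¹(i) > σ⁻¹(j)` and
`μ_i ≥ μ_j`. -/
def twistExponent {l : ℕ} (σ : Equiv.Perm (Fin l)) (μ : Weight l) : ℕ :=
  (Finset.univ.filter fun p : Fin l × Fin l =>
    p.1 < p.2 ∧ σ⁻¹ p.2 < σ⁻¹ p.1 ∧ μ p.2 ≤ μ p.1).card

/-- The twisted non-symmetric Hall–Littlewood polynomial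
`E^σ_μ(x; q) = q^{|Inv(σ⁻¹) ∩ Inv(μ + ε ρ)|} T_{σ⁻¹}⁻¹ E_{σ⁻¹(μ)}(x; q)`. -/
def twistedHL {𝕜 : Type*} [Field 𝕜] {l : ℕ} (q : 𝕜) (σ : Equiv.Perm (Fin l)) (μ : Weight l) :
    LaurentPoly 𝕜 l :=
  q ^ twistExponent σ μ • (Ring.inverse (heckeT q σ⁻¹)) (nsHL q (permAct σ⁻¹ μ))

/-- The coefficient `⟨E^σ_β⟩ f` of `E^σ_β(x; q)` in the expansion of `f` on the basis
`{E^σ_μ(x; q)}` of the Laurent polynomials. -/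
def twistedHLCoeff {𝕜 : Type*} [Field 𝕜] {l : ℕ} (q : 𝕜) (σ : Equiv.Perm (Fin l))
    (β : Weight l) (f : LaurentPoly 𝕜 l) : 𝕜 :=
  (Function.invFun (Finsupp.linearCombination 𝕜 (twistedHL q σ)) f) β

/-! ### Irreducible characters of `GL_l` -/

/-- The weight `ρ = (l - 1, …, 1, 0)`. -/
def rho (l : ℕ) : Weight l := fun i => (l : ℤ) - 1 - (i : ℕ)

/-- The alternating sum `∑_w (-1)^{ℓ(w)} x^{w μ}`. -/
def alternant (𝕜 : Type*) [Field 𝕜] {l : ℕ} (μ : Weight l) : LaurentPoly 𝕜 l :=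
  ∑ w : Equiv.Perm (Fin l), (Equiv.Perm.sign w : ℤ) • mono 𝕜 (permAct w μ)

/-- The variable `x_i`. -/
def var (𝕜 : Type*) [Field 𝕜] {l : ℕ} (i : Fin l) : LaurentPoly 𝕜 l := mono 𝕜 (Pi.single i 1)

theorem mono_sum (𝕜 : Type*) [Field 𝕜] {l : ℕ} {ι : Type*} (s : Finset ι) (f : ι → Weight l) :
    ∏ i ∈ s, mono 𝕜 (f i) = mono 𝕜 (∑ i ∈ s, f i) := by
  classical
  induction s using Finset.induction_on with
  | empty => simp [mono_zero]
  | insert a s ha ih => rw [Finset.prod_insert ha, Finset.sum_insert ha, ih, mono_mul_mono]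

theorem var_pow (𝕜 : Type*) [Field 𝕜] {l : ℕ} (i : Fin l) (n : ℕ) :
    var 𝕜 i ^ n = mono 𝕜 (Pi.single i (n : ℤ)) := by
  induction n with
  | zero => simp [mono_zero]
  | succ n ih => rw [pow_succ, ih, var, mono_mul_mono, ← Pi.single_add]; push_cast; rfl

theorem alternant_eq_det (𝕜 : Type*) [Field 𝕜] {l : ℕ} (m : Fin l → ℕ) :
    alternant 𝕜 (fun i => (m i : ℤ)) =
      (Matrix.of fun i j => var 𝕜 i ^ m j : Matrix (Fin l) (Fin l) (LaurentPoly 𝕜 l)).det := by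
  rw [Matrix.det_apply', alternant]
  refine Finset.sum_congr rfl fun w _ => ?_
  have e : ∏ i, (Matrix.of fun i j => var 𝕜 i ^ m j :
      Matrix (Fin l) (Fin l) (LaurentPoly 𝕜 l)) (w i) i
      = mono 𝕜 (permAct w fun i => (m i : ℤ)) := by
    simp only [Matrix.of_apply, var_pow]
    rw [mono_sum]
    congr 1
    funext k
    rw [Finset.sum_apply, Finset.sum_eq_single (w⁻¹ k)]
    · simp [permAct]
    · intro b _ hb
      rw [Pi.single_eq_of_ne]
      rintro rfl
      simp at hb
    · simp
  rw [e, zsmul_eq_mul]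

theorem vandermonde_dvd {R : Type*} [CommRing R] {l : ℕ} (v : Fin l → R) (m : Fin l → ℕ) :
    (Matrix.vandermonde v).det ∣ (Matrix.of fun i j => v i ^ m j : Matrix (Fin l) (Fin l) R).det := by
  nontriviality R
  let P : Polynomial R := ∏ i, (Polynomial.X - Polynomial.C (v i))
  have hP : P.Monic := Polynomial.monic_prod_of_monic _ _ fun i _ => Polynomial.monic_X_sub_C _
  have hdeg : P.natDegree = l := by
    simp only [P]
    rw [Polynomial.natDegree_prod_of_monic _ _ fun i _ => Polynomial.monic_X_sub_C _]
    simp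
  have hM : (Matrix.of fun i j => v i ^ m j : Matrix (Fin l) (Fin l) R) =
      Matrix.vandermonde v *
        Matrix.of fun k j : Fin l => ((Polynomial.X ^ m j : Polynomial R) %ₘ P).coeff k := by
    ext i j
    rw [Matrix.mul_apply]
    simp only [Matrix.of_apply, Matrix.vandermonde_apply]
    have h1 := congrArg (Polynomial.eval (v i))
      (Polynomial.modByMonic_add_div (Polynomial.X ^ m j : Polynomial R) P)
    have h0 : P.eval (v i) = 0 := by
      simp only [P, Polynomial.eval_prod]
      exact Finset.prod_eq_zero (Finset.mem_univ i) (by simp)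
    rw [Polynomial.eval_add, Polynomial.eval_mul, h0, zero_mul, add_zero, Polynomial.eval_pow,
      Polynomial.eval_X] at h1
    have hlt : ((Polynomial.X ^ m j : Polynomial R) %ₘ P).degree < (l : ℕ) := by
      have := Polynomial.degree_modByMonic_lt (Polynomial.X ^ m j : Polynomial R) hP
      rwa [Polynomial.degree_eq_natDegree hP.ne_zero, hdeg] at this
    rw [← h1]
    by_cases hz : (Polynomial.X ^ m j : Polynomial R) %ₘ P = 0
    · simp [hz]
    rw [Polynomial.eval_eq_sum_range' ((Polynomial.natDegree_lt_iff_degree_lt hz).2 hlt),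
      ← Fin.sum_univ_eq_sum_range
        (fun k => ((Polynomial.X ^ m j : Polynomial R) %ₘ P).coeff k * v i ^ k)]
    exact Finset.sum_congr rfl fun k _ => mul_comm _ _
  rw [hM, Matrix.det_mul]
  exact dvd_mul_right _ _

theorem alternant_add_const (𝕜 : Type*) [Field 𝕜] {l : ℕ} (μ : Weight l) (n : ℤ) :
    alternant 𝕜 (μ + fun _ => n) = mono 𝕜 (fun _ => n) * alternant 𝕜 μ := by
  rw [alternant, alternant, Finset.mul_sum]
  refine Finset.sum_congr rfl fun w _ => ?_
  rw [mul_smul_comm, mono_mul_mono, add_comm]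
  rfl

theorem alternant_rho_dvd_vandermonde (𝕜 : Type*) [Field 𝕜] (l : ℕ) :
    alternant 𝕜 (rho l) ∣ (Matrix.vandermonde (var 𝕜 : Fin l → LaurentPoly 𝕜 l)).det := by
  have hr : rho l = fun i : Fin l => (((Fin.rev i : Fin l) : ℕ) : ℤ) := by
    funext i
    have := i.isLt
    simp only [rho, Fin.val_rev]
    omega
  have hs : (Matrix.of fun i j : Fin l => var 𝕜 i ^ ((Fin.rev j : Fin l) : ℕ)) =
      (Matrix.vandermonde (var 𝕜 : Fin l → LaurentPoly 𝕜 l)).submatrix id Fin.revPerm := by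
    ext i j; rfl
  rw [hr, alternant_eq_det 𝕜 fun i : Fin l => ((Fin.rev i : Fin l) : ℕ), hs, Matrix.det_permute']
  have hu : IsUnit (((Equiv.Perm.sign (Fin.revPerm : Equiv.Perm (Fin l)) : ℤˣ) : ℤ) :
      LaurentPoly 𝕜 l) := by
    have := (Units.isUnit (Equiv.Perm.sign (Fin.revPerm : Equiv.Perm (Fin l)))).map
      (Int.castRingHom (LaurentPoly 𝕜 l))
    simpa using this
  exact hu.mul_left_dvd.2 dvd_rfl

/-- Divisibility of alternants: the quotient in the Weyl character formula is a Laurent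
polynomial. -/
theorem exists_weylCharacter (𝕜 : Type*) [Field 𝕜] {l : ℕ} (μ : Weight l) :
    ∃ f : LaurentPoly 𝕜 l, f * alternant 𝕜 (rho l) = alternant 𝕜 (μ + rho l) := by
  let N : ℕ := ∑ i, ((μ + rho l) i).natAbs
  let m : Fin l → ℕ := fun i => ((μ + rho l) i + N).toNat
  have hm : (fun i => (m i : ℤ)) = (μ + rho l) + fun _ => (N : ℤ) := by
    funext i
    have h1 : ((μ + rho l) i).natAbs ≤ N :=
      Finset.single_le_sum (f := fun i => ((μ + rho l) i).natAbs) (fun _ _ => Nat.zero_le _)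
        (Finset.mem_univ i)
    simp only [m]
    rw [Int.toNat_of_nonneg (by omega)]
    rfl
  obtain ⟨g, hg⟩ := (alternant_rho_dvd_vandermonde 𝕜 l).trans (vandermonde_dvd (var 𝕜) m)
  rw [← alternant_eq_det, hm, alternant_add_const] at hg
  refine ⟨mono 𝕜 (fun _ => -(N : ℤ)) * g, ?_⟩
  have e : mono 𝕜 (fun _ : Fin l => -(N : ℤ)) * mono 𝕜 (fun _ => (N : ℤ)) = 1 := by
    rw [mono_mul_mono, ← mono_zero]
    congr 1
    funext i
    simp
  calc mono 𝕜 (fun _ => -(N : ℤ)) * g * alternant 𝕜 (rho l)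
      = mono 𝕜 (fun _ => -(N : ℤ)) * (alternant 𝕜 (rho l) * g) := by ring
    _ = alternant 𝕜 (μ + rho l) := by rw [← hg, ← mul_assoc, e, one_mul]

/-- A dominant weight: `μ₁ ≥ ⋯ ≥ μ_l`. -/
abbrev DominantWeight (l : ℕ) : Type := {μ : Weight l // Antitone μ}

/-- The irreducible character `χ_μ` of `GL_l`, by the Weyl character formula: the quotient of
`∑_w (-1)^{ℓ(w)} x^{w(μ + ρ)}` by `∑_w (-1)^{ℓ(w)} x^{w ρ}`. -/
def irrChar (𝕜 : Type*) [Field 𝕜] {l : ℕ} (μ : DominantWeight l) : LaurentPoly 𝕜 l :=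
  Classical.choose (exists_weylCharacter 𝕜 μ.1)

theorem irrChar_mul (𝕜 : Type*) [Field 𝕜] {l : ℕ} (μ : DominantWeight l) :
    irrChar 𝕜 μ * alternant 𝕜 (rho l) = alternant 𝕜 (μ.1 + rho l) :=
  Classical.choose_spec (exists_weylCharacter 𝕜 μ.1)

/-- Infinite formal sums `∑_μ c_μ χ_μ` of irreducible `GL_l` characters, given by their
coefficients. -/
abbrev CharSeries (𝕜 : Type*) (l : ℕ) : Type _ := DominantWeight l → 𝕜

/-- The polynomial weights (dominant weights with nonnegative entries) of size `n`. -/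
def polyWeights (l n : ℕ) : Finset (DominantWeight l) :=
  Finset.subtype (fun μ : Weight l => Antitone μ)
    ((Fintype.piFinset fun _ : Fin l => Finset.Icc (0 : ℤ) n).filter fun μ => ∑ i, μ i = n)

theorem mem_polyWeights {l n : ℕ} (μ : DominantWeight l) :
    μ ∈ polyWeights l n ↔ (∀ i, 0 ≤ μ.1 i) ∧ ∑ i, μ.1 i = n := by
  simp only [polyWeights, Finset.mem_subtype, Finset.mem_filter, Fintype.mem_piFinset,
    Finset.mem_Icc]
  constructor
  · rintro ⟨h1, h2⟩
    exact ⟨fun i => (h1 i).1, h2⟩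
  · rintro ⟨h1, h2⟩
    exact ⟨fun i => ⟨h1 i, h2 ▸ Finset.single_le_sum (f := μ.1) (fun j _ => h1 j)
      (Finset.mem_univ i)⟩, h2⟩

/-- The polynomial part of `∑_μ c_μ χ_μ`: the partial sum over the polynomial weights `μ`, as a
formal power series in `x₁, …, x_l`.  Since `χ_μ` is homogeneous of degree `μ₁ + ⋯ + μ_l`, only
the finitely many polynomial weights of size `|d|` contribute to the coefficient of `x^d`. -/
def polPart {𝕜 : Type*} [Field 𝕜] {l : ℕ} (c : CharSeries 𝕜 l) : MvPowerSeries (Fin l) 𝕜 :=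
  fun d => ∑ μ ∈ polyWeights l (∑ i, d i), c μ * (irrChar 𝕜 μ).coeff fun i => (d i : ℤ)

/-- The LLT series `𝓛^σ_{β/α}(x; q)`: the coefficient of `χ_μ` is
`⟨E^{σ⁻¹}_β(x; q⁻¹)⟩ χ_μ · E^{σ⁻¹}_α(x; q⁻¹)`. -/
def lltSeries {𝕜 : Type*} [Field 𝕜] {l : ℕ} (q : 𝕜) (σ : Equiv.Perm (Fin l)) (β α : Weight l) :
    CharSeries 𝕜 l :=
  fun μ => twistedHLCoeff q⁻¹ σ⁻¹ β (irrChar 𝕜 μ * twistedHL q⁻¹ σ⁻¹ α)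

/-! ### Combinatorial LLT polynomials -/

/-- A tuple of `k` diagrams; the box `(i, j)` is the one in column `i` and row `j`. -/
abbrev DiagramTuple (k : ℕ) : Type := Fin k → Finset (ℤ × ℤ)

/-- The boxes of a tuple: the disjoint union of the boxes of its components. -/
abbrev DiagramTuple.Box {k : ℕ} (ν : DiagramTuple k) : Type := Σ r : Fin k, {b // b ∈ ν r}

/-- The column of a box. -/
def DiagramTuple.col {k : ℕ} {ν : DiagramTuple k} (a : ν.Box) : ℤ := a.2.1.1

/-- The row of a box. -/
def DiagramTuple.row {k : ℕ} {ν : DiagramTuple k} (a : ν.Box) : ℤ := a.2.1.2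

/-- The content (column minus row) of a box. -/
def DiagramTuple.content {k : ℕ} {ν : DiagramTuple k} (a : ν.Box) : ℤ :=
  DiagramTuple.col a - DiagramTuple.row a

/-- `a, b` is an attacking pair with `a` preceding `b` in the reading order: either `a` and `b` have
the same content and `a` lies in an earlier component, or the content of `b` is one more than that
of `a` and `a` lies in a later component. -/
def DiagramTuple.Attacks {k : ℕ} {ν : DiagramTuple k} (a b : ν.Box) : Prop :=
  (DiagramTuple.content a = DiagramTuple.content b ∧ a.1 < b.1) ∨
    (DiagramTuple.content b = DiagramTuple.content a + 1 ∧ b.1 < a.1)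

/-- Semistandardness on every component: weakly increasing along rows, strictly increasing along
columns. -/
def DiagramTuple.IsSemistandard {k n : ℕ} {ν : DiagramTuple k} (T : ν.Box → Fin n) : Prop :=
  ∀ a b : ν.Box, a.1 = b.1 →
    (DiagramTuple.row a = DiagramTuple.row b → DiagramTuple.col a < DiagramTuple.col b →
      T a ≤ T b) ∧
    (DiagramTuple.col a = DiagramTuple.col b → DiagramTuple.row a < DiagramTuple.row b →
      T a < T b)

open Classical in
/-- The semistandard tableaux on `ν` with `n` letters. -/
def ssyt {k : ℕ} (ν : DiagramTuple k) (n : ℕ) : Finset (ν.Box → Fin n) :=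
  Finset.univ.filter DiagramTuple.IsSemistandard

open Classical in
/-- The number of attacking inversions. -/
def inv {k n : ℕ} {ν : DiagramTuple k} (T : ν.Box → Fin n) : ℕ :=
  (Finset.univ.filter fun p : ν.Box × ν.Box =>
    DiagramTuple.Attacks p.1 p.2 ∧ T p.2 < T p.1).card

/-- The combinatorial LLT polynomial `𝓖_ν(x₁, …, x_n; q) = ∑_T q^{inv(T)} x^T`, evaluated in `n`
variables, so that the sum is over semistandard tableaux with letters `1, …, n`. -/
def combLLT {𝕜 : Type*} [Field 𝕜] {k : ℕ} (n : ℕ) (ν : DiagramTuple k) (q : 𝕜) :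
    MvPolynomial (Fin n) 𝕜 :=
  ∑ T ∈ ssyt ν n, MvPolynomial.C (q ^ inv T) * ∏ a : ν.Box, MvPolynomial.X (T a)

/-- The tuple `β/α` of one-row diagrams `(β_j)/(α_j)`, the boxes of the `j`-th one lying in the
columns `α_j + 1, …, β_j` of row `1`. -/
def rowTuple {l : ℕ} (β α : Weight l) : DiagramTuple l :=
  fun j => Finset.Ioc (α j) (β j) ×ˢ {1}

/-! ### Triples -/

/-- The positions `(i, j)` of the boxes in row `j` of `β/α`, with `α_j + 1 ≤ i ≤ β_j`. -/
def rowBoxes {l : ℕ} (β α : Weight l) : Finset (ℤ × Fin l) :=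
  Finset.univ.biUnion fun j => Finset.Icc (α j + 1) (β j) ×ˢ {j}

/-- The positions of the boxes in or adjacent to row `j` of `β/α`, with `α_j ≤ i ≤ β_j + 1`. -/
def extendedRowBoxes {l : ℕ} (β α : Weight l) : Finset (ℤ × Fin l) :=
  Finset.univ.biUnion fun j => Finset.Icc (α j) (β j + 1) ×ˢ {j}

/-- The order on boxes of `β/α` corresponding to the reading order on `σ(β/α)`: by `i`, then by
`σ(j)`. -/
def sigmaLT {l : ℕ} (σ : Equiv.Perm (Fin l)) (a b : ℤ × Fin l) : Prop :=
  a.1 < b.1 ∨ (a.1 = b.1 ∧ σ a.2 < σ b.2)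

open Classical in
/-- The `σ`-triples `(a, b, c)` in `β/α`: `a` and `c` are consecutive boxes in or adjacent to the
same row, `b` is a box of `β/α` in an earlier row, and `a < b < c` in the order given by `σ`. -/
def sigmaTriples {l : ℕ} (σ : Equiv.Perm (Fin l)) (β α : Weight l) :
    Finset ((ℤ × Fin l) × (ℤ × Fin l) × (ℤ × Fin l)) :=
  (extendedRowBoxes β α ×ˢ rowBoxes β α ×ˢ extendedRowBoxes β α).filter fun t =>
    t.1.2 = t.2.2.2 ∧ t.2.2.1 = t.1.1 + 1 ∧ t.2.1.2 < t.1.2 ∧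
      sigmaLT σ t.1 t.2.1 ∧ sigmaLT σ t.2.1 t.2.2

/-- `h_σ(β/α)`, the number of `σ`-triples in `β/α`. -/
def hSigma {l : ℕ} (σ : Equiv.Perm (Fin l)) (β α : Weight l) : ℕ := (sigmaTriples σ β α).card

end LLT

end

/-!
The theorem holds for every nonzero parameter `t = q⁻¹` in characteristic zero, and it is reduced
to a multiplication rule for the twisted polynomials `E_μ = E^{σ⁻¹}_μ(x; t)` by complete symmetric
functions.

*Basis.*  The operators `T_i` satisfy the quadratic and braid relations, so `T_i E_μ` is
`t E_{s_i μ}` or `t E_μ` according to whether `μ_i > μ_{i+1}` or `μ_i = μ_{i+1}`.  It follows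
that `E_μ(x; t)` is `x^μ` plus terms of smaller rank, so these polynomials form a basis, and so do
their twists, which up to nonzero factors are their images under an invertible operator
(`linearIndependent_twistedHL`, `span_twistedHL`).

*Pieri rules.*  For dominant `μ`, the product of the elementary symmetric function `e_k` with
`x^μ = E_μ` is recognized by its invariance under the stabilizer of `μ` and its coefficients on the
weights `μ + ε_I`; the general case follows by applying the `T_i`, which commute with symmetric
functions (`esymmL_mul_nsHL`).  Inverting with the help of `∑ (-1)^i e_i h_{k-i} = 0` and a
sign-reversing involution gives `h_k E_α = ∑ t^{-h_σ(β/α)} E_β`, the sum over the `β ≥ α` of size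
`|α| + k` (`hsymmL_mul_twistedHL`).

*Cauchy identity.*  The coefficient of `x^d` in the polynomial part of `∑_μ c_μ χ_μ`, where `c_μ` is
the coefficient of `E_β` in `χ_μ E_α`, is the coefficient of `E_β` in `∏ h_{d_i} · E_α`, since
`∑_μ [x^d] χ_μ · χ_μ = ∏ h_{d_i}` (`sum_coeff_smul_irrChar`).  By the Pieri rule it is a sum over
the chains of weights from `α` to `β` with steps of sizes `d_1, …, d_l`.

*Tableaux.*  Such chains are the same as semistandard tableaux of weight `d` on the tuple of rows
`σ(β/α)`.  A triple `(a, b, c)` of `β/α` is either a triple of the layer of `b`, when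
`T(a) ≤ T(b) ≤ T(c)` (with `T = -∞` to the left and `T = ∞` to the right of a row), or contributes
exactly one attacking inversion, and every attacking inversion arises once in this way; so
`h_σ(β/α)` is `inv(T)` plus the exponents of the layers
(`pairExponent_eq_fillingInv_add`).
-/

noncomputable section

namespace LLT

/-! ### Permutations acting on Laurent polynomials -/

section PermAction

variable {𝕜 : Type*} [Field 𝕜] {l : ℕ}

theorem permAct_apply (w : Equiv.Perm (Fin l)) (μ : Weight l) (i : Fin l) :
    permAct w μ i = μ (w⁻¹ i) := rfl

theorem permAct_mul (u v : Equiv.Perm (Fin l)) (μ : Weight l) :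
    permAct (u * v) μ = permAct u (permAct v μ) := by
  funext i; simp [permAct]

@[simp] theorem permAct_one (μ : Weight l) : permAct 1 μ = μ := by
  funext i; simp [permAct]

theorem permAct_add (w : Equiv.Perm (Fin l)) (μ ν : Weight l) :
    permAct w (μ + ν) = permAct w μ + permAct w ν := rfl

@[simp] theorem permAct_inv_permAct (w : Equiv.Perm (Fin l)) (μ : Weight l) :
    permAct w⁻¹ (permAct w μ) = μ := by
  rw [← permAct_mul]; simp

@[simp] theorem permAct_permAct_inv (w : Equiv.Perm (Fin l)) (μ : Weight l) :
    permAct w (permAct w⁻¹ μ) = μ := by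
  rw [← permAct_mul]; simp

/-- The action of a permutation on weights as an additive automorphism. -/
def permAddEquiv (w : Equiv.Perm (Fin l)) : Weight l ≃+ Weight l where
  toFun := permAct w
  invFun := permAct w⁻¹
  left_inv := permAct_inv_permAct w
  right_inv := permAct_permAct_inv w
  map_add' := permAct_add w

theorem permOp_mono (w : Equiv.Perm (Fin l)) (μ : Weight l) :
    permOp 𝕜 w (mono 𝕜 μ) = mono 𝕜 (permAct w μ) :=
  extendLinear_mono _ _

theorem permOp_eq_domCongr (w : Equiv.Perm (Fin l)) :
    permOp 𝕜 w = (AddMonoidAlgebra.domCongr 𝕜 𝕜 (permAddEquiv w)).toLinearMap := by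
  apply linearMap_ext
  intro μ
  rw [permOp_mono]
  simp [mono, permAddEquiv]

theorem permOp_mul_apply (w : Equiv.Perm (Fin l)) (f g : LaurentPoly 𝕜 l) :
    permOp 𝕜 w (f * g) = permOp 𝕜 w f * permOp 𝕜 w g := by
  simp [permOp_eq_domCongr]

theorem permOp_algebraMap (w : Equiv.Perm (Fin l)) (c : 𝕜) :
    permOp 𝕜 w (algebraMap 𝕜 (LaurentPoly 𝕜 l) c) = algebraMap 𝕜 (LaurentPoly 𝕜 l) c := by
  rw [Algebra.algebraMap_eq_smul_one, map_smul, ← mono_zero, permOp_mono]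
  rfl

theorem permOp_permOp (u v : Equiv.Perm (Fin l)) (f : LaurentPoly 𝕜 l) :
    permOp 𝕜 u (permOp 𝕜 v f) = permOp 𝕜 (u * v) f := by
  suffices h : permOp 𝕜 u ∘ₗ permOp 𝕜 v = permOp 𝕜 (u * v) from congrArg (fun g => g f) h
  apply linearMap_ext
  intro μ
  simp only [LinearMap.comp_apply, permOp_mono, permAct_mul]

@[simp] theorem permOp_one (f : LaurentPoly 𝕜 l) : permOp 𝕜 1 f = f := by
  suffices h : permOp 𝕜 (1 : Equiv.Perm (Fin l)) = LinearMap.id from congrArg (fun g => g f) h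
  apply linearMap_ext
  intro μ
  simp only [permOp_mono, permAct_one, LinearMap.id_apply]

theorem coeff_permOp (w : Equiv.Perm (Fin l)) (f : LaurentPoly 𝕜 l) (μ : Weight l) :
    (permOp 𝕜 w f).coeff μ = f.coeff (permAct w⁻¹ μ) := by
  rw [permOp_eq_domCongr]
  exact AddMonoidAlgebra.coeff_domCongr (R := 𝕜) (A := 𝕜) (permAddEquiv w) f μ

theorem permAct_single (w : Equiv.Perm (Fin l)) (i : Fin l) (n : ℤ) :
    permAct w (Pi.single i n) = Pi.single (w i) n := by
  funext j
  by_cases h : j = w i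
  · subst h; simp [permAct]
  · rw [permAct_apply, Pi.single_eq_of_ne h, Pi.single_eq_of_ne]
    rintro rfl
    simp at h

theorem permOp_var (w : Equiv.Perm (Fin l)) (i : Fin l) :
    permOp 𝕜 w (var 𝕜 i) = var 𝕜 (w i) := by
  rw [var, permOp_mono, permAct_single, var]

theorem mono_injective : Function.Injective (mono 𝕜 : Weight l → LaurentPoly 𝕜 l) := by
  intro μ ν h
  have := congrArg (fun f => f.coeff μ) h
  by_contra hne
  simp [mono, Ne.symm hne] at this

theorem coeff_mono (μ ν : Weight l) : (mono 𝕜 μ).coeff ν = if μ = ν then 1 else 0 := by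
  classical
  rw [mono, AddMonoidAlgebra.coeff_single, Finsupp.single_apply]

theorem coeff_mono_mul (μ ν : Weight l) (f : LaurentPoly 𝕜 l) :
    (mono 𝕜 μ * f).coeff ν = f.coeff (ν - μ) := by
  have := AddMonoidAlgebra.coeff_single_mul_apply f (1 : 𝕜) μ ν
  rw [one_mul] at this
  rw [mono, this, sub_eq_neg_add]

end PermAction

/-! ### The Hecke algebra relations -/

section Hecke

variable {𝕜 : Type*} [Field 𝕜] {l : ℕ}

theorem lo_ne_hi (a : Fin (l - 1)) : lo a ≠ hi a := by simp [lo, hi]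

@[simp] theorem simpleRefl_lo (a : Fin (l - 1)) : simpleRefl a (lo a) = hi a :=
  Equiv.swap_apply_left _ _

@[simp] theorem simpleRefl_hi (a : Fin (l - 1)) : simpleRefl a (hi a) = lo a :=
  Equiv.swap_apply_right _ _

@[simp] theorem simpleRefl_inv (a : Fin (l - 1)) : (simpleRefl a)⁻¹ = simpleRefl a :=
  Equiv.swap_inv _ _

@[simp] theorem simpleRefl_mul_self (a : Fin (l - 1)) : simpleRefl a * simpleRefl a = 1 :=
  Equiv.swap_mul_self _ _

theorem simpleRefl_of_ne {a : Fin (l - 1)} {i : Fin l} (h1 : i ≠ lo a) (h2 : i ≠ hi a) :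
    simpleRefl a i = i :=
  Equiv.swap_apply_of_ne_of_ne h1 h2

theorem var_sub_var_ne_zero {i j : Fin l} (h : i ≠ j) : var 𝕜 i - var 𝕜 j ≠ 0 := by
  rw [sub_ne_zero]
  intro e
  have := congrFun (mono_injective e) i
  simp [h] at this

/-- The Demazure–Lusztig operator with the denominator cleared. -/
theorem var_sub_var_mul_demazureLusztig (t : 𝕜) (a : Fin (l - 1)) (f : LaurentPoly 𝕜 l) :
    (var 𝕜 (lo a) - var 𝕜 (hi a)) * demazureLusztig t a f =
      (var 𝕜 (lo a) - algebraMap 𝕜 _ t * var 𝕜 (hi a)) * permOp 𝕜 (simpleRefl a) f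
        - (1 - algebraMap 𝕜 _ t) * var 𝕜 (lo a) * f := by
  have h1 : var 𝕜 (lo a) * mono 𝕜 (-simpleRoot a) = var 𝕜 (hi a) := by
    rw [var, mono_mul_mono, var, simpleRoot]
    congr 1
    abel
  have h2 := one_sub_mul_divDiff 𝕜 a f
  simp only [demazureLusztig, LinearMap.add_apply, LinearMap.smul_apply]
  simp only [Algebra.smul_def, map_sub, map_one]
  linear_combination (1 - algebraMap 𝕜 (LaurentPoly 𝕜 l) t) * var 𝕜 (lo a) * h2 +
    (1 - algebraMap 𝕜 (LaurentPoly 𝕜 l) t) * divDiff 𝕜 a f * h1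

/-- The image of a Laurent polynomial in the field of rational functions, where the relations of the
Hecke algebra are verified, as `T_a` is given there by an explicit formula. -/
def toFrac (f : LaurentPoly 𝕜 l) : FractionRing (LaurentPoly 𝕜 l) :=
  algebraMap _ _ f

theorem toFrac_injective : Function.Injective (toFrac : LaurentPoly 𝕜 l → _) :=
  IsFractionRing.injective _ _

theorem toFrac_var_sub_ne_zero {i j : Fin l} (h : i ≠ j) :
    toFrac (var 𝕜 i) - toFrac (var 𝕜 j) ≠ 0 := by
  rw [toFrac, toFrac, ← map_sub]
  exact fun e => var_sub_var_ne_zero h (toFrac_injective (e.trans (map_zero _).symm))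

theorem toFrac_permOp_demazureLusztig (t : 𝕜) (a : Fin (l - 1)) (w : Equiv.Perm (Fin l))
    (f : LaurentPoly 𝕜 l) :
    toFrac (permOp 𝕜 w (demazureLusztig t a f)) =
      ((toFrac (var 𝕜 (w (lo a))) - toFrac (algebraMap 𝕜 _ t) * toFrac (var 𝕜 (w (hi a)))) *
          toFrac (permOp 𝕜 (w * simpleRefl a) f)
        - (1 - toFrac (algebraMap 𝕜 _ t)) * toFrac (var 𝕜 (w (lo a))) * toFrac (permOp 𝕜 w f)) /
      (toFrac (var 𝕜 (w (lo a))) - toFrac (var 𝕜 (w (hi a)))) := by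
  have hne := toFrac_var_sub_ne_zero (𝕜 := 𝕜) (w.injective.ne (lo_ne_hi a))
  rw [eq_div_iff hne]
  have h := congrArg (permOp 𝕜 w) (var_sub_var_mul_demazureLusztig t a f)
  simp only [map_sub, permOp_mul_apply, permOp_var, permOp_algebraMap, permOp_permOp] at h
  have h1 : permOp 𝕜 w (1 : LaurentPoly 𝕜 l) = 1 := by
    have := permOp_algebraMap w (1 : 𝕜)
    rwa [map_one] at this
  rw [h1] at h
  have h2 := congrArg toFrac h
  simp only [toFrac, map_sub, map_mul, map_one] at h2 ⊢
  linear_combination h2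

theorem toFrac_demazureLusztig (t : 𝕜) (a : Fin (l - 1)) (f : LaurentPoly 𝕜 l) :
    toFrac (demazureLusztig t a f) =
      ((toFrac (var 𝕜 (lo a)) - toFrac (algebraMap 𝕜 _ t) * toFrac (var 𝕜 (hi a))) *
          toFrac (permOp 𝕜 (simpleRefl a) f)
        - (1 - toFrac (algebraMap 𝕜 _ t)) * toFrac (var 𝕜 (lo a)) * toFrac f) /
      (toFrac (var 𝕜 (lo a)) - toFrac (var 𝕜 (hi a))) := by
  simpa using toFrac_permOp_demazureLusztig t a 1 f

/-- The quadratic relation `(T_a - t) (T_a + 1) = 0`. -/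
theorem demazureLusztig_sq (t : 𝕜) (a : Fin (l - 1)) (f : LaurentPoly 𝕜 l) :
    demazureLusztig t a (demazureLusztig t a f) = (t - 1) • demazureLusztig t a f + t • f := by
  apply toFrac_injective
  have hne := toFrac_var_sub_ne_zero (𝕜 := 𝕜) (lo_ne_hi a)
  have hne' := toFrac_var_sub_ne_zero (𝕜 := 𝕜) (lo_ne_hi a).symm
  have e : ∀ u v : LaurentPoly 𝕜 l, toFrac ((t - 1) • u + t • v) =
      (toFrac (algebraMap 𝕜 _ t) - 1) * toFrac u + toFrac (algebraMap 𝕜 _ t) * toFrac v := by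
    intro u v
    simp only [toFrac, Algebra.smul_def, map_add, map_mul, map_sub, map_one]
  simp only [e, toFrac_demazureLusztig, toFrac_permOp_demazureLusztig, simpleRefl_mul_self,
    permOp_one, simpleRefl_lo, simpleRefl_hi]
  field_simp
  ring

theorem simpleRefl_comm {a b : Fin (l - 1)} (h1 : hi a ≠ lo b) (h2 : hi b ≠ lo a) (h : a ≠ b) :
    simpleRefl a * simpleRefl b = simpleRefl b * simpleRefl a := by
  have h3 : lo a ≠ lo b := by simpa [lo, Fin.ext_iff] using h
  have h4 : hi a ≠ hi b := by simpa [hi, Fin.ext_iff] using h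
  apply Equiv.Perm.Disjoint.commute
  intro i
  by_cases e1 : i = lo a
  · right; subst e1; exact simpleRefl_of_ne h3 h2.symm
  · by_cases e2 : i = hi a
    · right; subst e2; exact simpleRefl_of_ne h1 h4
    · left; exact simpleRefl_of_ne e1 e2

theorem demazureLusztig_comm (t : 𝕜) {a b : Fin (l - 1)} (h1 : hi a ≠ lo b) (h2 : hi b ≠ lo a)
    (h : a ≠ b) (f : LaurentPoly 𝕜 l) :
    demazureLusztig t a (demazureLusztig t b f) = demazureLusztig t b (demazureLusztig t a f) := by
  apply toFrac_injective
  have h3 : lo a ≠ lo b := by simpa [lo, Fin.ext_iff] using h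
  have h4 : hi a ≠ hi b := by simpa [hi, Fin.ext_iff] using h
  have hne := toFrac_var_sub_ne_zero (𝕜 := 𝕜) (lo_ne_hi a)
  have hne' := toFrac_var_sub_ne_zero (𝕜 := 𝕜) (lo_ne_hi b)
  simp only [toFrac_demazureLusztig, toFrac_permOp_demazureLusztig,
    simpleRefl_of_ne h3 h2.symm, simpleRefl_of_ne h1 h4,
    simpleRefl_of_ne h3.symm h1.symm, simpleRefl_of_ne h2 h4.symm, simpleRefl_comm h1 h2 h]
  field_simp
  ring

theorem simpleRefl_braid {a b : Fin (l - 1)} (h : hi a = lo b) :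
    simpleRefl a * simpleRefl b * simpleRefl a = simpleRefl b * simpleRefl a * simpleRefl b := by
  have h1 : lo a ≠ hi b := by
    simp only [hi, lo, Fin.ext_iff, ne_eq] at h ⊢; omega
  have h2 : lo a ≠ lo b := h ▸ lo_ne_hi a
  have e1 := Equiv.swap_mul_swap_mul_swap (lo_ne_hi b).symm h1.symm
  have e2 := Equiv.swap_mul_swap_mul_swap h2 h1
  simp only [simpleRefl, h]
  rw [e2, Equiv.swap_comm (lo a) (lo b), Equiv.swap_comm (lo b) (hi b), e1, Equiv.swap_comm]

theorem demazureLusztig_braid (t : 𝕜) {a b : Fin (l - 1)} (h : hi a = lo b)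
    (f : LaurentPoly 𝕜 l) :
    demazureLusztig t a (demazureLusztig t b (demazureLusztig t a f)) =
      demazureLusztig t b (demazureLusztig t a (demazureLusztig t b f)) := by
  have h1 : lo a ≠ hi b := by
    simp only [hi, lo, Fin.ext_iff, ne_eq] at h ⊢; omega
  have h2 : lo a ≠ lo b := h ▸ lo_ne_hi a
  apply toFrac_injective
  have n1 := toFrac_var_sub_ne_zero (𝕜 := 𝕜) h2
  have n2 := toFrac_var_sub_ne_zero (𝕜 := 𝕜) (lo_ne_hi b)
  have n3 := toFrac_var_sub_ne_zero (𝕜 := 𝕜) h1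
  have n1' := toFrac_var_sub_ne_zero (𝕜 := 𝕜) h2.symm
  have n2' := toFrac_var_sub_ne_zero (𝕜 := 𝕜) (lo_ne_hi b).symm
  have n3' := toFrac_var_sub_ne_zero (𝕜 := 𝕜) h1.symm
  have a1 : simpleRefl a (lo b) = lo a := h ▸ simpleRefl_hi a
  have a2 : simpleRefl a (lo a) = lo b := h ▸ simpleRefl_lo a
  have a3 : simpleRefl a (hi b) = hi b := simpleRefl_of_ne h1.symm (h ▸ (lo_ne_hi b).symm)
  have a4 : simpleRefl b (lo a) = lo a := simpleRefl_of_ne h2 h1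
  have br := simpleRefl_braid h
  simp only [toFrac_demazureLusztig, toFrac_permOp_demazureLusztig, Equiv.Perm.mul_apply, h,
    a1, a2, a3, a4, simpleRefl_lo, simpleRefl_hi, simpleRefl_mul_self, permOp_one, br]
  generalize toFrac (var 𝕜 (lo a)) = x at *
  generalize toFrac (var 𝕜 (lo b)) = y at *
  generalize toFrac (var 𝕜 (hi b)) = z at *
  generalize toFrac (permOp 𝕜 (simpleRefl b * simpleRefl a * simpleRefl b) f) = g1
  field_simp
  ring

/-- The operator `T_a` is linear over the Laurent polynomials invariant under `s_a`. -/
theorem demazureLusztig_mul_of_invariant (t : 𝕜) (a : Fin (l - 1)) {g : LaurentPoly 𝕜 l}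
    (hg : permOp 𝕜 (simpleRefl a) g = g) (f : LaurentPoly 𝕜 l) :
    demazureLusztig t a (g * f) = g * demazureLusztig t a f := by
  apply mul_left_cancel₀ (var_sub_var_ne_zero (𝕜 := 𝕜) (lo_ne_hi a))
  have h1 := var_sub_var_mul_demazureLusztig t a (g * f)
  have h2 := var_sub_var_mul_demazureLusztig t a f
  rw [permOp_mul_apply, hg] at h1
  linear_combination h1 - g * h2

/-- A `t`-eigenvector of `T_a` is invariant under `s_a`. -/
theorem permOp_eq_of_demazureLusztig_eq (t : 𝕜) (a : Fin (l - 1)) {f : LaurentPoly 𝕜 l}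
    (hf : demazureLusztig t a f = t • f) : permOp 𝕜 (simpleRefl a) f = f := by
  have hne : var 𝕜 (lo a) - algebraMap 𝕜 _ t * var 𝕜 (hi a) ≠ 0 := by
    intro e
    have h1 : (Pi.single (hi a) 1 : Weight l) ≠ Pi.single (lo a) 1 := by
      intro h
      have := congrFun h (lo a)
      simp [lo_ne_hi a] at this
    have := congrArg (fun f => f.coeff (Pi.single (lo a) 1)) e
    simp [var, coeff_mono, h1] at this
  have h := var_sub_var_mul_demazureLusztig t a f
  rw [hf, Algebra.smul_def] at h
  apply mul_left_cancel₀ hne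
  linear_combination -h

end Hecke

/-! ### Adjacent transpositions, inversions and sorting -/

section Sorting

variable {l : ℕ}

theorem simpleRefl_lt_simpleRefl {a : Fin (l - 1)} {p r : Fin l} (h : p < r)
    (hne : ¬(p = lo a ∧ r = hi a)) : simpleRefl a p < simpleRefl a r := by
  simp only [simpleRefl, Equiv.swap_apply_def, lo, hi, Fin.ext_iff, Fin.lt_def] at *
  split_ifs <;> simp <;> omega

/-- The pairs `p < r` of indices. -/
def orderedPairs (l : ℕ) : Finset (Fin l × Fin l) := Finset.univ.filter fun p => p.1 < p.2

@[simp] theorem mem_orderedPairs {p : Fin l × Fin l} : p ∈ orderedPairs l ↔ p.1 < p.2 := by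
  simp [orderedPairs]

theorem lo_lt_hi (a : Fin (l - 1)) : lo a < hi a := by simp [lo, hi, Fin.lt_def]

/-- An adjacent transposition permutes all pairs `p < r` but one, which it reverses. -/
theorem sum_orderedPairs_simpleRefl {M : Type*} [AddCommMonoid M] (a : Fin (l - 1))
    (F : Fin l → Fin l → M) :
    (∑ p ∈ orderedPairs l, F (simpleRefl a p.1) (simpleRefl a p.2)) + F (lo a) (hi a) =
      (∑ p ∈ orderedPairs l, F p.1 p.2) + F (hi a) (lo a) := by
  have hmem : (lo a, hi a) ∈ orderedPairs l := by simp [lo_lt_hi]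
  rw [← Finset.add_sum_erase _ _ hmem, ← Finset.add_sum_erase _ (fun p => F p.1 p.2) hmem]
  have key : ∑ p ∈ (orderedPairs l).erase (lo a, hi a),
      F (simpleRefl a p.1) (simpleRefl a p.2) =
      ∑ p ∈ (orderedPairs l).erase (lo a, hi a), F p.1 p.2 := by
    have inv : ∀ i, simpleRefl a (simpleRefl a i) = i := fun i => by
      rw [← Equiv.Perm.mul_apply, simpleRefl_mul_self]; rfl
    have hm : ∀ p ∈ (orderedPairs l).erase (lo a, hi a),
        (simpleRefl a p.1, simpleRefl a p.2) ∈ (orderedPairs l).erase (lo a, hi a) := by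
      rintro ⟨p, r⟩ hp
      simp only [Finset.mem_erase, mem_orderedPairs, ne_eq, Prod.mk.injEq] at hp ⊢
      refine ⟨?_, simpleRefl_lt_simpleRefl hp.2 hp.1⟩
      rintro ⟨h1, h2⟩
      have e1 : p = hi a := by rw [← inv p, h1, simpleRefl_lo]
      have e2 : r = lo a := by rw [← inv r, h2, simpleRefl_hi]
      have := lo_lt_hi a
      rw [e1, e2] at hp
      exact absurd hp.2 this.asymm
    refine Finset.sum_nbij' (fun p => (simpleRefl a p.1, simpleRefl a p.2))
      (fun p => (simpleRefl a p.1, simpleRefl a p.2)) hm hm ?_ ?_ ?_ <;>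
      simp [inv]
  simp only [simpleRefl_lo, simpleRefl_hi]
  rw [key]
  abel

/-- The number of pairs `p < r` with `μ_p < μ_r`, the distance of `μ` from its dominant
rearrangement. -/
def ninv (μ : Weight l) : ℕ := ∑ p ∈ orderedPairs l, if μ p.1 < μ p.2 then 1 else 0

theorem permAct_simpleRefl_apply (a : Fin (l - 1)) (μ : Weight l) (i : Fin l) :
    permAct (simpleRefl a) μ i = μ (simpleRefl a i) := by
  rw [permAct_apply, simpleRefl_inv]

@[simp] theorem permAct_simpleRefl_lo (a : Fin (l - 1)) (μ : Weight l) :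
    permAct (simpleRefl a) μ (lo a) = μ (hi a) := by
  rw [permAct_simpleRefl_apply, simpleRefl_lo]

@[simp] theorem permAct_simpleRefl_hi (a : Fin (l - 1)) (μ : Weight l) :
    permAct (simpleRefl a) μ (hi a) = μ (lo a) := by
  rw [permAct_simpleRefl_apply, simpleRefl_hi]

@[simp] theorem permAct_simpleRefl_self (a : Fin (l - 1)) (μ : Weight l) :
    permAct (simpleRefl a) (permAct (simpleRefl a) μ) = μ := by
  rw [← permAct_mul, simpleRefl_mul_self, permAct_one]

theorem permAct_simpleRefl_of_eq {a : Fin (l - 1)} {μ : Weight l} (h : μ (lo a) = μ (hi a)) :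
    permAct (simpleRefl a) μ = μ := by
  rw [permAct_simpleRefl, h, sub_self, zero_smul, sub_zero]

theorem ninv_permAct_simpleRefl {a : Fin (l - 1)} {μ : Weight l} (h : μ (lo a) < μ (hi a)) :
    ninv (permAct (simpleRefl a) μ) + 1 = ninv μ := by
  have := sum_orderedPairs_simpleRefl a fun p r => if μ p < μ r then 1 else 0
  simpa [ninv, permAct_simpleRefl_apply, h, h.asymm] using this

theorem ninv_permAct_simpleRefl_le (a : Fin (l - 1)) (μ : Weight l) :
    ninv (permAct (simpleRefl a) μ) ≤ ninv μ + 1 := by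
  rcases lt_trichotomy (μ (lo a)) (μ (hi a)) with h | h | h
  · have := ninv_permAct_simpleRefl h; omega
  · rw [permAct_simpleRefl_of_eq h]; omega
  · have := ninv_permAct_simpleRefl (a := a) (μ := permAct (simpleRefl a) μ) (by simpa using h)
    rw [permAct_simpleRefl_self] at this
    omega

theorem antitone_of_forall_simple {μ : Weight l} (h : ∀ a, μ (hi a) ≤ μ (lo a)) : Antitone μ := by
  cases l with
  | zero => exact fun i => i.elim0
  | succ n => exact Fin.antitone_iff_succ_le.2 fun i => h i

theorem ninv_eq_zero_of_antitone {μ : Weight l} (h : Antitone μ) : ninv μ = 0 := by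
  refine Finset.sum_eq_zero fun p hp => ?_
  rw [if_neg (h (mem_orderedPairs.1 hp).le).not_gt]

/-- The product of simple transpositions along a word. -/
def wordPerm (u : List (Fin (l - 1))) : Equiv.Perm (Fin l) := (u.map simpleRefl).prod

theorem wordPerm_cons (a : Fin (l - 1)) (u : List (Fin (l - 1))) :
    wordPerm (a :: u) = simpleRefl a * wordPerm u := by simp [wordPerm]

theorem ninv_permAct_wordPerm_le (u : List (Fin (l - 1))) (μ : Weight l) :
    ninv (permAct (wordPerm u) μ) ≤ ninv μ + u.length := by
  induction u with
  | nil => simp [wordPerm]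
  | cons a u ih =>
    rw [wordPerm_cons, permAct_mul, List.length_cons]
    have := ninv_permAct_simpleRefl_le a (permAct (wordPerm u) μ)
    omega

theorem dominantPerm_of_antitone {μ : Weight l} (h : Antitone μ) : dominantPerm μ = 1 :=
  Tuple.sort_eq_refl_iff_monotone.2 fun _ _ hij => neg_le_neg (h hij)

theorem dominantRep_of_antitone {μ : Weight l} (h : Antitone μ) : dominantRep μ = μ := by
  funext i; simp [dominantRep, dominantPerm_of_antitone h]

/-- The sorting permutation is the stable one, hence multiplicative along sorting steps. -/
theorem dominantPerm_eq_simpleRefl_mul {a : Fin (l - 1)} {μ : Weight l}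
    (h : μ (lo a) < μ (hi a)) :
    dominantPerm μ = simpleRefl a * dominantPerm (permAct (simpleRefl a) μ) := by
  set ν := permAct (simpleRefl a) μ with hν
  obtain ⟨h1, h2⟩ := Tuple.eq_sort_iff.1 (rfl : dominantPerm ν = Tuple.sort fun i => -ν i)
  have e : ∀ i, ν i = μ (simpleRefl a i) := permAct_simpleRefl_apply a μ
  symm
  refine Tuple.eq_sort_iff.2 ⟨fun i j hij => ?_, fun i j hij hμ => ?_⟩
  · simpa [e] using h1 hij
  · have hlt := h2 i j hij (by simpa [e] using hμ)
    refine simpleRefl_lt_simpleRefl hlt ?_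
    rintro ⟨e1, e2⟩
    simp [e1, e2] at hμ
    omega

theorem dominantRep_permAct_simpleRefl {a : Fin (l - 1)} {μ : Weight l}
    (h : μ (lo a) < μ (hi a)) : dominantRep (permAct (simpleRefl a) μ) = dominantRep μ := by
  funext i
  simp [dominantRep, dominantPerm_eq_simpleRefl_mul h, permAct_simpleRefl_apply]

/-- Induction on the distance from the dominant chamber. -/
theorem weight_induction {P : Weight l → Prop} (dom : ∀ μ, Antitone μ → P μ)
    (step : ∀ μ a, μ (lo a) < μ (hi a) → P (permAct (simpleRefl a) μ) → P μ) (μ : Weight l) :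
    P μ := by
  induction h : ninv μ using Nat.strong_induction_on generalizing μ with
  | _ n ih =>
    by_cases hμ : Antitone μ
    · exact dom μ hμ
    · obtain ⟨a, ha⟩ : ∃ a, μ (lo a) < μ (hi a) := by
        by_contra hc
        push Not at hc
        exact hμ (antitone_of_forall_simple hc)
      have := ninv_permAct_simpleRefl ha
      exact step μ a ha (ih _ (by omega) _ rfl)

theorem exists_word_dominantPerm (μ : Weight l) :
    ∃ u : List (Fin (l - 1)), u.length = ninv μ ∧ wordPerm u = dominantPerm μ := by
  induction μ using weight_induction with
  | dom μ h => exact ⟨[], by simp [ninv_eq_zero_of_antitone h], by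
      simp [wordPerm, dominantPerm_of_antitone h]⟩
  | step μ a ha ih =>
    obtain ⟨u, h1, h2⟩ := ih
    refine ⟨a :: u, ?_, ?_⟩
    · rw [List.length_cons, h1, ninv_permAct_simpleRefl ha]
    · rw [wordPerm_cons, h2, ← dominantPerm_eq_simpleRefl_mul ha]

theorem permLength_dominantPerm (μ : Weight l) : permLength (dominantPerm μ) = ninv μ := by
  classical
  apply le_antisymm
  · obtain ⟨u, h1, h2⟩ := exists_word_dominantPerm μ
    exact Nat.find_min' (exists_word _) ⟨u, h1, h2⟩
  · obtain ⟨u, h1, h2⟩ := exists_reducedWord (dominantPerm μ)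
    have := ninv_permAct_wordPerm_le u (dominantRep μ)
    rw [wordPerm, h2, permAct_dominantPerm,
      ninv_eq_zero_of_antitone (dominantRep_antitone μ)] at this
    omega

end Sorting

/-! ### The Hecke action on non-symmetric Hall–Littlewood polynomials -/

section HeckeOnHL

variable {𝕜 : Type*} [Field 𝕜] {l : ℕ}

theorem demazureLusztig_mono_of_eq (t : 𝕜) {a : Fin (l - 1)} {μ : Weight l}
    (h : μ (lo a) = μ (hi a)) : demazureLusztig t a (mono 𝕜 μ) = t • mono 𝕜 μ := by
  simp [demazureLusztig, divDiff, extendLinear_mono, permOp_mono, h, permAct_simpleRefl_of_eq h]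

theorem demazureLusztig_mono_of_gt (t : 𝕜) {a : Fin (l - 1)} {μ : Weight l}
    (h : μ (hi a) < μ (lo a)) :
    demazureLusztig t a (mono 𝕜 μ) =
      t • mono 𝕜 (permAct (simpleRefl a) μ) + (t - 1) • mono 𝕜 μ +
        (t - 1) • ∑ m ∈ Finset.range ((μ (lo a) - μ (hi a)).toNat - 1),
          mono 𝕜 (μ - ((m : ℤ) + 1) • simpleRoot a) := by
  have e1 : (μ (hi a) - μ (lo a)).toNat = 0 := by omega
  obtain ⟨n, hn⟩ : ∃ n, (μ (lo a) - μ (hi a)).toNat = n + 1 :=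
    ⟨(μ (lo a) - μ (hi a)).toNat - 1, by omega⟩
  simp only [demazureLusztig, LinearMap.add_apply, LinearMap.smul_apply, permOp_mono, divDiff,
    extendLinear_mono, e1, hn, Finset.range_zero, Finset.sum_empty, Finset.sum_range_succ',
    Nat.add_sub_cancel]
  simp only [Nat.cast_add, Nat.cast_one, Nat.cast_zero, zero_smul, sub_zero]
  module

theorem demazureLusztig_mono_of_lt (t : 𝕜) {a : Fin (l - 1)} {μ : Weight l}
    (h : μ (lo a) < μ (hi a)) :
    demazureLusztig t a (mono 𝕜 μ) =
      mono 𝕜 (permAct (simpleRefl a) μ) +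
        (1 - t) • ∑ m ∈ Finset.range ((μ (hi a) - μ (lo a)).toNat - 1),
          mono 𝕜 (μ + ((m : ℤ) + 1) • simpleRoot a) := by
  have e1 : (μ (lo a) - μ (hi a)).toNat = 0 := by omega
  obtain ⟨n, hn⟩ : ∃ n, (μ (hi a) - μ (lo a)).toNat = n + 1 :=
    ⟨(μ (hi a) - μ (lo a)).toNat - 1, by omega⟩
  have e2 : μ + ((n : ℤ) + 1) • simpleRoot a = permAct (simpleRefl a) μ := by
    rw [permAct_simpleRefl, show μ (lo a) - μ (hi a) = -((n : ℤ) + 1) by omega]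
    module
  simp only [demazureLusztig, LinearMap.add_apply, LinearMap.smul_apply, permOp_mono, divDiff,
    extendLinear_mono, e1, hn, Finset.range_zero, Finset.sum_empty, Finset.sum_range_succ,
    Nat.add_sub_cancel, e2]
  module

/-- The product of Demazure–Lusztig operators along a word. -/
def heckeWord (t : 𝕜) (u : List (Fin (l - 1))) : Module.End 𝕜 (LaurentPoly 𝕜 l) :=
  (u.map (demazureLusztig t)).prod

theorem heckeWord_cons (t : 𝕜) (a : Fin (l - 1)) (u : List (Fin (l - 1)))
    (f : LaurentPoly 𝕜 l) :
    heckeWord t (a :: u) f = demazureLusztig t a (heckeWord t u f) := by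
  simp [heckeWord]

/-- `T_w x^{μ₊}` for `μ = w (μ₊)`, which is `E_μ` up to a power of `t`. -/
def rawHL (t : 𝕜) (μ : Weight l) : LaurentPoly 𝕜 l :=
  heckeT t (dominantPerm μ) (mono 𝕜 (dominantRep μ))

/-- A word which leads from `μ₊` to `μ` in the least possible number of steps. -/
def IsPathTo (μ : Weight l) (u : List (Fin (l - 1))) : Prop :=
  u.length = ninv μ ∧ permAct (wordPerm u) (dominantRep μ) = μ

theorem isPathTo_reducedWord (μ : Weight l) : IsPathTo μ (reducedWord (dominantPerm μ)) := by
  obtain ⟨h1, h2⟩ := Classical.choose_spec (exists_reducedWord (dominantPerm μ))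
  exact ⟨h1.trans (permLength_dominantPerm μ), by
    rw [wordPerm, reducedWord, h2, permAct_dominantPerm]⟩

theorem IsPathTo.cons {μ : Weight l} {a : Fin (l - 1)} (h : μ (lo a) < μ (hi a))
    {u : List (Fin (l - 1))} (hu : IsPathTo (permAct (simpleRefl a) μ) u) :
    IsPathTo μ (a :: u) := by
  refine ⟨?_, ?_⟩
  · rw [List.length_cons, hu.1, ninv_permAct_simpleRefl h]
  · have := hu.2
    rw [dominantRep_permAct_simpleRefl h] at this
    rw [wordPerm_cons, permAct_mul, this, permAct_simpleRefl_self]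

/-- Every step of a shortest path is a sorting step. -/
theorem IsPathTo.of_cons {μ : Weight l} {a : Fin (l - 1)} {u : List (Fin (l - 1))}
    (h : IsPathTo μ (a :: u)) :
    μ (lo a) < μ (hi a) ∧ IsPathTo (permAct (simpleRefl a) μ) u := by
  obtain ⟨h1, h2⟩ := h
  rw [wordPerm_cons, permAct_mul] at h2
  rw [List.length_cons] at h1
  have h3 := ninv_permAct_wordPerm_le u (dominantRep μ)
  rw [ninv_eq_zero_of_antitone (dominantRep_antitone μ)] at h3
  have h4 : permAct (wordPerm u) (dominantRep μ) = permAct (simpleRefl a) μ := by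
    rw [← h2, permAct_simpleRefl_self, h2]
  rw [h4] at h3
  have hlt : μ (lo a) < μ (hi a) := by
    by_contra hc
    rcases (not_lt.1 hc).eq_or_lt with hc | hc
    · rw [permAct_simpleRefl_of_eq hc.symm] at h3; omega
    · have := ninv_permAct_simpleRefl (a := a) (μ := permAct (simpleRefl a) μ) (by simpa using hc)
      rw [permAct_simpleRefl_self] at this
      omega
  have h5 := ninv_permAct_simpleRefl hlt
  exact ⟨hlt, by omega, by rw [dominantRep_permAct_simpleRefl hlt, h4]⟩

theorem IsPathTo.eq_nil {μ : Weight l} {u : List (Fin (l - 1))} (h : IsPathTo μ u)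
    (hμ : Antitone μ) : u = [] :=
  List.length_eq_zero_iff.1 (h.1.trans (ninv_eq_zero_of_antitone hμ))

theorem lo_hi_cases (a b : Fin (l - 1)) :
    a = b ∨ hi a = lo b ∨ hi b = lo a ∨ (a ≠ b ∧ hi a ≠ lo b ∧ hi b ≠ lo a) := by tauto

theorem permAct_simpleRefl_of_ne {a : Fin (l - 1)} {i : Fin l} (h1 : i ≠ lo a) (h2 : i ≠ hi a)
    (μ : Weight l) : permAct (simpleRefl a) μ i = μ i := by
  rw [permAct_simpleRefl_apply, simpleRefl_of_ne h1 h2]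

/-- The diamond at the end of two shortest paths with different last steps, closed by the
commutation or braid relation.  The hypothesis says that the recursion for `G` is known for the
weights closer to the dominant chamber. -/
theorem demazureLusztig_diamond (t : 𝕜) {G : Weight l → LaurentPoly 𝕜 l} {μ : Weight l}
    {a b : Fin (l - 1)} (ha : μ (lo a) < μ (hi a)) (hb : μ (lo b) < μ (hi b))
    (hG : ∀ ν, ninv ν < ninv μ → ∀ c, ν (lo c) < ν (hi c) →
      G ν = demazureLusztig t c (G (permAct (simpleRefl c) ν))) :
    demazureLusztig t a (G (permAct (simpleRefl a) μ)) =
      demazureLusztig t b (G (permAct (simpleRefl b) μ)) := by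
  have braid : ∀ a b : Fin (l - 1), μ (lo a) < μ (hi a) → μ (lo b) < μ (hi b) → hi a = lo b →
      demazureLusztig t a (G (permAct (simpleRefl a) μ)) =
        demazureLusztig t b (G (permAct (simpleRefl b) μ)) := by
    intro a b ha hb h
    have n1 : lo a ≠ hi b := by
      simp only [hi, lo, Fin.ext_iff, ne_eq] at h ⊢; omega
    have n2 : hi b ≠ hi a := h ▸ (lo_ne_hi b).symm
    have n3 : lo a ≠ lo b := h ▸ lo_ne_hi a
    have i1 := ninv_permAct_simpleRefl ha
    have i2 := ninv_permAct_simpleRefl hb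
    have a1 : (permAct (simpleRefl a) μ) (lo b) < (permAct (simpleRefl a) μ) (hi b) := by
      rw [permAct_simpleRefl_of_ne n1.symm n2, ← h, permAct_simpleRefl_hi]
      exact ha.trans (h ▸ hb)
    have i3 := ninv_permAct_simpleRefl a1
    have a2 : (permAct (simpleRefl b) (permAct (simpleRefl a) μ)) (lo a) <
        (permAct (simpleRefl b) (permAct (simpleRefl a) μ)) (hi a) := by
      rw [permAct_simpleRefl_of_ne n3 n1, permAct_simpleRefl_lo, h, permAct_simpleRefl_lo,
        permAct_simpleRefl_of_ne n1.symm n2]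
      exact hb
    have b1 : (permAct (simpleRefl b) μ) (lo a) < (permAct (simpleRefl b) μ) (hi a) := by
      rw [permAct_simpleRefl_of_ne n3 n1, h, permAct_simpleRefl_lo]
      exact (h ▸ ha).trans hb
    have i4 := ninv_permAct_simpleRefl b1
    have b2 : (permAct (simpleRefl a) (permAct (simpleRefl b) μ)) (lo b) <
        (permAct (simpleRefl a) (permAct (simpleRefl b) μ)) (hi b) := by
      rw [permAct_simpleRefl_of_ne n1.symm n2, permAct_simpleRefl_hi, ← h, permAct_simpleRefl_hi,
        permAct_simpleRefl_of_ne n3 n1]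
      exact h ▸ ha
    rw [hG _ (by omega) b a1, hG _ (by omega) a a2, hG _ (by omega) a b1, hG _ (by omega) b b2,
      demazureLusztig_braid t h]
    simp only [← permAct_mul, ← mul_assoc, simpleRefl_braid h]
  rcases lo_hi_cases a b with rfl | h | h | ⟨h, h1, h2⟩
  · rfl
  · exact braid a b ha hb h
  · exact (braid b a hb ha h).symm
  · have h3 : lo a ≠ lo b := by simpa [lo, Fin.ext_iff] using h
    have h4 : hi a ≠ hi b := by simpa [hi, Fin.ext_iff] using h
    have i1 := ninv_permAct_simpleRefl ha
    have i2 := ninv_permAct_simpleRefl hb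
    rw [hG (permAct (simpleRefl a) μ) (by omega) b (by
        rwa [permAct_simpleRefl_of_ne h3.symm h1.symm, permAct_simpleRefl_of_ne h2 h4.symm]),
      hG (permAct (simpleRefl b) μ) (by omega) a (by
        rwa [permAct_simpleRefl_of_ne h3 h2.symm, permAct_simpleRefl_of_ne h1 h4]),
      demazureLusztig_comm t h1 h2 h, ← permAct_mul, ← permAct_mul, simpleRefl_comm h1 h2 h]

/-- The polynomial `T_{i₁} ⋯ T_{i_n} x^{μ₊}` is the same for all shortest paths from `μ₊` to `μ`.
This takes the place of the independence of `T_w` of the reduced expression of `w`. -/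
theorem heckeWord_eq_rawHL (t : 𝕜) (μ : Weight l) {u : List (Fin (l - 1))} (hu : IsPathTo μ u) :
    heckeWord t u (mono 𝕜 (dominantRep μ)) = rawHL t μ := by
  induction h : ninv μ using Nat.strong_induction_on generalizing μ u with
  | _ n ih =>
    have hG : ∀ ν : Weight l, ninv ν < ninv μ → ∀ c, ν (lo c) < ν (hi c) →
        rawHL t ν = demazureLusztig t c (rawHL t (permAct (simpleRefl c) ν)) := by
      intro ν hν c hc
      rw [← ih _ (by omega) ν ((isPathTo_reducedWord _).cons hc) rfl, heckeWord_cons,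
        ← dominantRep_permAct_simpleRefl hc]
      rfl
    -- Compare with an arbitrary second path, as the tail of a reduced word need not be the chosen
    -- reduced word of its product.
    have hR := isPathTo_reducedWord μ
    change _ = heckeWord t (reducedWord (dominantPerm μ)) _
    generalize reducedWord (dominantPerm μ) = v at hR
    match u, v, hu, hR with
    | [], [], _, _ => rfl
    | [], _ :: _, hu, hR => exact absurd (hu.1.trans hR.1.symm) (by simp)
    | _ :: _, [], hu, hR => exact absurd (hu.1.trans hR.1.symm) (by simp)
    | a :: u, b :: v, hu, hR =>
      obtain ⟨ha, hu⟩ := hu.of_cons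
      obtain ⟨hb, hR⟩ := hR.of_cons
      have ia := ninv_permAct_simpleRefl ha
      have ib := ninv_permAct_simpleRefl hb
      have e1 := ih _ (by omega) _ hu rfl
      have e2 := ih _ (by omega) _ hR rfl
      rw [dominantRep_permAct_simpleRefl ha] at e1
      rw [dominantRep_permAct_simpleRefl hb] at e2
      rw [heckeWord_cons, heckeWord_cons, e1, e2]
      exact demazureLusztig_diamond t ha hb hG

theorem rawHL_of_antitone (t : 𝕜) {μ : Weight l} (h : Antitone μ) : rawHL t μ = mono 𝕜 μ := by
  rw [← heckeWord_eq_rawHL t μ (isPathTo_reducedWord μ), (isPathTo_reducedWord μ).eq_nil h,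
    dominantRep_of_antitone h]
  rfl

theorem rawHL_eq_demazureLusztig (t : 𝕜) {μ : Weight l} {a : Fin (l - 1)}
    (h : μ (lo a) < μ (hi a)) :
    rawHL t μ = demazureLusztig t a (rawHL t (permAct (simpleRefl a) μ)) := by
  rw [← heckeWord_eq_rawHL t μ ((isPathTo_reducedWord _).cons h), heckeWord_cons,
    ← dominantRep_permAct_simpleRefl h]
  rfl

/-- If `μ_a = μ_{a+1}`, then `E_μ` is a `t`-eigenvector of `T_a`: by the braid relation the
eigenvector property is transported along a shortest path from the dominant weight. -/
theorem demazureLusztig_rawHL_of_eq (t : 𝕜) {μ : Weight l} {a : Fin (l - 1)}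
    (h : μ (lo a) = μ (hi a)) : demazureLusztig t a (rawHL t μ) = t • rawHL t μ := by
  induction hn : ninv μ using Nat.strong_induction_on generalizing μ a with
  | _ n ih =>
    by_cases hμ : Antitone μ
    · rw [rawHL_of_antitone t hμ, demazureLusztig_mono_of_eq t h]
    obtain ⟨b, hb⟩ : ∃ b, μ (lo b) < μ (hi b) := by
      by_contra hc
      push Not at hc
      exact hμ (antitone_of_forall_simple hc)
    have ib := ninv_permAct_simpleRefl hb
    -- Sort `μ` at `b`.  If `b` is adjacent to `a`, the sorted weight can be sorted further at `a`,
    -- after which the entries at `b` are equal, and `T_a T_b T_a = T_b T_a T_b` applies.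
    rw [rawHL_eq_demazureLusztig t hb]
    rcases lo_hi_cases a b with rfl | hab | hab | ⟨hab, h1, h2⟩
    · omega
    · have n1 : lo a ≠ hi b := by
        simp only [hi, lo, Fin.ext_iff, ne_eq] at hab ⊢; omega
      have n2 : hi b ≠ hi a := hab ▸ (lo_ne_hi b).symm
      have n3 : lo a ≠ lo b := hab ▸ lo_ne_hi a
      have b1 : (permAct (simpleRefl b) μ) (lo a) < (permAct (simpleRefl b) μ) (hi a) := by
        rw [permAct_simpleRefl_of_ne n3 n1, hab, permAct_simpleRefl_lo, h, hab]
        exact hb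
      have i2 := ninv_permAct_simpleRefl b1
      have key := ih (ninv (permAct (simpleRefl a) (permAct (simpleRefl b) μ))) (by omega)
        (μ := permAct (simpleRefl a) (permAct (simpleRefl b) μ)) (a := b) (by
          rw [permAct_simpleRefl_of_ne n1.symm n2, permAct_simpleRefl_hi, ← hab,
            permAct_simpleRefl_hi, permAct_simpleRefl_of_ne n3 n1, h]) rfl
      rw [rawHL_eq_demazureLusztig t b1, demazureLusztig_braid t hab, key, map_smul, map_smul]
    · have n1 : lo b ≠ hi a := by
        simp only [hi, lo, Fin.ext_iff, ne_eq] at hab ⊢; omega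
      have n2 : hi a ≠ hi b := hab ▸ (lo_ne_hi a).symm
      have n3 : lo b ≠ lo a := hab ▸ lo_ne_hi b
      have b1 : (permAct (simpleRefl b) μ) (lo a) < (permAct (simpleRefl b) μ) (hi a) := by
        rw [permAct_simpleRefl_of_ne n1.symm n2, ← hab, permAct_simpleRefl_hi, ← h, ← hab]
        exact hb
      have i2 := ninv_permAct_simpleRefl b1
      have key := ih (ninv (permAct (simpleRefl a) (permAct (simpleRefl b) μ))) (by omega)
        (μ := permAct (simpleRefl a) (permAct (simpleRefl b) μ)) (a := b) (by
          rw [permAct_simpleRefl_of_ne n3 n1, permAct_simpleRefl_lo, hab,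
            permAct_simpleRefl_lo, permAct_simpleRefl_of_ne n1.symm n2, h]) rfl
      rw [rawHL_eq_demazureLusztig t b1, ← demazureLusztig_braid t hab, key, map_smul, map_smul]
    · have h3 : lo a ≠ lo b := by simpa [lo, Fin.ext_iff] using hab
      have h4 : hi a ≠ hi b := by simpa [hi, Fin.ext_iff] using hab
      rw [demazureLusztig_comm t h1 h2 hab, ih _ (by omega) (by
        rwa [permAct_simpleRefl_of_ne h3 h2.symm, permAct_simpleRefl_of_ne h1 h4]) rfl, map_smul]

theorem nsHL_eq (t : 𝕜) (μ : Weight l) : nsHL t μ = (t ^ ninv μ)⁻¹ • rawHL t μ := by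
  rw [nsHL, permLength_dominantPerm, rawHL]

theorem nsHL_of_antitone (t : 𝕜) {μ : Weight l} (h : Antitone μ) : nsHL t μ = mono 𝕜 μ := by
  rw [nsHL_eq, rawHL_of_antitone t h, ninv_eq_zero_of_antitone h]
  simp

theorem demazureLusztig_nsHL_of_gt {t : 𝕜} (ht : t ≠ 0) {μ : Weight l} {a : Fin (l - 1)}
    (h : μ (hi a) < μ (lo a)) :
    demazureLusztig t a (nsHL t μ) = t • nsHL t (permAct (simpleRefl a) μ) := by
  have h' : (permAct (simpleRefl a) μ) (lo a) < (permAct (simpleRefl a) μ) (hi a) := by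
    simpa using h
  have i := ninv_permAct_simpleRefl h'
  rw [permAct_simpleRefl_self] at i
  rw [nsHL_eq, nsHL_eq, rawHL_eq_demazureLusztig t h', permAct_simpleRefl_self, ← i, map_smul,
    smul_smul, pow_succ]
  congr 1
  field_simp

theorem demazureLusztig_nsHL_of_eq (t : 𝕜) {μ : Weight l} {a : Fin (l - 1)}
    (h : μ (lo a) = μ (hi a)) : demazureLusztig t a (nsHL t μ) = t • nsHL t μ := by
  rw [nsHL_eq, map_smul, demazureLusztig_rawHL_of_eq t h, smul_comm]

theorem demazureLusztig_nsHL_of_lt {t : 𝕜} (ht : t ≠ 0) {μ : Weight l} {a : Fin (l - 1)}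
    (h : μ (lo a) < μ (hi a)) :
    demazureLusztig t a (nsHL t μ) =
      (t - 1) • nsHL t μ + nsHL t (permAct (simpleRefl a) μ) := by
  have h1 := demazureLusztig_nsHL_of_gt ht (a := a) (μ := permAct (simpleRefl a) μ)
    (by simpa using h)
  rw [permAct_simpleRefl_self] at h1
  have h2 := congrArg (demazureLusztig t a) h1
  rw [demazureLusztig_sq, h1, map_smul] at h2
  have h3 := congrArg (fun f => t⁻¹ • f) h2
  simp only [smul_add, smul_smul, inv_mul_cancel₀ ht, one_smul] at h3
  rw [← h3]
  congr 2
  field_simp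

end HeckeOnHL

/-! ### Unitriangularity and the basis property -/

section Basis

variable {𝕜 : Type*} [Field 𝕜] {l : ℕ}

/-- The squared Euclidean length of a weight. -/
def normSq (μ : Weight l) : ℕ := ∑ i, (μ i).natAbs ^ 2

theorem cast_normSq (μ : Weight l) : (normSq μ : ℤ) = ∑ i, μ i ^ 2 := by
  simp [normSq]

theorem normSq_add_smul_simpleRoot (μ : Weight l) (k : ℤ) (a : Fin (l - 1)) :
    (normSq (μ + k • simpleRoot a) : ℤ) =
      normSq μ + 2 * k * (μ (lo a) - μ (hi a)) + 2 * k ^ 2 := by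
  have hne := lo_ne_hi a
  rw [cast_normSq, cast_normSq]
  have e : ∀ i, (μ + k • simpleRoot a) i ^ 2 = μ i ^ 2 +
      (if i = lo a then 2 * k * μ i + k ^ 2 else 0) +
      (if i = hi a then - 2 * k * μ i + k ^ 2 else 0) := by
    intro i
    simp only [simpleRoot, Pi.add_apply, Pi.smul_apply, Pi.sub_apply, smul_eq_mul, Pi.single_apply]
    by_cases h1 : i = lo a
    · subst h1; simp only [hne, if_true, if_false]; ring
    · by_cases h2 : i = hi a
      · subst h2; simp only [hne.symm, if_true, if_false]; ring
      · simp only [h1, h2, if_false]; ring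
  simp only [e, Finset.sum_add_distrib, Finset.sum_ite_eq', Finset.mem_univ, if_true]
  ring

theorem normSq_permAct (w : Equiv.Perm (Fin l)) (μ : Weight l) :
    normSq (permAct w μ) = normSq μ :=
  Equiv.sum_comp w⁻¹ fun i => (μ i).natAbs ^ 2

theorem ninv_le (μ : Weight l) : ninv μ ≤ l * l := by
  calc ninv μ ≤ ∑ p ∈ orderedPairs l, 1 := Finset.sum_le_sum fun p _ => by split_ifs <;> simp
    _ ≤ l * l := by
      rw [Finset.sum_const, smul_eq_mul, mul_one]
      exact (Finset.card_le_univ _).trans (by simp)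

/-- A numerical grading of the weights, by Euclidean length and then by distance from the dominant
chamber, for which `E_μ` is unitriangular. -/
def weightRank (μ : Weight l) : ℕ := normSq μ * (l * l + 1) + ninv μ

theorem weightRank_lt_of_normSq_lt {μ ν : Weight l} (h : normSq μ < normSq ν) :
    weightRank μ < weightRank ν := by
  have h1 := ninv_le μ
  have h2 : (normSq μ + 1) * (l * l + 1) ≤ normSq ν * (l * l + 1) :=
    Nat.mul_le_mul_right _ h
  unfold weightRank
  nlinarith

theorem weightRank_permAct_simpleRefl_le (a : Fin (l - 1)) (μ : Weight l) :
    weightRank (permAct (simpleRefl a) μ) ≤ weightRank μ + 1 := by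
  have := ninv_permAct_simpleRefl_le a μ
  rw [weightRank, weightRank, normSq_permAct]
  omega

theorem weightRank_permAct_simpleRefl {a : Fin (l - 1)} {μ : Weight l}
    (h : μ (lo a) < μ (hi a)) : weightRank (permAct (simpleRefl a) μ) + 1 = weightRank μ := by
  have := ninv_permAct_simpleRefl h
  rw [weightRank, weightRank, normSq_permAct]
  omega

/-- The span of the monomials whose weights lie in a set. -/
def monoSpan (𝕜 : Type*) [Field 𝕜] {l : ℕ} (S : Set (Weight l)) :
    Submodule 𝕜 (LaurentPoly 𝕜 l) :=
  Submodule.span 𝕜 (mono 𝕜 '' S)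

theorem mono_mem_monoSpan {S : Set (Weight l)} {μ : Weight l} (h : μ ∈ S) :
    mono 𝕜 μ ∈ monoSpan 𝕜 S :=
  Submodule.subset_span ⟨μ, h, rfl⟩

theorem coeff_eq_zero_of_mem_monoSpan {S : Set (Weight l)} {f : LaurentPoly 𝕜 l}
    (hf : f ∈ monoSpan 𝕜 S) {μ : Weight l} (hμ : μ ∉ S) : f.coeff μ = 0 := by
  induction hf using Submodule.span_induction with
  | mem x hx =>
    obtain ⟨ν, hν, rfl⟩ := hx
    rw [coeff_mono, if_neg]
    rintro rfl
    exact hμ hν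
  | zero => simp
  | add x y _ _ hx hy => simp [hx, hy]
  | smul c x _ hx => simp [hx]

theorem map_mem_of_forall_mono {S S' : Set (Weight l)} {T : Module.End 𝕜 (LaurentPoly 𝕜 l)}
    (h : ∀ μ ∈ S, T (mono 𝕜 μ) ∈ monoSpan 𝕜 S') {f : LaurentPoly 𝕜 l}
    (hf : f ∈ monoSpan 𝕜 S) : T f ∈ monoSpan 𝕜 S' := by
  have : monoSpan 𝕜 S ≤ (monoSpan 𝕜 S').comap T := by
    refine Submodule.span_le.2 ?_
    rintro _ ⟨μ, hμ, rfl⟩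
    exact h μ hμ
  exact this hf

theorem demazureLusztig_mono_mem (t : 𝕜) (a : Fin (l - 1)) (μ : Weight l) {N : ℕ}
    (h : weightRank μ < N) :
    demazureLusztig t a (mono 𝕜 μ) ∈ monoSpan 𝕜 {ν : Weight l | weightRank ν < N + 1} := by
  have h0 : mono 𝕜 μ ∈ monoSpan 𝕜 {ν : Weight l | weightRank ν < N + 1} :=
    mono_mem_monoSpan (Set.mem_ofPred.2 (by omega))
  have h1 : mono 𝕜 (permAct (simpleRefl a) μ) ∈
      monoSpan 𝕜 {ν : Weight l | weightRank ν < N + 1} := by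
    have := weightRank_permAct_simpleRefl_le a μ
    exact mono_mem_monoSpan (Set.mem_ofPred.2 (by omega))
  rcases lt_trichotomy (μ (lo a)) (μ (hi a)) with hlt | heq | hgt
  · rw [demazureLusztig_mono_of_lt t hlt]
    refine add_mem h1 (Submodule.smul_mem _ _ (sum_mem fun m hm => mono_mem_monoSpan ?_))
    have hm' : (m : ℤ) + 1 < μ (hi a) - μ (lo a) := by
      have := Finset.mem_range.1 hm; omega
    have hn := normSq_add_smul_simpleRoot μ ((m : ℤ) + 1) a
    have := weightRank_lt_of_normSq_lt (μ := μ + ((m : ℤ) + 1) • simpleRoot a) (ν := μ)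
      (by nlinarith)
    exact Set.mem_ofPred.2 (by omega)
  · rw [demazureLusztig_mono_of_eq t heq]
    exact Submodule.smul_mem _ _ h0
  · rw [demazureLusztig_mono_of_gt t hgt]
    refine add_mem (add_mem (Submodule.smul_mem _ _ h1) (Submodule.smul_mem _ _ h0))
      (Submodule.smul_mem _ _ (sum_mem fun m hm => mono_mem_monoSpan ?_))
    have hm' : (m : ℤ) + 1 < μ (lo a) - μ (hi a) := by
      have := Finset.mem_range.1 hm; omega
    have hn := normSq_add_smul_simpleRoot μ (-((m : ℤ) + 1)) a
    rw [neg_smul, ← sub_eq_add_neg] at hn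
    have := weightRank_lt_of_normSq_lt (μ := μ - ((m : ℤ) + 1) • simpleRoot a) (ν := μ)
      (by nlinarith)
    exact Set.mem_ofPred.2 (by omega)

/-- `E_μ` is `x^μ` plus terms of lower rank. -/
theorem nsHL_sub_mono_mem {t : 𝕜} (ht : t ≠ 0) (μ : Weight l) :
    nsHL t μ - mono 𝕜 μ ∈ monoSpan 𝕜 {ν : Weight l | weightRank ν < weightRank μ} := by
  induction μ using weight_induction with
  | dom μ h => rw [nsHL_of_antitone t h, sub_self]; exact zero_mem _
  | step μ a h ih =>
    set ν := permAct (simpleRefl a) μ with hν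
    have hs : permAct (simpleRefl a) ν = μ := by rw [hν, permAct_simpleRefl_self]
    have hgt : ν (hi a) < ν (lo a) := by simpa [hν] using h
    have hr : weightRank ν + 1 = weightRank μ := weightRank_permAct_simpleRefl h
    have h1 := demazureLusztig_nsHL_of_gt ht hgt
    rw [hs] at h1
    have h2 := map_mem_of_forall_mono (T := demazureLusztig t a)
      (fun κ hκ => demazureLusztig_mono_mem t a κ hκ) ih
    rw [hr, map_sub, h1, demazureLusztig_mono_of_gt t hgt, hs] at h2
    have h3 : (t - 1) • mono 𝕜 ν + (t - 1) •
        ∑ m ∈ Finset.range ((ν (lo a) - ν (hi a)).toNat - 1),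
          mono 𝕜 (ν - ((m : ℤ) + 1) • simpleRoot a) ∈
        monoSpan 𝕜 {κ : Weight l | weightRank κ < weightRank μ} := by
      refine add_mem (Submodule.smul_mem _ _ (mono_mem_monoSpan (Set.mem_ofPred.2 (by omega))))
        (Submodule.smul_mem _ _ (sum_mem fun m hm => mono_mem_monoSpan ?_))
      have hm' : (m : ℤ) + 1 < ν (lo a) - ν (hi a) := by
        have := Finset.mem_range.1 hm; omega
      have hn := normSq_add_smul_simpleRoot ν (-((m : ℤ) + 1)) a
      rw [neg_smul, ← sub_eq_add_neg] at hn
      have := weightRank_lt_of_normSq_lt (μ := ν - ((m : ℤ) + 1) • simpleRoot a) (ν := ν)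
        (by nlinarith)
      exact Set.mem_ofPred.2 (by omega)
    have h4 := Submodule.smul_mem _ t⁻¹ (add_mem h2 h3)
    convert h4 using 1
    rw [show t • nsHL t μ - (t • mono 𝕜 μ + (t - 1) • mono 𝕜 ν + (t - 1) •
        ∑ m ∈ Finset.range ((ν (lo a) - ν (hi a)).toNat - 1),
          mono 𝕜 (ν - ((m : ℤ) + 1) • simpleRoot a)) + ((t - 1) • mono 𝕜 ν + (t - 1) •
        ∑ m ∈ Finset.range ((ν (lo a) - ν (hi a)).toNat - 1),
          mono 𝕜 (ν - ((m : ℤ) + 1) • simpleRoot a)) = t • (nsHL t μ - mono 𝕜 μ) by module,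
      smul_smul, inv_mul_cancel₀ ht, one_smul]

theorem span_mono_eq_top : Submodule.span 𝕜 (Set.range (mono 𝕜 : Weight l → _)) = ⊤ := by
  refine Submodule.eq_top_iff'.2 fun f => ?_
  induction f using AddMonoidAlgebra.induction_linear with
  | zero => exact zero_mem _
  | add a b ha hb => exact add_mem ha hb
  | single μ c =>
    have e : (AddMonoidAlgebra.single μ c : LaurentPoly 𝕜 l) = c • mono 𝕜 μ := by simp [mono]
    rw [e]
    exact Submodule.smul_mem _ _ (Submodule.subset_span ⟨μ, rfl⟩)

section Unitriangular

variable {F : Weight l → LaurentPoly 𝕜 l}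
  (hF : ∀ μ, F μ - mono 𝕜 μ ∈ monoSpan 𝕜 {ν : Weight l | weightRank ν < weightRank μ})
include hF

theorem span_eq_top_of_unitriangular : Submodule.span 𝕜 (Set.range F) = ⊤ := by
  rw [eq_top_iff, ← span_mono_eq_top, Submodule.span_le]
  rintro _ ⟨μ, rfl⟩
  induction h : weightRank μ using Nat.strong_induction_on generalizing μ with
  | _ n ih =>
    have h1 : monoSpan 𝕜 {ν : Weight l | weightRank ν < weightRank μ} ≤
        Submodule.span 𝕜 (Set.range F) := by
      refine Submodule.span_le.2 ?_
      rintro _ ⟨ν, hν, rfl⟩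
      exact ih _ (h ▸ hν) ν rfl
    have h2 := sub_mem (Submodule.subset_span ⟨μ, rfl⟩ : F μ ∈ Submodule.span 𝕜 (Set.range F))
      (h1 (hF μ))
    rwa [sub_sub_cancel] at h2

theorem linearIndependent_of_unitriangular : LinearIndependent 𝕜 F := by
  rw [linearIndependent_iff]
  intro c hc
  by_contra hne
  obtain ⟨μ, hμ, hmax⟩ := Finset.exists_max_image c.support weightRank
    (Finsupp.support_nonempty_iff.2 hne)
  have h1 := congrArg (fun f : LaurentPoly 𝕜 l => f.coeff μ) hc
  simp only [Finsupp.linearCombination_apply, Finsupp.sum, AddMonoidAlgebra.coeff_sum,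
    AddMonoidAlgebra.coeff_smul, Finsupp.coe_finsetSum, Finset.sum_apply, Finsupp.smul_apply,
    AddMonoidAlgebra.coeff_zero, Finsupp.coe_zero, Pi.zero_apply] at h1
  rw [Finset.sum_eq_single μ] at h1
  · have h2 : (F μ).coeff μ = 1 := by
      have := coeff_eq_zero_of_mem_monoSpan (hF μ) (μ := μ) (by simp)
      rw [AddMonoidAlgebra.coeff_sub, Finsupp.sub_apply, coeff_mono, if_pos rfl,
        sub_eq_zero] at this
      exact this
    rw [h2, smul_eq_mul, mul_one] at h1
    exact Finsupp.mem_support_iff.1 hμ h1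
  · intro ν hν hne'
    have := coeff_eq_zero_of_mem_monoSpan (hF ν) (μ := μ) (by simpa using hmax ν hν)
    rw [AddMonoidAlgebra.coeff_sub, Finsupp.sub_apply, coeff_mono, if_neg hne', sub_zero] at this
    rw [this, smul_zero]
  · exact fun h => absurd hμ h

end Unitriangular

theorem isUnit_demazureLusztig {t : 𝕜} (ht : t ≠ 0) (a : Fin (l - 1)) :
    IsUnit (demazureLusztig (𝕜 := 𝕜) t a) := by
  have h : demazureLusztig t a * demazureLusztig t a =
      (t - 1) • demazureLusztig t a + t • (1 : Module.End 𝕜 (LaurentPoly 𝕜 l)) :=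
    LinearMap.ext fun f => demazureLusztig_sq t a f
  refine isUnit_iff_exists.2 ⟨t⁻¹ • (demazureLusztig t a - (t - 1) • 1), ?_, ?_⟩
  · rw [mul_smul_comm, mul_sub, h, mul_smul_comm, mul_one, add_sub_cancel_left, smul_smul,
      inv_mul_cancel₀ ht, one_smul]
  · rw [smul_mul_assoc, sub_mul, h, smul_mul_assoc, one_mul, add_sub_cancel_left, smul_smul,
      inv_mul_cancel₀ ht, one_smul]

theorem isUnit_heckeT {t : 𝕜} (ht : t ≠ 0) (w : Equiv.Perm (Fin l)) :
    IsUnit (heckeT (𝕜 := 𝕜) t w) := by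
  unfold heckeT
  generalize reducedWord w = u
  induction u with
  | nil => simp
  | cons a u ih => simpa using (isUnit_demazureLusztig ht a).mul ih

theorem isUnit_ringInverse_heckeT {t : 𝕜} (ht : t ≠ 0) (w : Equiv.Perm (Fin l)) :
    IsUnit (Ring.inverse (heckeT (𝕜 := 𝕜) t w)) := (isUnit_heckeT ht w).ringInverse

theorem linearIndependent_twistedHL {t : 𝕜} (ht : t ≠ 0) (σ : Equiv.Perm (Fin l)) :
    LinearIndependent 𝕜 (twistedHL t σ) := by
  have h1 : LinearIndependent 𝕜 (nsHL t : Weight l → LaurentPoly 𝕜 l) :=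
    linearIndependent_of_unitriangular (nsHL_sub_mono_mem ht)
  have h2 := (h1.comp (permAct σ⁻¹) (permAddEquiv σ⁻¹).injective).map'
    (Ring.inverse (heckeT (𝕜 := 𝕜) t σ⁻¹)) (LinearMap.ker_eq_bot.2
      ((Module.End.isUnit_iff _).1 (isUnit_ringInverse_heckeT ht σ⁻¹)).injective)
  exact h2.units_smul fun μ => Units.mk0 (t ^ twistExponent σ μ) (pow_ne_zero _ ht)

theorem span_twistedHL {t : 𝕜} (ht : t ≠ 0) (σ : Equiv.Perm (Fin l)) :
    Submodule.span 𝕜 (Set.range (twistedHL t σ)) = ⊤ := by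
  have hsurj := ((Module.End.isUnit_iff _).1 (isUnit_ringInverse_heckeT (𝕜 := 𝕜) ht σ⁻¹)).surjective
  have h1 := span_eq_top_of_unitriangular (F := (nsHL t : Weight l → LaurentPoly 𝕜 l))
    (nsHL_sub_mono_mem ht)
  rw [eq_top_iff, ← LinearMap.range_eq_top.2 hsurj, LinearMap.range_eq_map, ← h1,
    Submodule.map_span, Submodule.span_le]
  rintro _ ⟨_, ⟨μ, rfl⟩, rfl⟩
  have h2 : Ring.inverse (heckeT (𝕜 := 𝕜) t σ⁻¹) (nsHL t μ) =
      (t ^ twistExponent σ (permAct σ μ))⁻¹ • twistedHL t σ (permAct σ μ) := by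
    rw [twistedHL, permAct_inv_permAct, smul_smul, inv_mul_cancel₀ (pow_ne_zero _ ht), one_smul]
  rw [h2]
  exact Submodule.smul_mem _ _ (Submodule.subset_span ⟨_, rfl⟩)

end Basis

/-! ### The Pieri rule for elementary symmetric polynomials -/

section ElementaryPieri

variable {𝕜 : Type*} [Field 𝕜] {l : ℕ}

/-- The weight `ε_I`, with entries `1` in `I` and `0` elsewhere. -/
def eps (I : Finset (Fin l)) : Weight l := fun i => if i ∈ I then 1 else 0

theorem eps_apply (I : Finset (Fin l)) (i : Fin l) : eps I i = if i ∈ I then 1 else 0 := rfl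

theorem eps_injective : Function.Injective (eps : Finset (Fin l) → Weight l) := by
  intro I J h
  ext i
  have := congrFun h i
  simp only [eps_apply] at this
  split_ifs at this <;> simp_all

theorem permAct_eps (w : Equiv.Perm (Fin l)) (I : Finset (Fin l)) :
    permAct w (eps I) = eps (I.map w.toEmbedding) := by
  funext i
  rw [permAct_apply, eps_apply, eps_apply]
  simp only [Finset.mem_map_equiv]
  rfl

theorem mem_map_simpleRefl {a : Fin (l - 1)} {I : Finset (Fin l)} {i : Fin l} :
    i ∈ I.map (simpleRefl a).toEmbedding ↔ simpleRefl a i ∈ I := by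
  rw [Finset.mem_map_equiv]
  exact Iff.of_eq (congrArg (· i ∈ I) (congrArg (fun s : Equiv.Perm (Fin l) => ⇑s)
    (simpleRefl_inv a)))

theorem map_simpleRefl_map (a : Fin (l - 1)) (I : Finset (Fin l)) :
    (I.map (simpleRefl a).toEmbedding).map (simpleRefl a).toEmbedding = I := by
  ext i
  rw [mem_map_simpleRefl, mem_map_simpleRefl, ← Equiv.Perm.mul_apply, simpleRefl_mul_self]
  rfl

theorem map_simpleRefl_of_iff {a : Fin (l - 1)} {I : Finset (Fin l)} (h : lo a ∈ I ↔ hi a ∈ I) :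
    I.map (simpleRefl a).toEmbedding = I := by
  ext i
  rw [mem_map_simpleRefl]
  by_cases h1 : i = lo a
  · subst h1; rw [simpleRefl_lo, h]
  · by_cases h2 : i = hi a
    · subst h2; rw [simpleRefl_hi, h]
    · rw [simpleRefl_of_ne h1 h2]

/-- The elementary symmetric polynomial `e_k(x_1, …, x_l)`. -/
def esymmL (𝕜 : Type*) [Field 𝕜] (l k : ℕ) : LaurentPoly 𝕜 l :=
  ∑ I ∈ Finset.powersetCard k Finset.univ, mono 𝕜 (eps I)

theorem map_mem_powersetCard {k : ℕ} {I : Finset (Fin l)} (w : Equiv.Perm (Fin l))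
    (h : I ∈ Finset.powersetCard k Finset.univ) :
    I.map w.toEmbedding ∈ Finset.powersetCard k Finset.univ := by
  simpa [Finset.mem_powersetCard] using h

theorem sum_powersetCard_simpleRefl {M : Type*} [AddCommMonoid M] (a : Fin (l - 1)) (k : ℕ)
    (F : Finset (Fin l) → M) :
    ∑ I ∈ Finset.powersetCard k Finset.univ, F (I.map (simpleRefl a).toEmbedding) =
      ∑ I ∈ Finset.powersetCard k Finset.univ, F I :=
  Finset.sum_nbij' (fun I => I.map (simpleRefl a).toEmbedding)
    (fun I => I.map (simpleRefl a).toEmbedding) (fun _ h => map_mem_powersetCard _ h)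
    (fun _ h => map_mem_powersetCard _ h) (fun I _ => map_simpleRefl_map a I)
    (fun I _ => map_simpleRefl_map a I) (fun _ _ => rfl)

theorem permOp_esymmL (a : Fin (l - 1)) (k : ℕ) :
    permOp 𝕜 (simpleRefl a) (esymmL 𝕜 l k) = esymmL 𝕜 l k := by
  simp only [esymmL, map_sum, permOp_mono, permAct_eps]
  exact sum_powersetCard_simpleRefl a k fun I => mono 𝕜 (eps I)

/-- The exponent in the Pieri rule for `e_k`: the number of pairs `p < r` with `μ_p = μ_r` such
that only the entry at `p` is raised. -/
def esymmExponent (μ : Weight l) (I : Finset (Fin l)) : ℕ :=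
  ∑ p ∈ orderedPairs l, if μ p.1 = μ p.2 ∧ p.1 ∈ I ∧ p.2 ∉ I then 1 else 0

theorem esymmExponent_simpleRefl (a : Fin (l - 1)) (μ : Weight l) (I : Finset (Fin l)) :
    esymmExponent (permAct (simpleRefl a) μ) (I.map (simpleRefl a).toEmbedding) +
        (if μ (lo a) = μ (hi a) ∧ lo a ∈ I ∧ hi a ∉ I then 1 else 0) =
      esymmExponent μ I + if μ (hi a) = μ (lo a) ∧ hi a ∈ I ∧ lo a ∉ I then 1 else 0 := by
  have := sum_orderedPairs_simpleRefl a fun p r => if μ p = μ r ∧ p ∈ I ∧ r ∉ I then 1 else 0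
  simpa only [esymmExponent, permAct_simpleRefl_apply, mem_map_simpleRefl] using this

theorem esymmExponent_of_mem {a : Fin (l - 1)} {μ : Weight l} {I : Finset (Fin l)}
    (h : μ (lo a) = μ (hi a)) (h1 : lo a ∈ I) (h2 : hi a ∉ I) :
    esymmExponent μ (I.map (simpleRefl a).toEmbedding) + 1 = esymmExponent μ I := by
  have := esymmExponent_simpleRefl a μ I
  simpa [permAct_simpleRefl_of_eq h, h, h1, h2] using this

theorem permAct_simpleRefl_add_eps {a : Fin (l - 1)} {μ : Weight l} (h : μ (lo a) = μ (hi a))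
    (I : Finset (Fin l)) : permAct (simpleRefl a) (μ + eps I) =
      μ + eps (I.map (simpleRefl a).toEmbedding) := by
  rw [permAct_add, permAct_simpleRefl_of_eq h, permAct_eps]

/-- The weights `μ + ε_K` with `K` of a given size and of exponent larger than `m`. -/
def esymmAbove (μ : Weight l) (k m : ℕ) : Set (Weight l) :=
  {ν | ∃ K : Finset (Fin l), K.card = k ∧ m < esymmExponent μ K ∧ ν = μ + eps K}

theorem demazureLusztig_mem_esymmAbove (t : 𝕜) {a : Fin (l - 1)} {μ : Weight l}
    (h : μ (lo a) = μ (hi a)) {k m : ℕ} {ν : Weight l} (hν : ν ∈ esymmAbove μ k (m + 1)) :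
    demazureLusztig t a (mono 𝕜 ν) ∈ monoSpan 𝕜 (esymmAbove μ k m) := by
  obtain ⟨K, hK, hm, rfl⟩ := hν
  have hself : mono 𝕜 (μ + eps K) ∈ monoSpan 𝕜 (esymmAbove μ k m) :=
    mono_mem_monoSpan ⟨K, hK, by omega, rfl⟩
  have hrefl : mono 𝕜 (permAct (simpleRefl a) (μ + eps K)) ∈ monoSpan 𝕜 (esymmAbove μ k m) := by
    refine mono_mem_monoSpan ⟨K.map (simpleRefl a).toEmbedding, by simpa using hK, ?_,
      permAct_simpleRefl_add_eps h K⟩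
    have := esymmExponent_simpleRefl a μ K
    rw [permAct_simpleRefl_of_eq h] at this
    split_ifs at this <;> omega
  by_cases h1 : lo a ∈ K <;> by_cases h2 : hi a ∈ K
  · rw [demazureLusztig_mono_of_eq t (by simp [h, eps_apply, h1, h2])]
    exact Submodule.smul_mem _ _ hself
  · rw [demazureLusztig_mono_of_gt t (by simp [h, eps_apply, h1, h2])]
    refine add_mem (add_mem (Submodule.smul_mem _ _ hrefl) (Submodule.smul_mem _ _ hself)) ?_
    simp [h, eps_apply, h1, h2]
  · rw [demazureLusztig_mono_of_lt t (by simp [h, eps_apply, h1, h2])]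
    refine add_mem hrefl ?_
    simp [h, eps_apply, h1, h2]
  · rw [demazureLusztig_mono_of_eq t (by simp [h, eps_apply, h1, h2])]
    exact Submodule.smul_mem _ _ hself

/-- For `μ` dominant, `E_{μ+ε_I}` is `x^{μ+ε_I}` plus monomials `x^{μ+ε_K}` of larger
exponent. -/
theorem nsHL_add_eps_sub_mono_mem {t : 𝕜} (ht : t ≠ 0) {μ : Weight l} (hμ : Antitone μ)
    (I : Finset (Fin l)) :
    nsHL t (μ + eps I) - mono 𝕜 (μ + eps I) ∈
      monoSpan 𝕜 (esymmAbove μ I.card (esymmExponent μ I)) := by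
  generalize hν : μ + eps I = ν
  induction ν using weight_induction generalizing I with
  | dom ν h => rw [nsHL_of_antitone t h, sub_self]; exact zero_mem _
  | step ν a h ih =>
    subst hν
    have hle := hμ (lo_lt_hi a).le
    have h12 : lo a ∉ I ∧ hi a ∈ I ∧ μ (lo a) = μ (hi a) := by
      simp only [Pi.add_apply, eps_apply] at h
      split_ifs at h with h1 h2 <;> first | omega | exact ⟨‹_›, ‹_›, by omega⟩
    obtain ⟨h1, h2, h3⟩ := h12
    set J := I.map (simpleRefl a).toEmbedding with hJ
    have hJI : J.map (simpleRefl a).toEmbedding = I := map_simpleRefl_map a I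
    have hj1 : lo a ∈ J := by rw [hJ, mem_map_simpleRefl, simpleRefl_lo]; exact h2
    have hj2 : hi a ∉ J := by rw [hJ, mem_map_simpleRefl, simpleRefl_hi]; exact h1
    have hcard : J.card = I.card := by simp [hJ]
    have hexp := esymmExponent_of_mem h3 hj1 hj2
    rw [hJI] at hexp
    have ih' := ih J (permAct_simpleRefl_add_eps h3 I).symm
    rw [permAct_simpleRefl_add_eps h3 I, hcard, ← hexp] at ih'
    have hgt : (μ + eps J) (hi a) < (μ + eps J) (lo a) := by
      simp [h3, eps_apply, hj1, hj2]
    have hrefl : permAct (simpleRefl a) (μ + eps J) = μ + eps I := by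
      rw [permAct_simpleRefl_add_eps h3, hJI]
    have e1 := demazureLusztig_nsHL_of_gt ht hgt
    have e2 := demazureLusztig_mono_of_gt t hgt
    have hz : ((μ + eps J) (lo a) - (μ + eps J) (hi a)).toNat - 1 = 0 := by
      simp [h3, eps_apply, hj1, hj2]
    rw [hz, Finset.range_zero, Finset.sum_empty, smul_zero, add_zero, hrefl] at e2
    rw [hrefl] at e1
    have h4 := map_mem_of_forall_mono (T := demazureLusztig t a)
      (fun κ hκ => demazureLusztig_mem_esymmAbove t h3 hκ) ih'
    rw [map_sub, e1, e2] at h4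
    have h5 : (t - 1) • mono 𝕜 (μ + eps J) ∈
        monoSpan 𝕜 (esymmAbove μ I.card (esymmExponent μ I)) :=
      Submodule.smul_mem _ _ (mono_mem_monoSpan ⟨J, hcard, by omega, rfl⟩)
    have h6 := Submodule.smul_mem _ t⁻¹ (add_mem h4 h5)
    convert h6 using 1
    rw [show t • nsHL t (μ + eps I) - (t • mono 𝕜 (μ + eps I) + (t - 1) • mono 𝕜 (μ + eps J)) +
        (t - 1) • mono 𝕜 (μ + eps J) = t • (nsHL t (μ + eps I) - mono 𝕜 (μ + eps I)) by module,
      smul_smul, inv_mul_cancel₀ ht, one_smul]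

/-- The term of the Pieri rule for `e_k` indexed by `I`. -/
def esymmTerm (t : 𝕜) (μ : Weight l) (I : Finset (Fin l)) : LaurentPoly 𝕜 l :=
  (t ^ esymmExponent μ I)⁻¹ • nsHL t (μ + eps I)

/-- The right-hand side of the Pieri rule is a `t`-eigenvector of `T_a` if `μ_a = μ_{a+1}`: the
terms of `I` and `s_a I` combine to an eigenvector. -/
theorem demazureLusztig_sum_esymmTerm {t : 𝕜} (ht : t ≠ 0) {a : Fin (l - 1)} {μ : Weight l}
    (h : μ (lo a) = μ (hi a)) (k : ℕ) :
    demazureLusztig t a (∑ I ∈ Finset.powersetCard k Finset.univ, esymmTerm t μ I) =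
      t • ∑ I ∈ Finset.powersetCard k Finset.univ, esymmTerm t μ I := by
  rw [← sub_eq_zero, map_sum, Finset.smul_sum, ← Finset.sum_sub_distrib]
  have fixed : ∀ I : Finset (Fin l), (lo a ∈ I ↔ hi a ∈ I) →
      demazureLusztig t a (esymmTerm t μ I) - t • esymmTerm t μ I = 0 := by
    intro I hI
    rw [esymmTerm, map_smul, demazureLusztig_nsHL_of_eq t (by simp [h, eps_apply, hI]),
      smul_comm, sub_self]
  have moved : ∀ I : Finset (Fin l), lo a ∈ I → hi a ∉ I →
      demazureLusztig t a (esymmTerm t μ I) - t • esymmTerm t μ I +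
        (demazureLusztig t a (esymmTerm t μ (I.map (simpleRefl a).toEmbedding)) -
          t • esymmTerm t μ (I.map (simpleRefl a).toEmbedding)) = 0 := by
    intro I h1 h2
    have hexp := esymmExponent_of_mem h h1 h2
    have e1 := demazureLusztig_nsHL_of_gt ht (a := a) (μ := μ + eps I)
      (by simp [h, eps_apply, h1, h2])
    have e2 := demazureLusztig_nsHL_of_lt ht (a := a)
      (μ := permAct (simpleRefl a) (μ + eps I)) (by simp [h, eps_apply, h1, h2])
    rw [permAct_simpleRefl_self] at e2
    rw [esymmTerm, esymmTerm, map_smul, map_smul, ← permAct_simpleRefl_add_eps h, e1, e2, ← hexp,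
      pow_succ, mul_inv]
    simp only [smul_add, smul_smul]
    rw [show (t ^ esymmExponent μ (I.map (simpleRefl a).toEmbedding))⁻¹ * t⁻¹ * t =
      (t ^ esymmExponent μ (I.map (simpleRefl a).toEmbedding))⁻¹ by field_simp,
      show t * ((t ^ esymmExponent μ (I.map (simpleRefl a).toEmbedding))⁻¹ * t⁻¹) =
      (t ^ esymmExponent μ (I.map (simpleRefl a).toEmbedding))⁻¹ by field_simp]
    module
  refine Finset.sum_involution (fun I _ => I.map (simpleRefl a).toEmbedding) ?_ ?_
    (fun I hI => map_mem_powersetCard _ hI) (fun I _ => map_simpleRefl_map a I)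
  · intro I _
    by_cases hI : lo a ∈ I ↔ hi a ∈ I
    · rw [map_simpleRefl_of_iff hI, fixed I hI, add_zero]
    · by_cases h1 : lo a ∈ I
      · exact moved I h1 (by tauto)
      · have := moved (I.map (simpleRefl a).toEmbedding)
          (by rw [mem_map_simpleRefl, simpleRefl_lo]; tauto)
          (by rw [mem_map_simpleRefl, simpleRefl_hi]; tauto)
        rw [map_simpleRefl_map] at this
        rw [add_comm]
        exact this
  · intro I _ hne heq
    refine hne (fixed I ?_)
    have := mem_map_simpleRefl (a := a) (I := I) (i := lo a)
    rwa [heq, simpleRefl_lo] at this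

/-- If only the first of two entries in a constant stretch of a dominant weight is raised, then
the same happens for two adjacent entries. -/
theorem exists_adjacent_of_esymmExponent_ne_zero {μ : Weight l} (hμ : Antitone μ)
    {I : Finset (Fin l)} (h : esymmExponent μ I ≠ 0) :
    ∃ a, μ (lo a) = μ (hi a) ∧ lo a ∈ I ∧ hi a ∉ I := by
  obtain ⟨⟨p, r⟩, hpr, hne⟩ := Finset.exists_ne_zero_of_sum_ne_zero h
  rw [mem_orderedPairs] at hpr
  obtain ⟨h1, h2, h3⟩ : μ p = μ r ∧ p ∈ I ∧ r ∉ I := by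
    by_contra hc
    exact hne (if_neg hc)
  by_contra hc
  push Not at hc
  have key : ∀ n : ℕ, ∀ hn : p.val + n ≤ r.val, (⟨p + n, by omega⟩ : Fin l) ∈ I := by
    intro n
    induction n with
    | zero => exact fun _ => h2
    | succ n ih =>
      intro hn
      have hin := ih (by omega)
      let a : Fin (l - 1) := ⟨p + n, by have := r.isLt; omega⟩
      refine hc a ?_ hin
      have e1 : μ r ≤ μ (hi a) := hμ (show (p : ℕ) + n + 1 ≤ r by omega)
      have e2 : μ (hi a) ≤ μ (lo a) := hμ (lo_lt_hi a).le
      have e3 : μ (lo a) ≤ μ p := hμ (show (p : ℕ) ≤ p + n by omega)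
      omega
  have := key (r - p) (by simp only at hpr; omega)
  simp only at hpr
  rw [show (⟨p + (r - p), by omega⟩ : Fin l) = r from Fin.ext (by simp; omega)] at this
  exact h3 this

/-- For `μ` dominant, the coefficients of the right-hand side of the Pieri rule are those of
`e_k x^μ`.  If the exponent of `K` is zero, only the term of `K` contributes; otherwise an adjacent
transposition fixing `μ` lowers the exponent, and the sum is invariant under it. -/
theorem coeff_sum_esymmTerm {t : 𝕜} (ht : t ≠ 0) {μ : Weight l} (hμ : Antitone μ) (k : ℕ)
    {K : Finset (Fin l)} (hK : K.card = k) :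
    (∑ I ∈ Finset.powersetCard k Finset.univ, esymmTerm t μ I).coeff (μ + eps K) = 1 := by
  induction hn : esymmExponent μ K generalizing K with
  | zero =>
    rw [AddMonoidAlgebra.coeff_sum, Finsupp.finsetSum_apply, Finset.sum_eq_single K]
    · have := coeff_eq_zero_of_mem_monoSpan (nsHL_add_eps_sub_mono_mem ht hμ K) (μ := μ + eps K)
        (by rintro ⟨J, -, hJ, hJK⟩
            rw [← eps_injective (add_left_cancel hJK)] at hJ
            omega)
      rw [AddMonoidAlgebra.coeff_sub, Finsupp.sub_apply, coeff_mono, if_pos rfl,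
        sub_eq_zero] at this
      simp [esymmTerm, hn, this]
    · intro I _ hI
      have := coeff_eq_zero_of_mem_monoSpan (nsHL_add_eps_sub_mono_mem ht hμ I) (μ := μ + eps K)
        (by rintro ⟨J, -, hJ, hJK⟩
            rw [← eps_injective (add_left_cancel hJK)] at hJ
            omega)
      rw [AddMonoidAlgebra.coeff_sub, Finsupp.sub_apply, coeff_mono,
        if_neg (fun e => hI (eps_injective (add_left_cancel e))), sub_zero] at this
      simp [esymmTerm, this]
    · intro h
      exact absurd (Finset.mem_powersetCard.2 ⟨Finset.subset_univ _, hK⟩) h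
  | succ n ih =>
    obtain ⟨a, h1, h2, h3⟩ := exists_adjacent_of_esymmExponent_ne_zero hμ (I := K) (by omega)
    have hexp := esymmExponent_of_mem h1 h2 h3
    have hsym := permOp_eq_of_demazureLusztig_eq t a (demazureLusztig_sum_esymmTerm ht h1 k)
    rw [← hsym, coeff_permOp, simpleRefl_inv, permAct_simpleRefl_add_eps h1]
    exact ih (by simpa using hK) (by omega)

theorem esymmL_mul_mono_of_antitone {t : 𝕜} (ht : t ≠ 0) {μ : Weight l} (hμ : Antitone μ)
    (k : ℕ) :
    esymmL 𝕜 l k * mono 𝕜 μ = ∑ I ∈ Finset.powersetCard k Finset.univ, esymmTerm t μ I := by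
  have e : esymmL 𝕜 l k * mono 𝕜 μ =
      ∑ K ∈ Finset.powersetCard k Finset.univ, mono 𝕜 (μ + eps K) := by
    rw [esymmL, Finset.sum_mul]
    exact Finset.sum_congr rfl fun I _ => by rw [mono_mul_mono, add_comm]
  rw [e]
  ext ν
  by_cases hν : ∃ K : Finset (Fin l), K.card = k ∧ ν = μ + eps K
  · obtain ⟨K, hK, rfl⟩ := hν
    rw [coeff_sum_esymmTerm ht hμ k hK, AddMonoidAlgebra.coeff_sum, Finsupp.finsetSum_apply,
      Finset.sum_eq_single K]
    · rw [coeff_mono, if_pos rfl]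
    · intro I _ hI
      rw [coeff_mono, if_neg fun e => hI (eps_injective (add_left_cancel e))]
    · intro h
      exact absurd (Finset.mem_powersetCard.2 ⟨Finset.subset_univ _, hK⟩) h
  · rw [AddMonoidAlgebra.coeff_sum, Finsupp.finsetSum_apply, AddMonoidAlgebra.coeff_sum,
      Finsupp.finsetSum_apply]
    refine Finset.sum_congr rfl fun I hI => ?_
    have hI' := (Finset.mem_powersetCard.1 hI).2
    have hne : μ + eps I ≠ ν := fun e => hν ⟨I, hI', e.symm⟩
    have := coeff_eq_zero_of_mem_monoSpan (nsHL_add_eps_sub_mono_mem ht hμ I) (μ := ν)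
      (by rintro ⟨J, hJ, -, hJK⟩
          exact hν ⟨J, hJ.trans hI', hJK⟩)
    rw [AddMonoidAlgebra.coeff_sub, Finsupp.sub_apply, coeff_mono, if_neg hne, sub_zero] at this
    rw [coeff_mono, if_neg hne]
    simp [esymmTerm, this]

/-- The Pieri rule `e_k E_μ = ∑_I t^{-n(μ, I)} E_{μ + ε_I}`.  It is carried from `ν = s_a μ` to `μ`
by applying `T_a`. -/
theorem esymmL_mul_nsHL {t : 𝕜} (ht : t ≠ 0) (μ : Weight l) (k : ℕ) :
    esymmL 𝕜 l k * nsHL t μ = ∑ I ∈ Finset.powersetCard k Finset.univ, esymmTerm t μ I := by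
  induction μ using weight_induction with
  | dom μ h => rw [nsHL_of_antitone t h, esymmL_mul_mono_of_antitone ht h]
  | step μ a h ih =>
    set ν := permAct (simpleRefl a) μ with hν
    have hs : permAct (simpleRefl a) ν = μ := by rw [hν, permAct_simpleRefl_self]
    have hgt : ν (hi a) < ν (lo a) := by simpa [hν] using h
    have h1 := congrArg (demazureLusztig t a) ih
    rw [demazureLusztig_mul_of_invariant t a (permOp_esymmL a k),
      demazureLusztig_nsHL_of_gt ht hgt, hs, mul_smul_comm, map_sum] at h1
    have h2 : ∀ I : Finset (Fin l), demazureLusztig t a (esymmTerm t ν I) =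
        t • esymmTerm t μ (I.map (simpleRefl a).toEmbedding) := by
      intro I
      have hexp := esymmExponent_simpleRefl a ν I
      rw [hs, if_neg (fun e => hgt.ne' e.1), if_neg (fun e => hgt.ne e.1)] at hexp
      have hadd : permAct (simpleRefl a) (ν + eps I) =
          μ + eps (I.map (simpleRefl a).toEmbedding) := by rw [permAct_add, hs, permAct_eps]
      rw [add_zero, add_zero] at hexp
      rw [esymmTerm, esymmTerm, map_smul, hexp, ← hadd]
      rcases (show (ν + eps I) (hi a) ≤ (ν + eps I) (lo a) by
        simp only [Pi.add_apply, eps_apply]; split_ifs <;> omega).lt_or_eq with hlt | heq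
      · rw [demazureLusztig_nsHL_of_gt ht hlt, smul_comm]
      · rw [demazureLusztig_nsHL_of_eq t heq.symm, permAct_simpleRefl_of_eq heq.symm, smul_comm]
    rw [Finset.sum_congr rfl fun I _ => h2 I, ← Finset.smul_sum,
      sum_powersetCard_simpleRefl a k fun I => esymmTerm t μ I] at h1
    have h3 := congrArg (fun f => t⁻¹ • f) h1
    simpa only [smul_smul, inv_mul_cancel₀ ht, one_smul] using h3

end ElementaryPieri

/-! ### Complete homogeneous symmetric polynomials -/

section Complete

variable {𝕜 : Type*} [Field 𝕜] {l : ℕ}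

/-- A vector of natural numbers as a weight. -/
def natWeight (c : Fin l → ℕ) : Weight l := fun i => c i

@[simp] theorem natWeight_apply (c : Fin l → ℕ) (i : Fin l) : natWeight c i = c i := rfl

theorem natWeight_injective : Function.Injective (natWeight : (Fin l → ℕ) → Weight l) := by
  intro c d h
  funext i
  have := congrFun h i
  simpa using this

/-- The complete homogeneous symmetric polynomial `h_k(x_1, …, x_l)`. -/
def hsymmL (𝕜 : Type*) [Field 𝕜] (l k : ℕ) : LaurentPoly 𝕜 l :=
  ∑ c ∈ Finset.piAntidiag Finset.univ k, mono 𝕜 (natWeight c)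

theorem mem_piAntidiag_univ {c : Fin l → ℕ} {k : ℕ} :
    c ∈ Finset.piAntidiag Finset.univ k ↔ ∑ i, c i = k := by simp

theorem permOp_hsymmL (w : Equiv.Perm (Fin l)) (k : ℕ) :
    permOp 𝕜 w (hsymmL 𝕜 l k) = hsymmL 𝕜 l k := by
  simp only [hsymmL, map_sum, permOp_mono]
  refine Finset.sum_nbij' (fun c i => c (w⁻¹ i)) (fun c i => c (w i)) ?_ ?_ ?_ ?_ ?_
  · intro c hc
    rw [mem_piAntidiag_univ] at hc ⊢
    rw [← hc]
    exact Equiv.sum_comp w⁻¹ c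
  · intro c hc
    rw [mem_piAntidiag_univ] at hc ⊢
    rw [← hc]
    exact Equiv.sum_comp w c
  · intro c _; simp
  · intro c _; simp
  · intro c _; rfl

theorem prod_var_pow (c : Fin l → ℕ) : ∏ i, var 𝕜 i ^ c i = mono 𝕜 (natWeight c) := by
  simp only [var_pow]
  rw [mono_sum]
  congr 1
  funext j
  simp [Finset.sum_apply, Pi.single_apply]

theorem prod_var_eq_mono_eps (I : Finset (Fin l)) : ∏ i ∈ I, var 𝕜 i = mono 𝕜 (eps I) := by
  simp only [var]
  rw [mono_sum]
  congr 1
  funext j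
  simp [Finset.sum_apply, Pi.single_apply, eps_apply]

/-- The geometric series `1 / (1 - a X)`. -/
def geomSeries {R : Type*} [CommRing R] (a : R) : PowerSeries R := PowerSeries.mk fun n => a ^ n

theorem one_sub_mul_geomSeries {R : Type*} [CommRing R] (a : R) :
    (1 - PowerSeries.C a * PowerSeries.X) * geomSeries a = 1 := by
  ext n
  rw [sub_mul, one_mul, mul_assoc, map_sub, PowerSeries.coeff_C_mul]
  cases n with
  | zero => simp [geomSeries]
  | succ n => simp [geomSeries, PowerSeries.coeff_succ_X_mul, pow_succ', PowerSeries.coeff_one]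

theorem coeff_prod_geomSeries (k : ℕ) :
    PowerSeries.coeff k (∏ i : Fin l, geomSeries (var 𝕜 i)) = hsymmL 𝕜 l k := by
  rw [PowerSeries.coeff_prod, hsymmL]
  refine Finset.sum_nbij' (fun c => ⇑c) (fun c => Finsupp.equivFunOnFinite.symm c) ?_ ?_ ?_ ?_ ?_
  · intro c hc
    rw [Finset.mem_finsuppAntidiag] at hc
    rw [mem_piAntidiag_univ]
    exact hc.1
  · intro c hc
    rw [mem_piAntidiag_univ] at hc
    rw [Finset.mem_finsuppAntidiag]
    exact ⟨hc, Finset.subset_univ _⟩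
  · intro c _; ext i; rfl
  · intro c _; rfl
  · intro c _
    simp only [geomSeries, PowerSeries.coeff_mk]
    exact prod_var_pow _

theorem coeff_prod_one_sub {R : Type*} [CommRing R] {ι : Type*} (s : Finset ι) (v : ι → R)
    (k : ℕ) :
    PowerSeries.coeff k (∏ i ∈ s, (1 - PowerSeries.C (v i) * PowerSeries.X)) =
      (-1) ^ k * ∑ I ∈ Finset.powersetCard k s, ∏ i ∈ I, v i := by
  simp only [sub_eq_add_neg]
  rw [Finset.prod_one_add, map_sum, Finset.mul_sum, Finset.powersetCard_eq_filter,
    Finset.sum_filter]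
  refine Finset.sum_congr rfl fun I _ => ?_
  have e : ∏ i ∈ I, -(PowerSeries.C (v i) * PowerSeries.X) =
      PowerSeries.C ((-1) ^ I.card * ∏ i ∈ I, v i) * PowerSeries.X ^ I.card := by
    rw [Finset.prod_neg, Finset.prod_mul_distrib, Finset.prod_const, map_mul, map_pow, map_neg,
      map_one, map_prod]
    ring
  rw [e, PowerSeries.coeff_C_mul, PowerSeries.coeff_X_pow]
  by_cases h : I.card = k
  · subst h; simp
  · simp [h, Ne.symm h]

theorem sum_antidiagonal_esymmL_hsymmL (k : ℕ) :
    ∑ p ∈ Finset.HasAntidiagonal.antidiagonal k, (-1) ^ p.1 * esymmL 𝕜 l p.1 * hsymmL 𝕜 l p.2 =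
      if k = 0 then 1 else 0 := by
  have h : (∏ i : Fin l, (1 - PowerSeries.C (var 𝕜 i) * PowerSeries.X)) *
      ∏ i : Fin l, geomSeries (var 𝕜 i) = 1 := by
    rw [← Finset.prod_mul_distrib]
    exact Finset.prod_eq_one fun i _ => one_sub_mul_geomSeries _
  have h2 := congrArg (PowerSeries.coeff k) h
  rw [PowerSeries.coeff_mul, PowerSeries.coeff_one] at h2
  rw [← h2]
  refine Finset.sum_congr rfl fun p _ => ?_
  rw [coeff_prod_one_sub, coeff_prod_geomSeries, esymmL]
  simp only [prod_var_eq_mono_eps]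

theorem esymmL_zero : esymmL 𝕜 l 0 = 1 := by
  rw [esymmL, Finset.powersetCard_zero, Finset.sum_singleton, ← mono_zero]
  congr 1

end Complete

/-! ### The Pieri rule for complete homogeneous symmetric polynomials -/

section CompletePieri

variable {𝕜 : Type*} [Field 𝕜] {l : ℕ}

/-- The number of boxes `i` of the row `(b)/(a)` such that `i - δ` and `i - δ + 1` are consecutive
positions in or adjacent to the row `(b')/(a')`. -/
def rowExponent (δ a b a' b' : ℤ) : ℕ :=
  ((Finset.Ioc a b).filter fun i => a' ≤ i - δ ∧ i - δ ≤ b').card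

theorem rowExponent_eq (δ a b a' b' : ℤ) :
    rowExponent δ a b a' b' = (min b (b' + δ) - max a (a' + δ - 1)).toNat := by
  have : (Finset.Ioc a b).filter (fun i => a' ≤ i - δ ∧ i - δ ≤ b') =
      Finset.Ioc (max a (a' + δ - 1)) (min b (b' + δ)) := by
    ext i
    simp only [Finset.mem_filter, Finset.mem_Ioc, max_lt_iff, le_min_iff]
    omega
  rw [rowExponent, this, Int.card_Ioc]

/-- The sum of `rowExponent` over all pairs of rows; this is `h_σ(β/α)`. -/
def pairExponent (σ : Equiv.Perm (Fin l)) (α β : Weight l) : ℕ :=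
  ∑ p ∈ orderedPairs l,
    rowExponent (if σ p.1 < σ p.2 then 1 else 0) (α p.1) (β p.1) (α p.2) (β p.2)

/-- The contribution of a pair of rows to the exponent of `t` in the product of a term of `h_j` and
a term of `e_i`. -/
def cancelExponent (α β : Weight l) (I : Finset (Fin l)) (p r : Fin l) : ℕ :=
  rowExponent 1 (α p) ((β - eps I) p) (α r) ((β - eps I) r) +
    if (β - eps I) p = (β - eps I) r ∧ p ∈ I ∧ r ∉ I then 1 else 0

theorem rowExponent_self_left (δ a a' b' : ℤ) : rowExponent δ a a a' b' = 0 := by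
  simp [rowExponent]

/-- The exponent does not change when the last box in the reading order is moved from the factor
`h` to the factor `e`.  Here `j` is the row of that box. -/
theorem cancelExponent_insert {α β : Weight l} (hαβ : ∀ i, α i ≤ β i) {j : Fin l}
    (hj : α j < β j) (hmax : ∀ i, α i < β i → β i < β j ∨ (β i = β j ∧ i ≤ j))
    {I : Finset (Fin l)} (hI : ∀ i ∈ I, α i < β i) (hjI : j ∉ I) {p r : Fin l} (hpr : p < r) :
    cancelExponent α β (insert j I) p r = cancelExponent α β I p r := by
  have hap := hαβ p
  have har := hαβ r
  have hmp := hmax p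
  have hmr := hmax r
  have hIp := hI p
  have hIr := hI r
  by_cases hpj : p = j
  · subst hpj
    have hne : r ≠ p := hpr.ne'
    have hnle : ¬ r ≤ p := not_le.2 hpr
    by_cases hr : r ∈ I <;>
      simp only [cancelExponent, rowExponent_eq, Pi.sub_apply, eps_apply, Finset.mem_insert, hne,
        hjI, hr, true_or, or_true, false_or, if_true, if_false, not_true, not_false_iff, and_true,
        and_false] <;>
      simp only [hr, hnle, and_false, or_false, forall_true_left] at hIr hmr <;>
      (try split_ifs) <;> omega
  · by_cases hrj : r = j
    · subst hrj
      by_cases hp : p ∈ I <;>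
        simp only [cancelExponent, rowExponent_eq, Pi.sub_apply, eps_apply, Finset.mem_insert, hpj,
          hjI, hp, true_or, or_true, false_or, if_true, if_false, not_true, not_false_iff, and_true,
          and_false] <;>
        simp only [hp, forall_true_left] at hIp hmp <;>
        (try split_ifs) <;> omega
    · by_cases hp : p ∈ I <;> by_cases hr : r ∈ I <;>
        simp [cancelExponent, eps_apply, hpj, hrj, hp, hr]

/-- The cancellation of the coefficient of `E_β` in `∑ (-1)^i e_i (h_{k-i} E_α)`, by the
sign-reversing involution which adds `j` to `I` or removes it, for `j` the row of the last box of
`β/α` in the reading order. -/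
theorem sum_powerset_cancel (t : 𝕜) {α β : Weight l} (hαβ : ∀ i, α i ≤ β i) (hne : α ≠ β) :
    ∑ I ∈ (Finset.univ.filter fun i => α i < β i).powerset,
      (-1 : 𝕜) ^ I.card * (t ^ pairExponent 1 α (β - eps I))⁻¹ *
        (t ^ esymmExponent (β - eps I) I)⁻¹ = 0 := by
  set N := Finset.univ.filter fun i => α i < β i with hN
  have hNn : N.Nonempty := by
    by_contra hc
    rw [Finset.not_nonempty_iff_eq_empty, Finset.filter_eq_empty_iff] at hc
    exact hne (funext fun i => le_antisymm (hαβ i) (not_lt.1 (hc (Finset.mem_univ i))))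
  obtain ⟨j, hjN, hmax⟩ := Finset.exists_max_image N (fun j => toLex (β j, j)) hNn
  have hj : α j < β j := by simpa [hN] using hjN
  have hmax' : ∀ i, α i < β i → β i < β j ∨ (β i = β j ∧ i ≤ j) := fun i hi => by
    simpa [Prod.Lex.le_iff] using hmax i (by simpa [hN] using hi)
  rw [← Finset.insert_erase hjN, Finset.sum_powerset_insert (Finset.notMem_erase _ _),
    ← Finset.sum_add_distrib]
  refine Finset.sum_eq_zero fun I hI => ?_
  have hIN : I ⊆ N.erase j := Finset.mem_powerset.1 hI
  have hjI : j ∉ I := fun h => Finset.notMem_erase _ _ (hIN h)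
  have hI' : ∀ i ∈ I, α i < β i := fun i hi => by
    simpa [hN] using Finset.mem_of_mem_erase (hIN hi)
  have hexp : ∀ J : Finset (Fin l), pairExponent 1 α (β - eps J) + esymmExponent (β - eps J) J =
      ∑ p ∈ orderedPairs l, cancelExponent α β J p.1 p.2 := by
    intro J
    rw [pairExponent, esymmExponent, ← Finset.sum_add_distrib]
    refine Finset.sum_congr rfl fun p hp => ?_
    rw [mem_orderedPairs] at hp
    simp only [Equiv.Perm.one_apply, hp, if_true, cancelExponent]
  have key : pairExponent 1 α (β - eps (insert j I)) +
      esymmExponent (β - eps (insert j I)) (insert j I) =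
      pairExponent 1 α (β - eps I) + esymmExponent (β - eps I) I := by
    rw [hexp, hexp]
    exact Finset.sum_congr rfl fun p hp =>
      cancelExponent_insert hαβ hj hmax' hI' hjI (mem_orderedPairs.1 hp)
  simp only [mul_assoc, ← mul_inv, ← pow_add]
  rw [key, Finset.card_insert_of_notMem hjI, pow_succ]
  ring

/-- The right-hand side of the Pieri rule for `h_k E_α`. -/
def hsymmAction (t : 𝕜) (α : Weight l) (k : ℕ) : LaurentPoly 𝕜 l :=
  ∑ c ∈ Finset.piAntidiag Finset.univ k,
    (t ^ pairExponent 1 α (α + natWeight c))⁻¹ • nsHL t (α + natWeight c)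

/-- The right-hand sides of the Pieri rule satisfy the same recursion as the products `h_k E_α`. -/
theorem sum_antidiagonal_esymmL_hsymmAction {t : 𝕜} (ht : t ≠ 0) (α : Weight l) {k : ℕ}
    (hk : k ≠ 0) :
    ∑ p ∈ Finset.HasAntidiagonal.antidiagonal k,
      (-1) ^ p.1 * esymmL 𝕜 l p.1 * hsymmAction t α p.2 = 0 := by
  let G : (Fin l → ℕ) → Finset (Fin l) → LaurentPoly 𝕜 l := fun c I =>
    ((-1 : 𝕜) ^ I.card * (t ^ pairExponent 1 α (α + natWeight c))⁻¹ *
      (t ^ esymmExponent (α + natWeight c) I)⁻¹) • nsHL t (α + natWeight c + eps I)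
  have e1 : ∀ p ∈ Finset.HasAntidiagonal.antidiagonal k,
      (-1) ^ p.1 * esymmL 𝕜 l p.1 * hsymmAction t α p.2 =
      ∑ x ∈ Finset.piAntidiag Finset.univ p.2 ×ˢ Finset.powersetCard p.1 Finset.univ,
        G x.1 x.2 := by
    intro p _
    rw [hsymmAction, Finset.mul_sum, Finset.sum_product]
    refine Finset.sum_congr rfl fun c _ => ?_
    rw [mul_smul_comm, mul_assoc, esymmL_mul_nsHL ht, Finset.mul_sum, Finset.smul_sum]
    refine Finset.sum_congr rfl fun I hI => ?_
    have hc := (Finset.mem_powersetCard.1 hI).2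
    have hs : ∀ f : LaurentPoly 𝕜 l, (-1) ^ p.1 * f = ((-1 : 𝕜) ^ I.card) • f := by
      intro f
      rw [Algebra.smul_def, map_pow, map_neg, map_one, hc]
    rw [hs, esymmTerm, smul_smul, smul_smul]
    congr 1
    ring
  rw [Finset.sum_congr rfl e1, Finset.sum_sigma']
  -- Collect the terms by the final weight `α + b`, where `b` is the sum of the boxes added by
  -- `h_{k-i}` and the boxes added by `e_i`.
  have e2 : ∑ x ∈ (Finset.HasAntidiagonal.antidiagonal k).sigma (fun p =>
        Finset.piAntidiag (Finset.univ : Finset (Fin l)) p.2 ×ˢ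
          Finset.powersetCard p.1 (Finset.univ : Finset (Fin l))), G x.2.1 x.2.2 =
      ∑ y ∈ (Finset.piAntidiag (Finset.univ : Finset (Fin l)) k).sigma (fun b =>
        (Finset.univ.filter fun i => α i < (α + natWeight b) i).powerset),
        G (fun i => y.1 i - if i ∈ y.2 then 1 else 0) y.2 := by
    refine Finset.sum_bij' (fun x _ => ⟨fun i => x.2.1 i + if i ∈ x.2.2 then 1 else 0, x.2.2⟩)
      (fun y _ => ⟨(y.2.card, k - y.2.card), (fun i => y.1 i - if i ∈ y.2 then 1 else 0, y.2)⟩)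
      ?_ ?_ ?_ ?_ ?_
    · rintro ⟨⟨i, j⟩, c, I⟩ hx
      simp only [Finset.mem_sigma, Finset.HasAntidiagonal.mem_antidiagonal, Finset.mem_product,
        mem_piAntidiag_univ, Finset.mem_powersetCard, Finset.subset_univ, true_and] at hx
      simp only [Finset.mem_sigma, mem_piAntidiag_univ, Finset.mem_powerset]
      refine ⟨?_, fun i hi => ?_⟩
      · rw [Finset.sum_add_distrib]
        simp
        omega
      · simp [hi]
    · rintro ⟨b, I⟩ hy
      simp only [Finset.mem_sigma, mem_piAntidiag_univ, Finset.mem_powerset] at hy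
      have hb : ∀ i ∈ I, 1 ≤ b i := fun i hi => by
        have := hy.2 hi
        simp at this
        omega
      have hsum : (∑ i, (b i - if i ∈ I then 1 else 0)) + I.card = k := by
        rw [← hy.1]
        have : I.card = ∑ i, if i ∈ I then 1 else 0 := by simp
        rw [this, ← Finset.sum_add_distrib]
        refine Finset.sum_congr rfl fun i _ => ?_
        by_cases hi : i ∈ I
        · have := hb i hi
          simp only [hi, if_true]; omega
        · simp [hi]
      simp only [Finset.mem_sigma, Finset.HasAntidiagonal.mem_antidiagonal, Finset.mem_product,
        mem_piAntidiag_univ, Finset.mem_powersetCard, Finset.subset_univ, and_true]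
      omega
    · rintro ⟨⟨i, j⟩, c, I⟩ hx
      simp only [Finset.mem_sigma, Finset.HasAntidiagonal.mem_antidiagonal, Finset.mem_product,
        mem_piAntidiag_univ, Finset.mem_powersetCard, Finset.subset_univ] at hx
      obtain ⟨h1, h2, -, h3⟩ := hx
      have h4 : k - i = j := by omega
      simp [h3, h4]
    · rintro ⟨b, I⟩ hy
      simp only [Finset.mem_sigma, mem_piAntidiag_univ, Finset.mem_powerset] at hy
      have hb : ∀ i, b i - (if i ∈ I then 1 else 0) + (if i ∈ I then 1 else 0) = b i := by
        intro i
        by_cases hi : i ∈ I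
        · have := hy.2 hi
          simp at this
          simp only [hi, if_true]; omega
        · simp [hi]
      simp [hb]
    · rintro ⟨⟨i, j⟩, c, I⟩ _
      simp
  rw [e2, Finset.sum_sigma]
  refine Finset.sum_eq_zero fun b hb => ?_
  rw [mem_piAntidiag_univ] at hb
  have e3 : ∀ I ∈ (Finset.univ.filter fun i => α i < (α + natWeight b) i).powerset,
      G (fun i => b i - if i ∈ I then 1 else 0) I =
      ((-1 : 𝕜) ^ I.card * (t ^ pairExponent 1 α (α + natWeight b - eps I))⁻¹ *
        (t ^ esymmExponent (α + natWeight b - eps I) I)⁻¹) • nsHL t (α + natWeight b) := by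
    intro I hI
    have hw : α + natWeight (fun i => b i - if i ∈ I then 1 else 0) =
        α + natWeight b - eps I := by
      funext i
      simp only [Pi.add_apply, Pi.sub_apply, natWeight_apply, eps_apply]
      by_cases hi : i ∈ I
      · have := Finset.mem_powerset.1 hI hi
        simp at this
        simp only [hi, if_true]; omega
      · simp [hi]
    simp only [G, hw, sub_add_cancel]
  rw [Finset.sum_congr rfl e3, ← Finset.sum_smul, sum_powerset_cancel t, zero_smul]
  · intro i; simp
  · intro h
    have hb0 : ∀ i, b i = 0 := fun i => by
      have := congrFun h i
      simpa using this
    exact hk (by rw [← hb]; simp [hb0])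

/-- The Pieri rule `h_k E_α = ∑_β t^{-h(β/α)} E_β`. -/
theorem hsymmL_mul_nsHL {t : 𝕜} (ht : t ≠ 0) (α : Weight l) (k : ℕ) :
    hsymmL 𝕜 l k * nsHL t α = hsymmAction t α k := by
  induction k using Nat.strong_induction_on with
  | _ k ih =>
    rcases Nat.eq_zero_or_pos k with rfl | hk
    · have h0 : natWeight (0 : Fin l → ℕ) = 0 := by funext i; simp
      have h1 : pairExponent 1 α α = 0 :=
        Finset.sum_eq_zero fun p _ => rowExponent_self_left _ _ _ _
      rw [hsymmAction, hsymmL, Finset.piAntidiag_zero, Finset.sum_singleton,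
        Finset.sum_singleton, h0, mono_zero, one_mul, add_zero, h1]
      simp
    · have h1 := congrArg (· * nsHL t α) (sum_antidiagonal_esymmL_hsymmL (𝕜 := 𝕜) (l := l) k)
      have h2 := sum_antidiagonal_esymmL_hsymmAction ht α hk.ne'
      simp only [hk.ne', if_false, zero_mul, Finset.sum_mul] at h1
      rw [← h2, ← sub_eq_zero, ← Finset.sum_sub_distrib,
        Finset.sum_eq_single (0, k)] at h1
      · simpa [esymmL_zero, sub_eq_zero] using h1
      · rintro ⟨i, j⟩ hp hne
        rw [Finset.HasAntidiagonal.mem_antidiagonal] at hp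
        have hj : j < k := by
          rcases Nat.eq_zero_or_pos i with rfl | hi
          · exact absurd (by simp at hp; simp [hp]) hne
          · simp only at hp; omega
        rw [mul_assoc, ih j hj, sub_self]
      · intro h
        exact absurd (by simp) h

theorem sum_orderedPairs_perm {M : Type*} [AddCommMonoid M] (σ : Equiv.Perm (Fin l))
    (F : Fin l → Fin l → M) :
    ∑ p ∈ orderedPairs l, F (σ⁻¹ p.1) (σ⁻¹ p.2) =
      ∑ p ∈ orderedPairs l, if σ p.1 < σ p.2 then F p.1 p.2 else F p.2 p.1 := by
  refine Finset.sum_nbij'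
    (fun p => if σ⁻¹ p.1 < σ⁻¹ p.2 then (σ⁻¹ p.1, σ⁻¹ p.2) else (σ⁻¹ p.2, σ⁻¹ p.1))
    (fun p => if σ p.1 < σ p.2 then (σ p.1, σ p.2) else (σ p.2, σ p.1)) ?_ ?_ ?_ ?_ ?_
  · rintro ⟨p, r⟩ h
    rw [mem_orderedPairs] at h ⊢
    have : σ⁻¹ p ≠ σ⁻¹ r := σ⁻¹.injective.ne h.ne
    split_ifs with h1
    · exact h1
    · exact lt_of_le_of_ne (not_lt.1 h1) this.symm
  · rintro ⟨p, r⟩ h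
    rw [mem_orderedPairs] at h ⊢
    have : σ p ≠ σ r := σ.injective.ne h.ne
    split_ifs with h1
    · exact h1
    · exact lt_of_le_of_ne (not_lt.1 h1) this.symm
  · rintro ⟨p, r⟩ h
    rw [mem_orderedPairs] at h
    have h' := h.asymm
    by_cases h1 : Equiv.symm σ p < Equiv.symm σ r <;> simp [h1, h, h']
  · rintro ⟨p, r⟩ h
    rw [mem_orderedPairs] at h
    have h' := h.asymm
    by_cases h1 : σ p < σ r <;> simp [h1, h, h']
  · rintro ⟨p, r⟩ h
    rw [mem_orderedPairs] at h
    have h' := h.asymm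
    by_cases h1 : Equiv.symm σ p < Equiv.symm σ r <;> simp [h1, h, h']

theorem twistExponent_eq (σ : Equiv.Perm (Fin l)) (μ : Weight l) :
    twistExponent σ⁻¹ μ =
      ∑ p ∈ orderedPairs l, if σ p.2 < σ p.1 ∧ μ p.2 ≤ μ p.1 then 1 else 0 := by
  rw [twistExponent, orderedPairs, inv_inv, ← Finset.sum_filter, Finset.filter_filter,
    Finset.card_eq_sum_ones]

/-- The twist changes the exponent in the Pieri rule from `h_1` to `h_σ`. -/
theorem pairExponent_add_twistExponent (σ : Equiv.Perm (Fin l)) {α β : Weight l}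
    (h : ∀ i, α i ≤ β i) :
    pairExponent σ α β + twistExponent σ⁻¹ α =
      pairExponent 1 (permAct σ α) (permAct σ β) + twistExponent σ⁻¹ β := by
  have e : pairExponent 1 (permAct σ α) (permAct σ β) = ∑ p ∈ orderedPairs l,
      if σ p.1 < σ p.2 then rowExponent 1 (α p.1) (β p.1) (α p.2) (β p.2)
      else rowExponent 1 (α p.2) (β p.2) (α p.1) (β p.1) := by
    rw [← sum_orderedPairs_perm σ fun p r => rowExponent 1 (α p) (β p) (α r) (β r)]
    refine Finset.sum_congr rfl fun p hp => ?_
    rw [mem_orderedPairs] at hp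
    simp only [Equiv.Perm.one_apply, hp, if_true, permAct_apply]
  rw [e, twistExponent_eq, twistExponent_eq, pairExponent, ← Finset.sum_add_distrib,
    ← Finset.sum_add_distrib]
  refine Finset.sum_congr rfl fun p hp => ?_
  rw [mem_orderedPairs] at hp
  have hne : σ p.1 ≠ σ p.2 := σ.injective.ne hp.ne
  by_cases h1 : σ p.1 < σ p.2
  · simp [h1, h1.asymm]
  · have h2 : σ p.2 < σ p.1 := lt_of_le_of_ne (not_lt.1 h1) hne.symm
    have ha := h p.1
    have hb := h p.2
    simp only [h1, h2, if_false, true_and, rowExponent_eq]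
    split_ifs <;> omega

theorem heckeT_mul_of_invariant (t : 𝕜) (w : Equiv.Perm (Fin l)) {g : LaurentPoly 𝕜 l}
    (hg : ∀ a, permOp 𝕜 (simpleRefl a) g = g) :
    Commute (LinearMap.mulLeft 𝕜 g) (heckeT t w) := by
  unfold heckeT
  generalize reducedWord w = u
  induction u with
  | nil => simp
  | cons a u ih =>
    rw [List.map_cons, List.prod_cons]
    refine Commute.mul_right ?_ ih
    exact LinearMap.ext fun f => (demazureLusztig_mul_of_invariant t a (hg a) f).symm

theorem ringInverse_heckeT_mul {t : 𝕜} (ht : t ≠ 0) (w : Equiv.Perm (Fin l))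
    {g : LaurentPoly 𝕜 l} (hg : ∀ a, permOp 𝕜 (simpleRefl a) g = g) (f : LaurentPoly 𝕜 l) :
    g * Ring.inverse (heckeT t w) f = Ring.inverse (heckeT t w) (g * f) := by
  obtain ⟨u, hu⟩ := isUnit_heckeT (𝕜 := 𝕜) ht w
  have h := heckeT_mul_of_invariant t w hg
  rw [← hu] at h ⊢
  rw [Ring.inverse_unit]
  exact congrArg (fun T => T f) h.units_inv_right.eq

/-- The Pieri rule for the twisted polynomials. -/
theorem hsymmL_mul_twistedHL {t : 𝕜} (ht : t ≠ 0) (σ : Equiv.Perm (Fin l)) (α : Weight l)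
    (k : ℕ) :
    hsymmL 𝕜 l k * twistedHL t σ⁻¹ α = ∑ c ∈ Finset.piAntidiag Finset.univ k,
      (t ^ pairExponent σ α (α + natWeight c))⁻¹ • twistedHL t σ⁻¹ (α + natWeight c) := by
  have hg : ∀ a, permOp 𝕜 (simpleRefl a) (hsymmL 𝕜 l k) = hsymmL 𝕜 l k :=
    fun a => permOp_hsymmL _ k
  rw [twistedHL, mul_smul_comm, ringInverse_heckeT_mul ht _ hg, inv_inv, hsymmL_mul_nsHL ht,
    hsymmAction, map_sum, Finset.smul_sum]
  refine Finset.sum_nbij' (fun c i => c (σ i)) (fun c i => c (σ⁻¹ i)) ?_ ?_ ?_ ?_ ?_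
  · intro c hc
    rw [mem_piAntidiag_univ] at hc ⊢
    rw [← hc]
    exact Equiv.sum_comp σ c
  · intro c hc
    rw [mem_piAntidiag_univ] at hc ⊢
    rw [← hc]
    exact Equiv.sum_comp σ⁻¹ c
  · intro c _; simp
  · intro c _; simp
  · intro c _
    have e : permAct σ (α + natWeight fun i => c (σ i)) = permAct σ α + natWeight c := by
      funext i; simp [permAct]
    have hexp := pairExponent_add_twistExponent σ (α := α) (β := α + natWeight fun i => c (σ i))
      (fun i => by simp)
    rw [e] at hexp
    rw [twistedHL, inv_inv, e, map_smul, smul_smul, smul_smul]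
    congr 1
    have hp := fun n : ℕ => pow_ne_zero n ht
    rw [← div_eq_mul_inv, mul_comm, ← div_eq_mul_inv, div_eq_div_iff (hp _) (hp _), ← pow_add,
      ← pow_add]
    congr 1
    omega

end CompletePieri

/-! ### The Jacobi–Trudi formula and the Cauchy identity -/

section Cauchy

variable {𝕜 : Type*} [Field 𝕜] {l : ℕ}

/-- The complete homogeneous symmetric polynomial `h_n` with an integer index, zero for `n < 0`. -/
def hsymmZ (𝕜 : Type*) [Field 𝕜] (l : ℕ) (n : ℤ) : LaurentPoly 𝕜 l :=
  if 0 ≤ n then hsymmL 𝕜 l n.toNat else 0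

theorem hsymmL_zero : hsymmL 𝕜 l 0 = 1 := by
  rw [hsymmL, Finset.piAntidiag_zero, Finset.sum_singleton, ← mono_zero]
  congr 1

/-- The coefficient of `X^r` in `∏_{i ≠ k} (1 - x_i X)`. -/
def omitCoeff (𝕜 : Type*) [Field 𝕜] {l : ℕ} (k : Fin l) (r : ℕ) : LaurentPoly 𝕜 l :=
  PowerSeries.coeff r (∏ i ∈ Finset.univ.erase k, (1 - PowerSeries.C (var 𝕜 i) * PowerSeries.X))

theorem omitCoeff_eq_zero (k : Fin l) {r : ℕ} (hr : l ≤ r) : omitCoeff 𝕜 k r = 0 := by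
  have := k.isLt
  rw [omitCoeff, coeff_prod_one_sub, Finset.powersetCard_eq_empty.2, Finset.sum_empty, mul_zero]
  rw [Finset.card_erase_of_mem (Finset.mem_univ _), Finset.card_univ, Fintype.card_fin]
  omega

/-- `x_k^m = ∑_r (coefficient of X^r in ∏_{i ≠ k} (1 - x_i X)) · h_{m-r}`. -/
theorem var_pow_eq_sum (k : Fin l) (m : ℕ) :
    var 𝕜 k ^ m = ∑ r ∈ Finset.range l, omitCoeff 𝕜 k r * hsymmZ 𝕜 l (m - r) := by
  have h : geomSeries (var 𝕜 k) =
      (∏ i ∈ Finset.univ.erase k, (1 - PowerSeries.C (var 𝕜 i) * PowerSeries.X)) *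
        ∏ i : Fin l, geomSeries (var 𝕜 i) := by
    rw [← Finset.mul_prod_erase _ (fun i => geomSeries (var 𝕜 i)) (Finset.mem_univ k),
      mul_left_comm, ← Finset.prod_mul_distrib,
      Finset.prod_eq_one fun i _ => one_sub_mul_geomSeries (var 𝕜 i), mul_one]
  have h2 := congrArg (PowerSeries.coeff m) h
  rw [geomSeries, PowerSeries.coeff_mk, PowerSeries.coeff_mul,
    Finset.Nat.sum_antidiagonal_eq_sum_range_succ_mk] at h2
  have hz : ∀ r, r ≤ m → hsymmZ 𝕜 l ((m : ℤ) - r) = hsymmL 𝕜 l (m - r) := by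
    intro r hr
    rw [hsymmZ, if_pos (by omega)]
    congr 1
    omega
  have e1 : ∑ r ∈ Finset.range (m + 1), omitCoeff 𝕜 k r * hsymmZ 𝕜 l (m - r) =
      ∑ r ∈ Finset.range (max l (m + 1)), omitCoeff 𝕜 k r * hsymmZ 𝕜 l (m - r) := by
    refine Finset.sum_subset (Finset.range_mono (le_max_right _ _)) fun r _ hr => ?_
    rw [Finset.mem_range] at hr
    rw [hsymmZ, if_neg (by omega), mul_zero]
  have e2 : ∑ r ∈ Finset.range l, omitCoeff 𝕜 k r * hsymmZ 𝕜 l (m - r) =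
      ∑ r ∈ Finset.range (max l (m + 1)), omitCoeff 𝕜 k r * hsymmZ 𝕜 l (m - r) := by
    refine Finset.sum_subset (Finset.range_mono (le_max_left _ _)) fun r _ hr => ?_
    rw [Finset.mem_range] at hr
    rw [omitCoeff_eq_zero k (by omega), zero_mul]
  rw [h2, e2, ← e1]
  refine Finset.sum_congr rfl fun r hr => ?_
  rw [coeff_prod_geomSeries, hz r (by have := Finset.mem_range.1 hr; omega)]
  rfl

theorem rho_nonneg (j : Fin l) : 0 ≤ rho l j := by
  have := j.isLt; simp only [rho]; omega

/-- The alternant `∑_w (-1)^{ℓ(w)} x^{w m}` is the product of a matrix which does not depend on `m`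
and a matrix of complete homogeneous symmetric polynomials. -/
theorem alternant_eq_det_mul (m : Fin l → ℕ) :
    alternant 𝕜 (natWeight m) =
      (Matrix.of fun k j : Fin l => omitCoeff 𝕜 k (rho l j).toNat).det *
        (Matrix.of fun j c : Fin l => hsymmZ 𝕜 l (m c - rho l j)).det := by
  have h := alternant_eq_det 𝕜 m
  change alternant 𝕜 (natWeight m) = _ at h
  rw [h, ← Matrix.det_mul]
  congr 1
  ext1 k c
  rw [Matrix.mul_apply]
  simp only [Matrix.of_apply]
  rw [var_pow_eq_sum, ← Fin.sum_univ_eq_sum_range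
    (fun r => omitCoeff 𝕜 k r * hsymmZ 𝕜 l ((m c : ℤ) - (r : ℕ))) l, ← Equiv.sum_comp Fin.revPerm]
  refine Finset.sum_congr rfl fun j _ => ?_
  have e : ((Fin.revPerm j : Fin l) : ℕ) = (rho l j).toNat := by
    have := j.isLt
    simp only [Fin.revPerm_apply, Fin.val_rev, rho]
    omega
  have e' : ((rho l j).toNat : ℤ) = rho l j := Int.toNat_of_nonneg (rho_nonneg j)
  rw [e, e']

theorem det_hsymmZ_rho :
    (Matrix.of fun j c : Fin l => hsymmZ 𝕜 l (rho l c - rho l j)).det = 1 := by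
  rw [Matrix.det_of_isLowerTriangular]
  · refine Finset.prod_eq_one fun i _ => ?_
    simp [hsymmZ, hsymmL_zero]
  · intro j c hjc
    have hlt : j < c := hjc
    rw [Matrix.of_apply, hsymmZ, if_neg]
    have : (j : ℕ) < c := hlt
    simp only [rho]
    omega

theorem alternant_rho_eq_det :
    alternant 𝕜 (rho l) =
      (Matrix.of fun k j : Fin l => omitCoeff 𝕜 k (rho l j).toNat).det := by
  have e : rho l = natWeight fun i => (rho l i).toNat := by
    funext i
    exact (Int.toNat_of_nonneg (rho_nonneg i)).symm
  have h := alternant_eq_det_mul (𝕜 := 𝕜) fun i : Fin l => (rho l i).toNat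
  rw [← e] at h
  have e2 : ∀ c : Fin l, ((rho l c).toNat : ℤ) = rho l c :=
    fun c => Int.toNat_of_nonneg (rho_nonneg c)
  simp only [e2] at h
  rw [h, det_hsymmZ_rho, mul_one]

theorem strictAnti_rho : StrictAnti (rho l) := by
  intro i j h
  have : (i : ℕ) < j := h
  simp only [rho]
  omega

theorem eq_one_of_permAct_strictAnti {w : Equiv.Perm (Fin l)} {μ ν : Weight l}
    (hμ : StrictAnti μ) (hν : StrictAnti ν) (h : permAct w μ = ν) : w = 1 := by
  have hm : Monotone ⇑w⁻¹ := by
    intro i j hij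
    have := hν.antitone hij
    rw [← h] at this
    exact hμ.le_iff_ge.1 this
  have := (Equiv.Perm.monotone_iff w⁻¹).1 hm
  rwa [inv_eq_one] at this

theorem coeff_alternant (μ κ : Weight l) :
    (alternant 𝕜 μ).coeff κ =
      ∑ w : Equiv.Perm (Fin l),
        (Equiv.Perm.sign w : ℤ) • if permAct w μ = κ then (1 : 𝕜) else 0 := by
  rw [alternant, AddMonoidAlgebra.coeff_sum, Finsupp.finsetSum_apply]
  refine Finset.sum_congr rfl fun w _ => ?_
  rw [← coeff_mono]
  rfl

theorem coeff_alternant_strictAnti {μ ν : Weight l} (hμ : StrictAnti μ) (hν : StrictAnti ν) :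
    (alternant 𝕜 μ).coeff ν = if μ = ν then 1 else 0 := by
  rw [coeff_alternant, Finset.sum_eq_single 1]
  · simp
  · intro w _ hw
    rw [if_neg fun h => hw (eq_one_of_permAct_strictAnti hμ hν h), smul_zero]
  · simp

theorem alternant_rho_ne_zero : alternant 𝕜 (rho l) ≠ 0 := by
  intro h
  have := coeff_alternant_strictAnti (𝕜 := 𝕜) (strictAnti_rho (l := l)) strictAnti_rho
  simp [h] at this

/-- The Jacobi–Trudi formula for polynomial weights. -/
theorem irrChar_eq_det (μ : DominantWeight l) (hμ : ∀ i, 0 ≤ μ.1 i) :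
    irrChar 𝕜 μ =
      (Matrix.of fun j c : Fin l => hsymmZ 𝕜 l (μ.1 c + rho l c - rho l j)).det := by
  have hnn : ∀ i, 0 ≤ (μ.1 + rho l) i := fun i => add_nonneg (hμ i) (rho_nonneg i)
  have e : μ.1 + rho l = natWeight fun i => ((μ.1 + rho l) i).toNat := by
    funext i
    exact (Int.toNat_of_nonneg (hnn i)).symm
  have h := alternant_eq_det_mul (𝕜 := 𝕜) fun i : Fin l => ((μ.1 + rho l) i).toNat
  rw [← e, ← alternant_rho_eq_det] at h
  have e2 : ∀ c : Fin l, (((μ.1 + rho l) c).toNat : ℤ) = μ.1 c + rho l c :=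
    fun c => Int.toNat_of_nonneg (hnn c)
  simp only [e2] at h
  apply mul_right_cancel₀ (alternant_rho_ne_zero (𝕜 := 𝕜) (l := l))
  rw [irrChar_mul, h, mul_comm]

/-- The product `h_{d_1} ⋯ h_{d_l}` is the generating function of the column sums of the matrices
with row sums `d`. -/
theorem prod_hsymmL {n : ℕ} (d : Fin n → ℕ) :
    ∏ i, hsymmL 𝕜 l (d i) = ∑ R ∈ Fintype.piFinset fun i => Finset.piAntidiag Finset.univ (d i),
      mono 𝕜 (natWeight fun j => ∑ i, R i j) := by
  simp only [hsymmL]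
  rw [Finset.prod_univ_sum]
  refine Finset.sum_congr rfl fun R _ => ?_
  rw [mono_sum]
  congr 1
  funext j
  simp

theorem exists_of_coeff_prod_hsymmL_ne_zero {n : ℕ} {d : Fin n → ℕ} {κ : Weight l}
    (h : (∏ i, hsymmL 𝕜 l (d i)).coeff κ ≠ 0) :
    ∃ c : Fin l → ℕ, κ = natWeight c ∧ ∑ j, c j = ∑ i, d i := by
  rw [prod_hsymmL, AddMonoidAlgebra.coeff_sum, Finsupp.finsetSum_apply] at h
  obtain ⟨R, hR, hne⟩ := Finset.exists_ne_zero_of_sum_ne_zero h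
  rw [coeff_mono] at hne
  refine ⟨fun j => ∑ i, R i j, ?_, ?_⟩
  · by_contra hc
    exact hne (if_neg (Ne.symm hc))
  · rw [Finset.sum_comm]
    refine Finset.sum_congr rfl fun i _ => ?_
    exact mem_piAntidiag_univ.1 (Fintype.mem_piFinset.1 hR i)

/-- Transposing matrices exchanges row sums and column sums. -/
theorem coeff_prod_hsymmL_comm (c d : Fin l → ℕ) :
    (∏ i, hsymmL 𝕜 l (d i)).coeff (natWeight c) = (∏ i, hsymmL 𝕜 l (c i)).coeff (natWeight d) := by
  have key : ∀ c d : Fin l → ℕ, (∏ i, hsymmL 𝕜 l (d i)).coeff (natWeight c) =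
      ∑ R ∈ (Fintype.piFinset fun i => Finset.piAntidiag Finset.univ (d i)).filter
        (fun R : Fin l → Fin l → ℕ => (fun j => ∑ i, R i j) = c), (1 : 𝕜) := by
    intro c d
    rw [prod_hsymmL, AddMonoidAlgebra.coeff_sum, Finsupp.finsetSum_apply, Finset.sum_filter]
    refine Finset.sum_congr rfl fun R _ => ?_
    rw [coeff_mono]
    simp only [natWeight_injective.eq_iff]
  have hm : ∀ c d : Fin l → ℕ, ∀ R ∈ (Fintype.piFinset fun i =>
      Finset.piAntidiag Finset.univ (d i)).filter
        (fun R : Fin l → Fin l → ℕ => (fun j => ∑ i, R i j) = c),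
      (fun i j => R j i) ∈ (Fintype.piFinset fun i =>
      Finset.piAntidiag Finset.univ (c i)).filter
        (fun R : Fin l → Fin l → ℕ => (fun j => ∑ i, R i j) = d) := by
    intro c d R hR
    simp only [Finset.mem_filter, Fintype.mem_piFinset, mem_piAntidiag_univ] at hR ⊢
    exact ⟨fun i => congrFun hR.2 i, funext hR.1⟩
  rw [key, key]
  exact Finset.sum_nbij' (fun R i j => R j i) (fun R i j => R j i) (hm c d) (hm d c)
    (fun _ _ => rfl) (fun _ _ => rfl) (fun _ _ => rfl)

theorem coeff_prod_hsymmL (d : Fin l → ℕ) (κ : Weight l) :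
    (∏ i, hsymmL 𝕜 l (d i)).coeff κ = (∏ i, hsymmZ 𝕜 l (κ i)).coeff (natWeight d) := by
  by_cases h : ∀ i, 0 ≤ κ i
  · have e : κ = natWeight fun i => (κ i).toNat := by
      funext i
      exact (Int.toNat_of_nonneg (h i)).symm
    have e2 : ∏ i, hsymmZ 𝕜 l (κ i) = ∏ i, hsymmL 𝕜 l (κ i).toNat :=
      Finset.prod_congr rfl fun i _ => if_pos (h i)
    rw [e2]
    conv_lhs => rw [e]
    exact coeff_prod_hsymmL_comm _ _
  · push Not at h
    obtain ⟨i, hi⟩ := h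
    have h0 : hsymmZ 𝕜 l (κ i) = 0 := if_neg (not_le.2 hi)
    rw [Finset.prod_eq_zero (f := fun i => hsymmZ 𝕜 l (κ i)) (Finset.mem_univ i) h0]
    by_contra hc
    obtain ⟨c, rfl, -⟩ := exists_of_coeff_prod_hsymmL_ne_zero hc
    simp at hi
    omega

/-- Antisymmetry of a Laurent polynomial under simple transpositions. -/
def IsAntisymm (f : LaurentPoly 𝕜 l) : Prop := ∀ a, permOp 𝕜 (simpleRefl a) f = -f

theorem isAntisymm_alternant (μ : Weight l) : IsAntisymm (alternant 𝕜 μ) := by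
  intro a
  rw [alternant, map_sum, ← Finset.sum_neg_distrib,
    ← Equiv.sum_comp (Equiv.mulLeft (simpleRefl a))]
  refine Finset.sum_congr rfl fun w _ => ?_
  have hs : Equiv.Perm.sign (simpleRefl a) = -1 := Equiv.Perm.sign_swap (lo_ne_hi a)
  rw [map_zsmul, permOp_mono, ← permAct_mul, Equiv.coe_mulLeft, ← mul_assoc, simpleRefl_mul_self,
    one_mul, Equiv.Perm.sign_mul, hs]
  simp

/-- An antisymmetric Laurent polynomial is determined by its coefficients at the strictly dominant
weights `ν + ρ`. -/
theorem IsAntisymm.eq_zero [CharZero 𝕜] {f : LaurentPoly 𝕜 l} (hf : IsAntisymm f)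
    (h : ∀ ν : DominantWeight l, f.coeff (ν.1 + rho l) = 0) : f = 0 := by
  ext κ
  rw [AddMonoidAlgebra.coeff_zero, Finsupp.zero_apply]
  have hco : ∀ a κ, f.coeff (permAct (simpleRefl a) κ) = -f.coeff κ := by
    intro a κ
    have := congrArg (fun g : LaurentPoly 𝕜 l => g.coeff κ) (hf a)
    simpa [coeff_permOp] using this
  induction κ using weight_induction with
  | dom κ hκ =>
    by_cases hs : ∃ a, κ (lo a) = κ (hi a)
    · obtain ⟨a, ha⟩ := hs
      -- The coefficient is its own negative, hence zero in characteristic zero.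
      have := hco a κ
      rw [permAct_simpleRefl_of_eq ha] at this
      exact self_eq_neg.1 this
    · push Not at hs
      have hanti : Antitone (κ - rho l) := by
        refine antitone_of_forall_simple fun a => ?_
        have h1 := lt_of_le_of_ne (hκ (lo_lt_hi a).le) (hs a).symm
        simp only [Pi.sub_apply, rho, lo, hi] at h1 ⊢
        push_cast
        omega
      have := h ⟨κ - rho l, hanti⟩
      rwa [sub_add_cancel] at this
  | step κ a _ ih =>
    rw [hco] at ih
    exact neg_eq_zero.1 ih

theorem strictAnti_add_rho (ν : DominantWeight l) : StrictAnti (ν.1 + rho l) :=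
  ν.2.add_strictAnti strictAnti_rho

/-- The Cauchy identity: the coefficient of `y^d` in `∑_μ χ_μ(x) χ_μ(y) = ∏ 1 / (1 - x_i y_j)`.
Multiplied by the alternant of `ρ`, both sides are antisymmetric, and their coefficients at `ν + ρ`
agree by the Jacobi–Trudi formula and the symmetry `coeff_prod_hsymmL_comm`. -/
theorem sum_coeff_smul_irrChar [CharZero 𝕜] (d : Fin l → ℕ) :
    ∑ μ ∈ polyWeights l (∑ i, d i), (irrChar 𝕜 μ).coeff (natWeight d) • irrChar 𝕜 μ =
      ∏ i, hsymmL 𝕜 l (d i) := by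
  apply mul_right_cancel₀ (alternant_rho_ne_zero (𝕜 := 𝕜) (l := l))
  rw [← sub_eq_zero, Finset.sum_mul]
  have e : ∀ μ : DominantWeight l,
      (irrChar 𝕜 μ).coeff (natWeight d) • irrChar 𝕜 μ * alternant 𝕜 (rho l) =
      (irrChar 𝕜 μ).coeff (natWeight d) • alternant 𝕜 (μ.1 + rho l) := by
    intro μ
    rw [smul_mul_assoc, irrChar_mul]
  simp only [e]
  have hsym : ∀ a, permOp 𝕜 (simpleRefl a) (∏ i, hsymmL 𝕜 l (d i)) =
      ∏ i, hsymmL 𝕜 l (d i) := by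
    intro a
    rw [permOp_eq_domCongr]
    change (AddMonoidAlgebra.domCongr 𝕜 𝕜 (permAddEquiv (simpleRefl a))) _ = _
    rw [map_prod]
    refine Finset.prod_congr rfl fun i _ => ?_
    have := permOp_hsymmL (𝕜 := 𝕜) (simpleRefl a) (d i)
    rwa [permOp_eq_domCongr] at this
  refine IsAntisymm.eq_zero ?_ ?_
  · intro a
    rw [map_sub, permOp_mul_apply, hsym, isAntisymm_alternant, map_sum, mul_neg, neg_sub,
      sub_neg_eq_add, add_comm, sub_eq_add_neg, ← Finset.sum_neg_distrib]
    congr 1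
    refine Finset.sum_congr rfl fun μ _ => ?_
    rw [map_smul, isAntisymm_alternant, smul_neg]
  · intro ν
    rw [AddMonoidAlgebra.coeff_sub, Finsupp.sub_apply, sub_eq_zero, AddMonoidAlgebra.coeff_sum,
      Finsupp.finsetSum_apply]
    have hl : ∀ μ : DominantWeight l, ((irrChar 𝕜 μ).coeff (natWeight d) •
        alternant 𝕜 (μ.1 + rho l)).coeff (ν.1 + rho l) =
        if μ = ν then (irrChar 𝕜 ν).coeff (natWeight d) else 0 := by
      intro μ
      rw [AddMonoidAlgebra.coeff_smul, Finsupp.smul_apply,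
        coeff_alternant_strictAnti (strictAnti_add_rho μ) (strictAnti_add_rho ν)]
      by_cases h : μ = ν
      · simp [h]
      · rw [if_neg h, if_neg fun h' => h (Subtype.ext (add_right_cancel h')), smul_zero]
    have hr : ((∏ i, hsymmL 𝕜 l (d i)) * alternant 𝕜 (rho l)).coeff (ν.1 + rho l) =
        ∑ w : Equiv.Perm (Fin l), (Equiv.Perm.sign w : ℤ) •
          (∏ i, hsymmL 𝕜 l (d i)).coeff (ν.1 + rho l - permAct w (rho l)) := by
      rw [mul_comm, alternant, Finset.sum_mul, AddMonoidAlgebra.coeff_sum,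
        Finsupp.finsetSum_apply]
      refine Finset.sum_congr rfl fun w _ => ?_
      rw [smul_mul_assoc, ← coeff_mono_mul]
      rfl
    rw [hr, Finset.sum_congr rfl fun μ _ => hl μ, Finset.sum_ite_eq']
    split_ifs with hν
    · rw [mem_polyWeights] at hν
      rw [irrChar_eq_det ν hν.1, Matrix.det_apply', AddMonoidAlgebra.coeff_sum,
        Finsupp.finsetSum_apply, ← Equiv.sum_comp (Equiv.inv (Equiv.Perm (Fin l)))]
      refine Finset.sum_congr rfl fun w _ => ?_
      rw [coeff_prod_hsymmL, Equiv.inv_apply, Equiv.Perm.sign_inv, ← zsmul_eq_mul]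
      rfl
    · -- If `ν` is not a polynomial weight of size `|d|`, no term of the product contributes.
      symm
      refine Finset.sum_eq_zero fun w _ => ?_
      by_contra hne
      obtain ⟨c, hc, hcd⟩ := exists_of_coeff_prod_hsymmL_ne_zero (right_ne_zero_of_smul hne)
      refine hν ((mem_polyWeights ν).2 ⟨fun i => ?_, ?_⟩)
      · have hi := i.isLt
        let j : Fin l := ⟨l - 1, by omega⟩
        have h1 : ν.1 j ≤ ν.1 i := ν.2 (show (i : ℕ) ≤ l - 1 by omega)
        have h2 := congrFun hc j
        have h3 : rho l j = 0 := by simp only [rho, j]; omega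
        have h4 := rho_nonneg (w⁻¹ j)
        simp only [Pi.sub_apply, Pi.add_apply, permAct_apply, natWeight_apply, h3] at h2
        omega
      · have h1 : ∑ i, (ν.1 + rho l - permAct w (rho l)) i = ∑ i, (d i : ℤ) := by
          simp only [hc, natWeight_apply]
          exact_mod_cast hcd
        have h2 : ∑ i, permAct w (rho l) i = ∑ i, rho l i := Equiv.sum_comp w⁻¹ (rho l)
        simp only [Pi.sub_apply, Pi.add_apply, Finset.sum_sub_distrib, Finset.sum_add_distrib,
          h2] at h1
        push_cast
        linarith

end Cauchy

/-! ### Triples and inversions -/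

section Triples

variable {l : ℕ}

theorem mem_sigmaTriples {σ : Equiv.Perm (Fin l)} {α β : Weight l} {ia i ic : ℤ} {ra p rc : Fin l} :
    ((ia, ra), (i, p), (ic, rc)) ∈ sigmaTriples σ β α ↔
      ((α ra ≤ ia ∧ ia ≤ β ra + 1) ∧ (α p + 1 ≤ i ∧ i ≤ β p) ∧ (α rc ≤ ic ∧ ic ≤ β rc + 1)) ∧
        ra = rc ∧ ic = ia + 1 ∧ p < ra ∧ (ia < i ∨ (ia = i ∧ σ ra < σ p)) ∧
          (i < ic ∨ (i = ic ∧ σ p < σ rc)) := by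
  classical
  rw [sigmaTriples, Finset.mem_filter, extendedRowBoxes, rowBoxes]
  simp [sigmaLT]

/-- The triples whose middle box lies in row `p` and whose outer boxes lie in row `r` are counted
by the middle box, as its position determines those of the outer boxes. -/
theorem hSigma_eq_pairExponent (σ : Equiv.Perm (Fin l)) (α β : Weight l) :
    hSigma σ β α = pairExponent σ α β := by
  classical
  have e : pairExponent σ α β = ((orderedPairs l).sigma fun p =>
      (Finset.Ioc (α p.1) (β p.1)).filter fun i =>
        α p.2 ≤ i - (if σ p.1 < σ p.2 then 1 else 0) ∧
          i - (if σ p.1 < σ p.2 then 1 else 0) ≤ β p.2).card := by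
    rw [Finset.card_sigma]
    rfl
  rw [e, hSigma]
  refine Finset.card_nbij' (fun t => ⟨(t.2.1.2, t.1.2), t.2.1.1⟩)
    (fun x => ((x.2 - (if σ x.1.1 < σ x.1.2 then 1 else 0), x.1.2), (x.2, x.1.1),
      (x.2 - (if σ x.1.1 < σ x.1.2 then 1 else 0) + 1, x.1.2))) ?_ ?_ ?_ ?_
  · rintro ⟨⟨ia, ra⟩, ⟨i, p⟩, ⟨ic, rc⟩⟩ h
    obtain ⟨⟨h1, h2, h3⟩, rfl, h4, h5, h6, h7⟩ := mem_sigmaTriples.1 (Finset.mem_coe.1 h)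
    simp only [Finset.mem_coe, Finset.mem_sigma, mem_orderedPairs, Finset.mem_filter,
      Finset.mem_Ioc]
    have hne : σ p ≠ σ ra := σ.injective.ne h5.ne
    refine ⟨h5, ?_⟩
    split_ifs with hlt
    · have := hlt.asymm
      simp only [hlt, this, and_true, and_false, or_false] at h6 h7
      omega
    · simp only [hlt, and_false, or_false] at h7
      omega
  · rintro ⟨⟨p, r⟩, i⟩ h
    simp only [Finset.mem_coe, Finset.mem_sigma, mem_orderedPairs, Finset.mem_filter,
      Finset.mem_Ioc] at h
    refine Finset.mem_coe.2 (mem_sigmaTriples.2 ?_)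
    obtain ⟨h1, h2, h3⟩ := h
    have hne : σ p ≠ σ r := σ.injective.ne h1.ne
    refine ⟨⟨?_, ?_, ?_⟩, rfl, rfl, h1, ?_, ?_⟩
    · dsimp only; split_ifs at h3 ⊢ <;> omega
    · dsimp only; omega
    · dsimp only; split_ifs at h3 ⊢ <;> omega
    · dsimp only
      split_ifs with hlt
      · left; omega
      · right; exact ⟨by omega, lt_of_le_of_ne (not_lt.1 hlt) hne.symm⟩
    · dsimp only
      split_ifs with hlt
      · right; exact ⟨by omega, hlt⟩
      · left; omega
  · rintro ⟨⟨ia, ra⟩, ⟨i, p⟩, ⟨ic, rc⟩⟩ h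
    obtain ⟨-, rfl, rfl, h5, h6, h7⟩ := mem_sigmaTriples.1 (Finset.mem_coe.1 h)
    have hne : σ p ≠ σ ra := σ.injective.ne h5.ne
    have hi : i - (if σ p < σ ra then 1 else 0) = ia := by
      split_ifs with hlt
      · have := hlt.asymm
        simp only [hlt, this, and_true, and_false, or_false] at h6 h7
        omega
      · simp only [hlt, and_false, or_false] at h7
        omega
    simp only [hi]
  · rintro ⟨⟨p, r⟩, i⟩ _
    rfl

/-- The number of attacking inversions of a filling `e` of the rows of `β/α`, where the filling is
given as a function of the row and the column. -/
def fillingInv (σ : Equiv.Perm (Fin l)) (α β : Weight l) (e : Fin l → ℤ → ℕ) : ℕ :=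
  ∑ j, ∑ j', ∑ i ∈ Finset.Ioc (α j) (β j), ∑ i' ∈ Finset.Ioc (α j') (β j'),
    if ((i = i' ∧ σ j < σ j') ∨ (i' = i + 1 ∧ σ j' < σ j)) ∧ e j' i' < e j i then 1 else 0

theorem sum_sum_eq_sum_orderedPairs {M : Type*} [AddCommMonoid M] (F : Fin l → Fin l → M)
    (h : ∀ j, F j j = 0) :
    ∑ j, ∑ j', F j j' = ∑ p ∈ orderedPairs l, (F p.1 p.2 + F p.2 p.1) := by
  have e : ∀ p : Fin l × Fin l, F p.1 p.2 =
      (if p.1 < p.2 then F p.1 p.2 else 0) + if p.2 < p.1 then F p.1 p.2 else 0 := by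
    rintro ⟨i, j⟩
    rcases lt_trichotomy i j with hlt | rfl | hlt
    · simp [hlt, hlt.asymm]
    · simp [h]
    · simp [hlt, hlt.asymm]
  rw [← Finset.sum_product' Finset.univ Finset.univ F, Finset.univ_product_univ,
    Finset.sum_congr rfl fun p _ => e p, Finset.sum_add_distrib, Finset.sum_add_distrib,
    orderedPairs, Finset.sum_filter, Finset.sum_filter]
  congr 1
  exact (Equiv.sum_comp (Equiv.prodComm (Fin l) (Fin l))
    fun p => if p.2 < p.1 then F p.1 p.2 else 0).symm

/-- The triples `(a, b, c)` of `β/α` are of three kinds: those within the layer of `b` in the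
filling, meaning that `e(a) ≤ e(b) ≤ e(c)`, where `e` is `-∞` to the left and `∞` to the right of a
row, those with an inversion `e(a) > e(b)`, and those with an inversion `e(b) > e(c)`.  The layer
`m` of the filling is the skew shape `P (m + 1) / P m`, consisting of the boxes with entry `m`. -/
theorem pairExponent_eq_fillingInv_add (σ : Equiv.Perm (Fin l)) {α β : Weight l} {n : ℕ}
    {P : ℕ → Weight l} (hP : ∀ j, Monotone fun m => P m j) (h0 : P 0 = α) (hn : P n = β)
    {e : Fin l → ℤ → ℕ} (he : ∀ j, ∀ i ∈ Finset.Ioc (α j) (β j), ∀ m, e j i < m ↔ i ≤ P m j) :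
    pairExponent σ α β = fillingInv σ α β e +
      ∑ m ∈ Finset.range n, pairExponent σ (P m) (P (m + 1)) := by
  have hdiag : ∀ j, ∑ i ∈ Finset.Ioc (α j) (β j), ∑ i' ∈ Finset.Ioc (α j) (β j),
      (if ((i = i' ∧ σ j < σ j) ∨ (i' = i + 1 ∧ σ j < σ j)) ∧ e j i' < e j i then 1 else 0) =
      0 := by
    intro j
    simp
  rw [fillingInv, sum_sum_eq_sum_orderedPairs _ hdiag]
  simp only [pairExponent]
  rw [Finset.sum_comm, ← Finset.sum_add_distrib]
  refine Finset.sum_congr rfl fun x hx => ?_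
  obtain ⟨p, r⟩ := x
  rw [mem_orderedPairs] at hx
  have hne : σ p ≠ σ r := σ.injective.ne hx.ne
  simp only
  set δ : ℤ := if σ p < σ r then 1 else 0 with hδ
  have hbound : ∀ m, m ≤ n → ∀ j, α j ≤ P m j ∧ P m j ≤ β j := fun m hm j =>
    ⟨h0 ▸ hP j (Nat.zero_le m), hn ▸ hP j hm⟩
  have hen : ∀ i ∈ Finset.Ioc (α p) (β p), e p i < n := fun i hi =>
    (he p i hi n).2 (hn ▸ (Finset.mem_Ioc.1 hi).2)
  -- A box `i` of row `p` attacks or is attacked by at most one box of row `r` on either side: these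
  -- are the outer boxes `i - δ` and `i - δ + 1` of its triple.
  have h1 : ∑ i ∈ Finset.Ioc (α p) (β p), ∑ i' ∈ Finset.Ioc (α r) (β r),
      (if ((i = i' ∧ σ p < σ r) ∨ (i' = i + 1 ∧ σ r < σ p)) ∧ e r i' < e p i then 1 else 0) =
      ∑ i ∈ Finset.Ioc (α p) (β p),
        if (α r < i + 1 - δ ∧ i + 1 - δ ≤ β r) ∧ e r (i + 1 - δ) < e p i then 1 else 0 := by
    refine Finset.sum_congr rfl fun i _ => ?_
    have hc : ∀ i', (((i = i' ∧ σ p < σ r) ∨ (i' = i + 1 ∧ σ r < σ p)) ∧ e r i' < e p i) ↔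
        (i' = i + 1 - δ ∧ e r (i + 1 - δ) < e p i) := by
      intro i'
      by_cases hlt : σ p < σ r
      · have hd : i + 1 - δ = i := by rw [hδ, if_pos hlt]; ring
        rw [hd]
        simp only [hlt, hlt.asymm, and_true, and_false, or_false]
        constructor <;> rintro ⟨rfl, h⟩ <;> exact ⟨rfl, h⟩
      · have hgt : σ r < σ p := lt_of_le_of_ne (not_lt.1 hlt) hne.symm
        have hd : i + 1 - δ = i + 1 := by rw [hδ, if_neg hlt]; ring
        rw [hd]
        simp only [hgt, hlt, and_true, and_false, false_or]
        constructor <;> rintro ⟨rfl, h⟩ <;> exact ⟨rfl, h⟩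
    simp only [hc, ite_and, Finset.sum_ite_eq', Finset.mem_Ioc]
  have h2 : ∑ i ∈ Finset.Ioc (α r) (β r), ∑ i' ∈ Finset.Ioc (α p) (β p),
      (if ((i = i' ∧ σ r < σ p) ∨ (i' = i + 1 ∧ σ p < σ r)) ∧ e p i' < e r i then 1 else 0) =
      ∑ i ∈ Finset.Ioc (α p) (β p),
        if (α r < i - δ ∧ i - δ ≤ β r) ∧ e p i < e r (i - δ) then 1 else 0 := by
    rw [Finset.sum_comm]
    refine Finset.sum_congr rfl fun i' _ => ?_
    have hc : ∀ i, (((i = i' ∧ σ r < σ p) ∨ (i' = i + 1 ∧ σ p < σ r)) ∧ e p i' < e r i) ↔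
        (i = i' - δ ∧ e p i' < e r (i' - δ)) := by
      intro i
      by_cases hlt : σ p < σ r
      · have hd : i' - δ = i' - 1 := by rw [hδ, if_pos hlt]
        rw [hd]
        simp only [hlt, hlt.asymm, and_true, and_false, false_or]
        constructor
        · rintro ⟨rfl, h⟩
          exact ⟨by ring, by rwa [add_sub_cancel_right]⟩
        · rintro ⟨rfl, h⟩
          exact ⟨by ring, h⟩
      · have hgt : σ r < σ p := lt_of_le_of_ne (not_lt.1 hlt) hne.symm
        have hd : i' - δ = i' := by rw [hδ, if_neg hlt]; ring
        rw [hd]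
        simp only [hgt, hlt, and_true, and_false, or_false]
        constructor <;> rintro ⟨rfl, h⟩ <;> exact ⟨rfl, h⟩
    simp only [hc, ite_and, Finset.sum_ite_eq', Finset.mem_Ioc]
  -- The box `i` of row `p` lies in the layer `e p i`.
  have h3 : ∑ m ∈ Finset.range n,
      rowExponent δ (P m p) (P (m + 1) p) (P m r) (P (m + 1) r) =
      ∑ i ∈ Finset.Ioc (α p) (β p),
        if P (e p i) r ≤ i - δ ∧ i - δ ≤ P (e p i + 1) r then 1 else 0 := by
    have hm : ∀ m ∈ Finset.range n,
        rowExponent δ (P m p) (P (m + 1) p) (P m r) (P (m + 1) r) =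
        ∑ i ∈ Finset.Ioc (α p) (β p),
          if e p i = m then (if P m r ≤ i - δ ∧ i - δ ≤ P (m + 1) r then 1 else 0) else 0 := by
      intro m hm
      have hmn := Finset.mem_range.1 hm
      rw [rowExponent, Finset.card_filter]
      have hsub : Finset.Ioc (P m p) (P (m + 1) p) ⊆ Finset.Ioc (α p) (β p) :=
        Finset.Ioc_subset_Ioc (hbound m hmn.le p).1 (hbound (m + 1) hmn p).2
      rw [← Finset.sum_subset hsub]
      · refine Finset.sum_congr rfl fun i hi => ?_
        have k1 := he p i (hsub hi) m
        have k2 := he p i (hsub hi) (m + 1)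
        have hi' := Finset.mem_Ioc.1 hi
        have h : e p i = m := by omega
        rw [if_pos h]
      · intro i hi hni
        have k1 := he p i hi m
        have k2 := he p i hi (m + 1)
        rw [Finset.mem_Ioc] at hni
        have h : e p i ≠ m := by omega
        rw [if_neg h]
    rw [Finset.sum_congr rfl hm, Finset.sum_comm]
    refine Finset.sum_congr rfl fun i hi => ?_
    rw [Finset.sum_ite_eq, if_pos (Finset.mem_range.2 (hen i hi))]
  rw [h1, h2, h3, rowExponent, Finset.card_filter, ← Finset.sum_add_distrib,
    ← Finset.sum_add_distrib]
  refine Finset.sum_congr rfl fun i hi => ?_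
  have b1 := hbound (e p i) (hen i hi).le r
  have b2 := hbound (e p i + 1) (hen i hi) r
  have b3 : P (e p i) r ≤ P (e p i + 1) r := hP r (Nat.le_succ _)
  -- It remains to split the range `α r ≤ i - δ ≤ β r` at the ends of the layer in row `r`.
  have k1 : (α r < i + 1 - δ ∧ i + 1 - δ ≤ β r) ∧ e r (i + 1 - δ) < e p i ↔
      α r ≤ i - δ ∧ i - δ < P (e p i) r := by
    constructor
    · rintro ⟨h, h'⟩
      have := (he r _ (Finset.mem_Ioc.2 h) _).1 h'
      omega
    · rintro ⟨h, h'⟩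
      have hm : α r < i + 1 - δ ∧ i + 1 - δ ≤ β r := by omega
      exact ⟨hm, (he r _ (Finset.mem_Ioc.2 hm) _).2 (by omega)⟩
  have k2 : (α r < i - δ ∧ i - δ ≤ β r) ∧ e p i < e r (i - δ) ↔
      P (e p i + 1) r < i - δ ∧ i - δ ≤ β r := by
    constructor
    · rintro ⟨h, h'⟩
      have := he r _ (Finset.mem_Ioc.2 h) (e p i + 1)
      omega
    · rintro ⟨h, h'⟩
      have hm : α r < i - δ ∧ i - δ ≤ β r := by omega
      have := he r _ (Finset.mem_Ioc.2 hm) (e p i + 1)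
      exact ⟨hm, by omega⟩
  rw [if_congr k1 rfl rfl, if_congr k2 rfl rfl]
  split_ifs <;> omega

end Triples

/-! ### Chains of weights -/

section Chains

variable {l n : ℕ}

/-- The `m`-th weight of the chain which starts at `α` and whose steps are the rows of `D`. -/
def chain (α : Weight l) (D : Fin n → Fin l → ℕ) (m : ℕ) : Weight l :=
  fun j => α j + ∑ m' : Fin n, if (m' : ℕ) < m then (D m' j : ℤ) else 0

theorem chain_zero (α : Weight l) (D : Fin n → Fin l → ℕ) : chain α D 0 = α := by
  funext j
  simp [chain]

theorem chain_monotone (α : Weight l) (D : Fin n → Fin l → ℕ) (j : Fin l) :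
    Monotone fun m => chain α D m j := by
  intro m m' h
  refine add_le_add_right (Finset.sum_le_sum fun x _ => ?_) _
  split_ifs with h1 h2
  · rfl
  · omega
  · positivity
  · rfl

theorem chain_succ (α : Weight l) (D : Fin n → Fin l → ℕ) (m : Fin n) :
    chain α D (m + 1) = chain α D m + natWeight (D m) := by
  funext j
  rw [Pi.add_apply, natWeight_apply, chain, chain, add_assoc]
  congr 1
  have e : (D m j : ℤ) = ∑ x : Fin n, if x = m then (D x j : ℤ) else 0 := by simp
  rw [e, ← Finset.sum_add_distrib]
  refine Finset.sum_congr rfl fun x _ => ?_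
  have hx : x = m ↔ (x : ℕ) = m := Fin.ext_iff
  simp only [hx]
  grind

theorem chain_castSucc (α : Weight l) (D : Fin (n + 1) → Fin l → ℕ) {m : ℕ} (hm : m ≤ n) :
    chain α D m = chain α (fun x : Fin n => D x.castSucc) m := by
  funext j
  rw [chain, chain, Fin.sum_univ_castSucc]
  simp [hm]

/-- Multiplying by a product of complete symmetric functions amounts to summing over all chains
of weights whose steps have the given sizes. -/
theorem prod_hsymmL_mul_twistedHL {𝕜 : Type*} [Field 𝕜] {t : 𝕜} (ht : t ≠ 0)
    (σ : Equiv.Perm (Fin l)) (α : Weight l) (d : Fin n → ℕ) :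
    (∏ m, hsymmL 𝕜 l (d m)) * twistedHL t σ⁻¹ α =
      ∑ D ∈ Fintype.piFinset fun m => Finset.piAntidiag Finset.univ (d m),
        (t ^ ∑ m ∈ Finset.range n, pairExponent σ (chain α D m) (chain α D (m + 1)))⁻¹ •
          twistedHL t σ⁻¹ (chain α D n) := by
  induction n with
  | zero => simp [chain_zero]
  | succ n ih =>
    rw [Fin.prod_univ_castSucc, mul_right_comm, ih, mul_comm, Finset.mul_sum]
    have e : ∀ D ∈ Fintype.piFinset fun m : Fin n =>
        Finset.piAntidiag Finset.univ (d m.castSucc), hsymmL 𝕜 l (d (Fin.last n)) *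
        ((t ^ ∑ m ∈ Finset.range n, pairExponent σ (chain α D m) (chain α D (m + 1)))⁻¹ •
          twistedHL t σ⁻¹ (chain α D n)) =
        ∑ c ∈ Finset.piAntidiag Finset.univ (d (Fin.last n)),
          (t ^ (∑ m ∈ Finset.range n, pairExponent σ (chain α D m) (chain α D (m + 1)) +
            pairExponent σ (chain α D n) (chain α D n + natWeight c)))⁻¹ •
            twistedHL t σ⁻¹ (chain α D n + natWeight c) := by
      intro D _
      rw [mul_smul_comm, hsymmL_mul_twistedHL ht, Finset.smul_sum]
      refine Finset.sum_congr rfl fun c _ => ?_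
      rw [smul_smul, pow_add, mul_inv]
    rw [Finset.sum_congr rfl e, ← Finset.sum_product']
    refine Finset.sum_nbij' (fun x => Fin.snoc (α := fun _ => Fin l → ℕ) x.1 x.2)
      (fun D => (fun m => D m.castSucc, D (Fin.last n))) ?_ ?_ ?_ ?_ ?_
    · rintro ⟨D, c⟩ h
      rw [Finset.mem_product, Fintype.mem_piFinset] at h
      rw [Fintype.mem_piFinset]
      intro m
      induction m using Fin.lastCases with
      | last => simpa using h.2
      | cast m => simpa using h.1 m
    · intro D h
      rw [Fintype.mem_piFinset] at h
      rw [Finset.mem_product, Fintype.mem_piFinset]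
      exact ⟨fun m => h m.castSucc, h (Fin.last n)⟩
    · rintro ⟨D, c⟩ _
      simp
    · intro D _
      funext m
      induction m using Fin.lastCases with
      | last => simp
      | cast m => simp
    · rintro ⟨D, c⟩ _
      set D' : Fin (n + 1) → Fin l → ℕ := Fin.snoc (α := fun _ => Fin l → ℕ) D c with hD'
      have hD : (fun x : Fin n => D' x.castSucc) = D := by
        funext x
        simp [hD']
      have hc : D' (Fin.last n) = c := by simp [hD']
      have h1 : ∀ m ≤ n, chain α D' m = chain α D m := fun m hm => by
        rw [chain_castSucc α D' hm, hD]
      have h2 : chain α D' (n + 1) = chain α D n + natWeight c := by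
        have := chain_succ α D' (Fin.last n)
        rwa [Fin.val_last, hc, h1 n le_rfl] at this
      rw [Finset.sum_range_succ, h2, h1 n le_rfl]
      congr 4
      refine Finset.sum_congr rfl fun m hm => ?_
      have := Finset.mem_range.1 hm
      rw [h1 m (by omega), h1 (m + 1) (by omega)]

end Chains

/-! ### Tableaux on tuples of rows -/

section Tableaux

variable {l n : ℕ} {σ : Equiv.Perm (Fin l)} {α β : Weight l}

open DiagramTuple

/-- The boxes of `σ(β/α)`. -/
abbrev RowBox (σ : Equiv.Perm (Fin l)) (α β : Weight l) : Type :=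
  DiagramTuple.Box (rowTuple (permAct σ β) (permAct σ α))

/-- The box of `σ(β/α)` in column `i` of the component coming from the row `j` of `β/α`. -/
def rowBox (σ : Equiv.Perm (Fin l)) {α β : Weight l} {j : Fin l} {i : ℤ}
    (h : i ∈ Finset.Ioc (α j) (β j)) : RowBox σ α β :=
  ⟨σ j, ⟨(i, 1), by simpa [rowTuple, permAct] using h⟩⟩

theorem exists_rowBox_eq (a : RowBox σ α β) :
    ∃ (j : Fin l) (i : ℤ) (h : i ∈ Finset.Ioc (α j) (β j)), rowBox σ h = a := by
  obtain ⟨r, ⟨⟨i, y⟩, h⟩⟩ := a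
  obtain ⟨j, rfl⟩ := σ.surjective r
  have e : σ⁻¹ (σ j) = j := σ.symm_apply_apply j
  have h' := h
  simp only [rowTuple, permAct, e, Finset.mem_product, Finset.mem_singleton] at h'
  obtain ⟨hi, rfl⟩ := h'
  exact ⟨j, i, hi, rfl⟩

/-- The entry of a tableau on `σ(β/α)` in column `i` of the component coming from the row `j`, with
the value `0` outside of the row. -/
def entry (T : RowBox σ α β → Fin n) (j : Fin l) (i : ℤ) : ℕ :=
  if h : i ∈ Finset.Ioc (α j) (β j) then T (rowBox σ h) else 0

theorem entry_of_mem (T : RowBox σ α β → Fin n) {j : Fin l} {i : ℤ}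
    (h : i ∈ Finset.Ioc (α j) (β j)) : entry T j i = T (rowBox σ h) := dif_pos h

theorem entry_box (T : RowBox σ α β → Fin n) (a : RowBox σ α β) :
    entry T (σ⁻¹ a.1) (col a) = T a := by
  obtain ⟨j, i, h, rfl⟩ := exists_rowBox_eq a
  have e : σ⁻¹ (rowBox σ h).1 = j := by simp [rowBox]
  rw [e]
  exact entry_of_mem T h

theorem sum_box {M : Type*} [AddCommMonoid M] (F : Fin l → ℤ → M) :
    ∑ a : RowBox σ α β, F (σ⁻¹ a.1) (col a) = ∑ j, ∑ i ∈ Finset.Ioc (α j) (β j), F j i := by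
  rw [Fintype.sum_sigma, ← Equiv.sum_comp σ]
  refine Finset.sum_congr rfl fun j _ => ?_
  have e := Finset.sum_coe_sort (rowTuple (permAct σ β) (permAct σ α) (σ j))
    fun b : ℤ × ℤ => F j b.1
  have hj : σ⁻¹ (σ j) = j := σ.symm_apply_apply j
  simp only [col, hj]
  rw [e, rowTuple, Finset.sum_product]
  simp [permAct]

theorem inv_eq_fillingInv (T : RowBox σ α β → Fin n) : inv T = fillingInv σ α β (entry T) := by
  classical
  have hrow : ∀ a : RowBox σ α β, row a = 1 := by
    intro a
    obtain ⟨j, i, h, rfl⟩ := exists_rowBox_eq a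
    rfl
  have e : inv T = ∑ a : RowBox σ α β, ∑ b : RowBox σ α β,
      if ((col a = col b ∧ σ (σ⁻¹ a.1) < σ (σ⁻¹ b.1)) ∨
        (col b = col a + 1 ∧ σ (σ⁻¹ b.1) < σ (σ⁻¹ a.1))) ∧
          entry T (σ⁻¹ b.1) (col b) < entry T (σ⁻¹ a.1) (col a) then 1 else 0 := by
    rw [inv, Finset.card_filter, ← Finset.univ_product_univ, Finset.sum_product]
    refine Finset.sum_congr rfl fun a _ => Finset.sum_congr rfl fun b _ => ?_
    refine if_congr ?_ rfl rfl
    rw [entry_box, entry_box, Attacks, content, content, hrow a, hrow b, Fin.lt_def (a := T b)]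
    have hσ : ∀ r, σ (σ⁻¹ r) = r := σ.apply_symm_apply
    simp only [hσ, sub_left_inj]
    have : (col b - 1 = col a - 1 + 1) ↔ col b = col a + 1 := by omega
    rw [this]
  rw [e, sum_box (fun j i => ∑ b : RowBox σ α β,
      if ((i = col b ∧ σ j < σ (σ⁻¹ b.1)) ∨ (col b = i + 1 ∧ σ (σ⁻¹ b.1) < σ j)) ∧
          entry T (σ⁻¹ b.1) (col b) < entry T j i then 1 else 0), fillingInv]
  refine Finset.sum_congr rfl fun j _ => ?_
  symm
  rw [Finset.sum_comm]
  refine Finset.sum_congr rfl fun i _ => ?_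
  symm
  exact sum_box fun j' i' => if ((i = i' ∧ σ j < σ j') ∨ (i' = i + 1 ∧ σ j' < σ j)) ∧
          entry T j' i' < entry T j i then 1 else 0

theorem isSemistandard_iff (T : RowBox σ α β → Fin n) :
    IsSemistandard T ↔ ∀ j, MonotoneOn (entry T j) (Finset.Ioc (α j) (β j)) := by
  constructor
  · intro h j i hi i' hi' hle
    rw [Finset.mem_coe] at hi hi'
    rw [entry_of_mem T hi, entry_of_mem T hi']
    rcases hle.eq_or_lt with rfl | hlt
    · rfl
    · exact (h (rowBox σ hi) (rowBox σ hi') rfl).1 rfl hlt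
  · intro h a b hab
    obtain ⟨j, i, hi, rfl⟩ := exists_rowBox_eq a
    obtain ⟨j', i', hi', rfl⟩ := exists_rowBox_eq b
    obtain rfl : j = j' := σ.injective hab
    refine ⟨fun _ hlt => ?_, fun _ hlt => absurd hlt (lt_irrefl (1 : ℤ))⟩
    have := h j (Finset.mem_coe.2 hi) (Finset.mem_coe.2 hi') (le_of_lt hlt)
    rwa [entry_of_mem T hi, entry_of_mem T hi'] at this

/-- The number of occurrences of each letter in each row of a tableau. -/
def letterCount (T : RowBox σ α β → Fin n) (m : Fin n) (j : Fin l) : ℕ :=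
  ((Finset.Ioc (α j) (β j)).filter fun i => entry T j i = m).card

theorem sum_letterCount (T : RowBox σ α β → Fin n) (m : Fin n) :
    ∑ j, letterCount T m j = (Finset.univ.filter fun a => T a = m).card := by
  classical
  simp only [letterCount, Finset.card_filter]
  rw [← sum_box (σ := σ) fun j i => if entry T j i = m then 1 else 0]
  refine Finset.sum_congr rfl fun a _ => ?_
  rw [entry_box]
  exact if_congr Fin.ext_iff.symm rfl rfl

theorem entry_lt (T : RowBox σ α β → Fin n) {j : Fin l} {i : ℤ}
    (h : i ∈ Finset.Ioc (α j) (β j)) : entry T j i < n := by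
  rw [entry_of_mem T h]
  exact Fin.isLt _

theorem chain_letterCount (T : RowBox σ α β → Fin n) (m : ℕ) (j : Fin l) :
    chain α (letterCount T) m j =
      α j + ((Finset.Ioc (α j) (β j)).filter fun i => entry T j i < m).card := by
  rw [chain]
  congr 1
  simp only [letterCount, Finset.card_filter]
  push_cast
  have e : ∀ x : Fin n, (if (x : ℕ) < m then
      ∑ i ∈ Finset.Ioc (α j) (β j), (if entry T j i = x then (1 : ℤ) else 0) else 0) =
      ∑ i ∈ Finset.Ioc (α j) (β j),
        if entry T j i = x then (if entry T j i < m then (1 : ℤ) else 0) else 0 := by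
    intro x
    split_ifs with h
    · refine Finset.sum_congr rfl fun i _ => ?_
      split_ifs <;> first | rfl | omega
    · refine (Finset.sum_eq_zero fun i _ => ?_).symm
      split_ifs <;> first | rfl | omega
  rw [Finset.sum_congr rfl fun x _ => e x, Finset.sum_comm]
  refine Finset.sum_congr rfl fun i hi => ?_
  rw [Finset.sum_eq_single ⟨entry T j i, entry_lt T hi⟩]
  · simp
  · intro x _ hx
    exact if_neg fun h => hx (Fin.ext h.symm)
  · simp

/-- A function which is monotone on an interval takes its values less than `m` on an initial
segment. -/
theorem lt_iff_le_add_card {f : ℤ → ℕ} {a b i : ℤ} (hf : MonotoneOn f (Finset.Ioc a b))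
    (hi : i ∈ Finset.Ioc a b) (m : ℕ) :
    f i < m ↔ i ≤ a + ((Finset.Ioc a b).filter fun x => f x < m).card := by
  have hi' := Finset.mem_Ioc.1 hi
  constructor
  · intro h
    have hsub : Finset.Ioc a i ⊆ (Finset.Ioc a b).filter fun x => f x < m := by
      intro x hx
      rw [Finset.mem_Ioc] at hx
      have hx' : x ∈ Finset.Ioc a b := Finset.mem_Ioc.2 ⟨hx.1, hx.2.trans hi'.2⟩
      exact Finset.mem_filter.2
        ⟨hx', (hf (Finset.mem_coe.2 hx') (Finset.mem_coe.2 hi) hx.2).trans_lt h⟩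
    have := Finset.card_le_card hsub
    rw [Int.card_Ioc] at this
    omega
  · intro h
    by_contra hm
    have hsub : ((Finset.Ioc a b).filter fun x => f x < m) ⊆ Finset.Ioc a (i - 1) := by
      intro x hx
      obtain ⟨hx', hxm⟩ := Finset.mem_filter.1 hx
      have hlt : x < i := by
        by_contra hle
        have := hf (Finset.mem_coe.2 hi) (Finset.mem_coe.2 hx') (not_lt.1 hle)
        omega
      exact Finset.mem_Ioc.2 ⟨(Finset.mem_Ioc.1 hx').1, by omega⟩
    have := Finset.card_le_card hsub
    rw [Int.card_Ioc] at this
    omega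

/-- The boxes with letters less than `m` in a semistandard tableau form the skew shape
`P_m / α`, where `P` is the chain of the letter counts. -/
theorem entry_lt_iff {T : RowBox σ α β → Fin n} (hT : IsSemistandard T) {j : Fin l} {i : ℤ}
    (hi : i ∈ Finset.Ioc (α j) (β j)) (m : ℕ) :
    entry T j i < m ↔ i ≤ chain α (letterCount T) m j := by
  rw [chain_letterCount]
  exact lt_iff_le_add_card ((isSemistandard_iff T).1 hT j) hi m

theorem chain_letterCount_last (h : ∀ j, α j ≤ β j) (T : RowBox σ α β → Fin n) :
    chain α (letterCount T) n = β := by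
  funext j
  have e : ((Finset.Ioc (α j) (β j)).filter fun i => entry T j i < n) = Finset.Ioc (α j) (β j) :=
    Finset.filter_true_of_mem fun i hi => entry_lt T hi
  rw [chain_letterCount, e, Int.card_Ioc]
  have := h j
  omega

theorem letterCount_injective {T T' : RowBox σ α β → Fin n} (hT : IsSemistandard T)
    (hT' : IsSemistandard T') (h : letterCount T = letterCount T') : T = T' := by
  funext a
  obtain ⟨j, i, hi, rfl⟩ := exists_rowBox_eq a
  have key : ∀ m, entry T j i < m ↔ entry T' j i < m := fun m => by
    rw [entry_lt_iff hT hi, entry_lt_iff hT' hi, h]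
  rw [Fin.ext_iff, ← entry_of_mem T hi, ← entry_of_mem T' hi]
  have h1 := key (entry T j i + 1)
  have h2 := key (entry T' j i + 1)
  omega

/-- A chain from `α` to `β` gives a tableau: the letter in a box is the index of the step which
reaches the box. -/
theorem exists_letterCount_eq (σ : Equiv.Perm (Fin l)) {D : Fin n → Fin l → ℕ}
    (hD : chain α D n = β) :
    ∃ T : RowBox σ α β → Fin n, IsSemistandard T ∧ letterCount T = D := by
  classical
  have hex : ∀ a : RowBox σ α β, ∃ x : Fin n, ∀ m, (x : ℕ) < m ↔
      col a ≤ chain α D m (σ⁻¹ a.1) := by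
    intro a
    obtain ⟨j, i, hi, rfl⟩ := exists_rowBox_eq a
    have e : σ⁻¹ (rowBox σ hi).1 = j := by simp [rowBox]
    rw [e]
    change ∃ x : Fin n, ∀ m, (x : ℕ) < m ↔ i ≤ chain α D m j
    have hi' := Finset.mem_Ioc.1 hi
    have hp : ∃ m, i ≤ chain α D m j := ⟨n, hD ▸ hi'.2⟩
    have h0 : Nat.find hp ≠ 0 := by
      intro h
      have := Nat.find_spec hp
      rw [h, chain_zero] at this
      omega
    have hn : Nat.find hp ≤ n := Nat.find_min' hp (hD ▸ hi'.2)
    refine ⟨⟨Nat.find hp - 1, by omega⟩, fun m => ⟨fun h => ?_, fun h => ?_⟩⟩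
    · have h' : Nat.find hp - 1 < m := h
      exact (Nat.find_spec hp).trans (chain_monotone α D j (by omega : Nat.find hp ≤ m))
    · have := Nat.find_min' hp h
      change Nat.find hp - 1 < m
      omega
  choose T hT using hex
  have hent : ∀ j, ∀ i ∈ Finset.Ioc (α j) (β j), ∀ m, entry T j i < m ↔ i ≤ chain α D m j := by
    intro j i hi m
    have e : σ⁻¹ (rowBox σ hi).1 = j := by simp [rowBox]
    rw [entry_of_mem T hi, hT, e]
    rfl
  refine ⟨T, (isSemistandard_iff T).2 fun j i hi i' hi' hle => ?_, ?_⟩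
  · rw [← Nat.lt_succ_iff, hent j i hi]
    exact hle.trans ((hent j i' hi' _).1 (Nat.lt_succ_self _))
  · have hch : ∀ m ≤ n, chain α (letterCount T) m = chain α D m := by
      intro m hm
      funext j
      have h1 : α j ≤ chain α D m j := by
        have : chain α D 0 j ≤ chain α D m j := chain_monotone α D j (Nat.zero_le m)
        rwa [chain_zero] at this
      have h2 : chain α D m j ≤ β j := hD ▸ chain_monotone α D j hm
      have e : ((Finset.Ioc (α j) (β j)).filter fun i => entry T j i < m) =
          Finset.Ioc (α j) (chain α D m j) := by
        ext i
        rw [Finset.mem_filter, Finset.mem_Ioc (a := α j) (b := chain α D m j)]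
        constructor
        · rintro ⟨h, h'⟩
          exact ⟨(Finset.mem_Ioc.1 h).1, (hent j i h m).1 h'⟩
        · rintro ⟨h, h'⟩
          have hi : i ∈ Finset.Ioc (α j) (β j) := Finset.mem_Ioc.2 ⟨h, h'.trans h2⟩
          exact ⟨hi, (hent j i hi m).2 h'⟩
      rw [chain_letterCount, e, Int.card_Ioc]
      omega
    funext m
    have h1 := chain_succ α (letterCount T) m
    rw [hch _ m.isLt, hch _ m.isLt.le, chain_succ] at h1
    exact (natWeight_injective (add_left_cancel h1)).symm

/-- The chains from `α` to `β` correspond to the semistandard tableaux on `σ(β/α)` by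
`letterCount`, and the exponents are compared by `pairExponent_eq_fillingInv_add`. -/
theorem sum_chains_eq_sum_ssyt {𝕜 : Type*} [Field 𝕜] {t : 𝕜} (ht : t ≠ 0) (σ : Equiv.Perm (Fin l))
    (h : ∀ j, α j ≤ β j) (d : Fin n → ℕ) :
    (∑ D ∈ Fintype.piFinset fun m => Finset.piAntidiag Finset.univ (d m),
      if chain α D n = β then
        (t ^ ∑ m ∈ Finset.range n, pairExponent σ (chain α D m) (chain α D (m + 1)))⁻¹ else 0) =
      (t ^ pairExponent σ α β)⁻¹ *
        ∑ T ∈ ssyt (rowTuple (permAct σ β) (permAct σ α)) n,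
          if ∀ m, (Finset.univ.filter fun a => T a = m).card = d m then t ^ inv T else 0 := by
  classical
  rw [← Finset.sum_filter, ← Finset.sum_filter, Finset.mul_sum]
  symm
  have hss : ∀ T, T ∈ (ssyt (rowTuple (permAct σ β) (permAct σ α)) n).filter
      (fun T => ∀ m, (Finset.univ.filter fun a => T a = m).card = d m) ↔
      IsSemistandard T ∧ ∀ m, ∑ j, letterCount T m j = d m := by
    intro T
    simp only [Finset.mem_filter, ssyt, Finset.mem_univ, true_and, sum_letterCount]
  refine Finset.sum_bij (fun T _ => letterCount T) ?_ ?_ ?_ ?_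
  · intro T hT
    rw [Finset.mem_filter, Fintype.mem_piFinset]
    exact ⟨fun m => mem_piAntidiag_univ.2 (((hss T).1 hT).2 m), chain_letterCount_last h T⟩
  · intro T hT T' hT' e
    exact letterCount_injective ((hss T).1 hT).1 ((hss T').1 hT').1 e
  · intro D hD
    rw [Finset.mem_filter, Fintype.mem_piFinset] at hD
    obtain ⟨T, hT, hTD⟩ := exists_letterCount_eq σ hD.2
    refine ⟨T, (hss T).2 ⟨hT, fun m => ?_⟩, hTD⟩
    rw [hTD]
    exact mem_piAntidiag_univ.1 (hD.1 m)
  · intro T hT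
    rw [pairExponent_eq_fillingInv_add σ (chain_monotone α (letterCount T)) (chain_zero _ _)
      (chain_letterCount_last h T) fun j i hi m => entry_lt_iff ((hss T).1 hT).1 hi m,
      ← inv_eq_fillingInv, pow_add, mul_inv, mul_right_comm, inv_mul_cancel₀ (pow_ne_zero _ ht),
      one_mul]

end Tableaux

/-! ### The polynomial part of an LLT series -/

section Series

variable {𝕜 : Type*} [Field 𝕜] {l : ℕ}

/-- The basis of the twisted non-symmetric Hall–Littlewood polynomials. -/
def twistedHLBasis {t : 𝕜} (ht : t ≠ 0) (σ : Equiv.Perm (Fin l)) :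
    Module.Basis (Weight l) 𝕜 (LaurentPoly 𝕜 l) :=
  Module.Basis.mk (linearIndependent_twistedHL ht σ) (span_twistedHL ht σ).ge

theorem twistedHLCoeff_eq_coord {t : 𝕜} (ht : t ≠ 0) (σ : Equiv.Perm (Fin l)) (β : Weight l)
    (f : LaurentPoly 𝕜 l) : twistedHLCoeff t σ β f = (twistedHLBasis ht σ).coord β f := by
  have hf : Finsupp.linearCombination 𝕜 (twistedHL t σ) ((twistedHLBasis ht σ).repr f) = f := by
    conv_rhs => rw [← (twistedHLBasis ht σ).linearCombination_repr f]
    rw [twistedHLBasis, Module.Basis.coe_mk]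
  have hinj : Function.Injective (Finsupp.linearCombination 𝕜 (twistedHL t σ)) :=
    linearIndependent_twistedHL ht σ
  rw [twistedHLCoeff, Module.Basis.coord_apply]
  conv_lhs => rw [← hf]
  rw [Function.leftInverse_invFun hinj]

theorem coord_twistedHL {t : 𝕜} (ht : t ≠ 0) (σ : Equiv.Perm (Fin l)) (β μ : Weight l) :
    (twistedHLBasis ht σ).coord β (twistedHL t σ μ) = if μ = β then 1 else 0 := by
  have e : twistedHL t σ μ = twistedHLBasis ht σ μ := by rw [twistedHLBasis, Module.Basis.mk_apply]
  rw [e, Module.Basis.coord_apply, Module.Basis.repr_self, Finsupp.single_apply]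

/-- The coefficient of `x^d` in the polynomial part is the coefficient of `E_β` in the product of
`E_α` by complete symmetric functions, hence a sum over chains from `α` to `β`. -/
theorem polPart_lltSeries [CharZero 𝕜] {q : 𝕜} (hq : q ≠ 0) (σ : Equiv.Perm (Fin l))
    (α β : Weight l) (d : Fin l →₀ ℕ) :
    MvPowerSeries.coeff d (polPart (lltSeries q σ β α)) =
      ∑ D ∈ Fintype.piFinset fun m => Finset.piAntidiag Finset.univ (d m),
        if chain α D l = β then
          (q⁻¹ ^ ∑ m ∈ Finset.range l, pairExponent σ (chain α D m) (chain α D (m + 1)))⁻¹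
        else 0 := by
  have ht : q⁻¹ ≠ 0 := inv_ne_zero hq
  have e : MvPowerSeries.coeff d (polPart (lltSeries q σ β α)) =
      (twistedHLBasis ht σ⁻¹).coord β ((∏ m, hsymmL 𝕜 l (d m)) * twistedHL q⁻¹ σ⁻¹ α) := by
    rw [← sum_coeff_smul_irrChar, Finset.sum_mul, map_sum]
    refine Finset.sum_congr rfl fun μ _ => ?_
    rw [smul_mul_assoc, map_smul, lltSeries, twistedHLCoeff_eq_coord ht, smul_eq_mul, mul_comm]
    rfl
  rw [e, prod_hsymmL_mul_twistedHL ht, map_sum]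
  refine Finset.sum_congr rfl fun D _ => ?_
  rw [map_smul, coord_twistedHL, smul_eq_mul, mul_ite, mul_one, mul_zero]

theorem coeff_combLLT {k : ℕ} (n : ℕ) (ν : DiagramTuple k) (t : 𝕜) (d : Fin n →₀ ℕ) :
    (combLLT n ν t).coeff d = ∑ T ∈ ssyt ν n,
      if ∀ m, (Finset.univ.filter fun a => T a = m).card = d m then t ^ inv T else 0 := by
  classical
  rw [combLLT, MvPolynomial.coeff_sum]
  refine Finset.sum_congr rfl fun T _ => ?_
  have e : ∏ a : ν.Box, (MvPolynomial.X (T a) : MvPolynomial (Fin n) 𝕜) =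
      MvPolynomial.monomial (∑ a : ν.Box, Finsupp.single (T a) 1) 1 := by
    rw [MvPolynomial.monomial_sum_one]
    rfl
  rw [e, MvPolynomial.coeff_C_mul, MvPolynomial.coeff_monomial, mul_ite, mul_one, mul_zero]
  refine if_congr ?_ rfl rfl
  rw [Finsupp.ext_iff]
  refine forall_congr' fun m => ?_
  rw [Finsupp.finsetSum_apply, Finset.card_filter]
  simp only [Finsupp.single_apply]

end Series

end LLT

end

theorem mainTheorem4 {𝕜 : Type*} [Field 𝕜] [Algebra ℚ 𝕜] (q : 𝕜) (hq : Transcendental ℚ q)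
    (l : ℕ) (α β : Fin l → ℤ) (σ : Equiv.Perm (Fin l)) :
    (LinearIndependent 𝕜 (LLT.twistedHL q⁻¹ σ⁻¹) ∧
      Submodule.span 𝕜 (Set.range (LLT.twistedHL q⁻¹ σ⁻¹)) = ⊤) ∧
    LLT.polPart (LLT.lltSeries q σ β α) =
      if ∀ i, α i ≤ β i then
        ((MvPolynomial.C (q ^ LLT.hSigma σ β α) *
          LLT.combLLT l (LLT.rowTuple (LLT.permAct σ β) (LLT.permAct σ α)) q⁻¹ :
            MvPolynomial (Fin l) 𝕜) : MvPowerSeries (Fin l) 𝕜)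
      else 0 := by
  have hq0 : q ≠ 0 := by
    rintro rfl
    exact hq isAlgebraic_zero
  have ht : q⁻¹ ≠ 0 := inv_ne_zero hq0
  have : CharZero 𝕜 := algebraRat.charZero 𝕜
  refine ⟨⟨LLT.linearIndependent_twistedHL ht σ⁻¹, LLT.span_twistedHL ht σ⁻¹⟩, ?_⟩
  ext d
  rw [LLT.polPart_lltSeries hq0]
  split_ifs with h
  · rw [MvPolynomial.coeff_coe, MvPolynomial.coeff_C_mul, LLT.coeff_combLLT,
      LLT.sum_chains_eq_sum_ssyt ht σ h, LLT.hSigma_eq_pairExponent, inv_pow, inv_inv]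
  · -- A chain from `α` to `β` would force `α ≤ β`.
    rw [map_zero]
    refine Finset.sum_eq_zero fun D _ => if_neg fun hD => h fun j => ?_
    have hj : LLT.chain α D 0 j ≤ LLT.chain α D l j := LLT.chain_monotone α D j (Nat.zero_le l)
    rwa [LLT.chain_zero, hD] at hj
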